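/- **Setting.** Let $r\ge 1$, let $K$ be a finite abelian group and $\Bbbk\in K$. Let $R=\mathbb Z_r\times_\beta K$ be the group of pairs $(a,k)$ with $a\in\mathbb Z_r$, $k\in K$ and addition $(a,k)+(b,l)=(a+b,\;k+l+\beta(a,b))$, where, for representatives $0\le a,b<r$, $\beta(a,b)=\Bbbk$ if $a+b\ge r$ and $\beta(a,b)=0$ otherwise; so $|R|=r|K|$. Let $K^*$ be the group of characters of $K$, and for each $\gamma\in K^*$ fix an $r$-th root of $\gamma(-\Bbbk)\,r$; its $a$-th power is denoted $(\gamma(-\Bbbk)r)^{a/r}$. Let $\bigwedge^{\infty/2}V$ be the infinite wedge, with basis the vectors $\underline{i_1}\wedge\underline{i_2}\wedge\cdots$, where $i_1>i_2>\cdots$ are half-integers containing all but finitely many of the negative ones and only finitely many positive ones. Let $\psi_j$ be wedging with $\underline j$ from the left, $\psi_j^*$ its adjoint, and $E_{i,j}=\psi_i\psi_j^*$ for $j>0$, $E_{i,j}=-\psi_j^*\psi_i$ for $j<0$. Put $\varsigma(x)=e^{x/2}-e^{-x/2}$, $\mathcal S(x)=\varsigma(x)/x$, and, for $m\in\mathbb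 Z$, $$\mathcal E_m(x)=\sum_{l\in\mathbb Z+\frac12}e^{x(l-m/2)}E_{l-m,l}+\frac{\delta_{m,0}}{\varsigma(x)} .$$ Let $\bigwedge_0$ be the charge zero subspace, with orthonormal basis the basis wedges of charge zero. On $\mathcal Z_K=\bigotimes_{\gamma\in K^*}\bigwedge_0$, with the tensor product basis and vacuum vector $v_\emptyset$ (the tensor power of $\underline{-\tfrac12}\wedge\underline{-\tfrac32}\wedge\cdots$), let $\mathcal E^\gamma_m$ be $\mathcal E_m$ acting on the factor $\gamma$. With $(x+1)_i=(x+1)\cdots(x+i)$ for $i\ge0$ and $(x+1)_i=\big(x(x-1)\cdots(x+i+1)\big)^{-1}$ for $i\le 0$, define for $0\le a<r$ $$\mathcal A^\gamma_{a/r}(z,u)=\frac{z\,(\gamma(-\Bbbk)r)^{a/r}}{z+a}\,\mathcal S(|R|uz)^{\frac{z+a}{r}}\sum_{i\in\mathbb Z}\frac{z^i\,\mathcal S(|R|uz)^i}{\big(1+\frac{z+a}{r}\big)_i}\,\mathcal E^\gamma_{ir+a}(|K|uz),$$ $$\mathcal A_{(a,k)}(z,u)=\sum_{\gamma\in K^*}\gamma(-k)\,\mathcal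 A^\gamma_{a/r}(z,u).$$ Matrix elements of these operators between basis vectors are expanded at $z=0$ as Laurent series in $z$ with coefficients Laurent series in $u$. For $\mathfrak r_1,\dots,\mathfrak r_n\in R$, the vacuum expectation $$F_{\mathfrak r}(z,u)=\big\langle\mathcal A_{\mathfrak r_1}(z_1,u)\cdots\mathcal A_{\mathfrak r_n}(z_n,u)\big\rangle=\big(\mathcal A_{\mathfrak r_1}(z_1,u)\cdots\mathcal A_{\mathfrak r_n}(z_n,u)\,v_\emptyset,\,v_\emptyset\big)$$ is the formal series in the $z_i^{\pm1}$ obtained by multiplying matrix elements and summing over intermediate basis vectors. **Statement.** Let $n\ge0$ and $\mathfrak r_1,\dots,\mathfrak r_n\in R$. Each coefficient of a monomial $z_1^{p_1}\cdots z_n^{p_n}$ in the sum defining $F_{\mathfrak r}$ receives only finitely many nonzero contributions, and $F_{\mathfrak r}$ is an iterated Laurent series in $z_n,z_{n-1},\dots,z_1$, i.e. it lies in $\mathbb C((u))((z_n))((z_{n-1}))\cdots((z_1))$. Moreover: 1. For every $m\in\mathbb Z$, the coefficient $[u^m]F_{\mathfrak r}\in\mathbb C((z_n))\cdots((z_1))$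 is (the expansion of) a rational function of $z_1,\dots,z_n$ of the form $$\frac{P_m(z_1,\dots,z_n)}{\prod_{i<j,\ \mathfrak r_i+\mathfrak r_j=0}(z_i+z_j)\ \prod_{i:\ \mathfrak r_i=0}z_i},\qquad P_m\in\mathbb C[z_1,\dots,z_n];$$ that is, its only poles are at most simple poles along the divisors $z_i+z_j=0$ with $i\neq j$, $\mathfrak r_i+\mathfrak r_j=0$, and along the divisors $z_i=0$ with $\mathfrak r_i=0$. 2. The series $$\Big(\prod_{i<j,\ \mathfrak r_i+\mathfrak r_j=0}(z_i+z_j)\Big)\big\langle\mathcal A_{\mathfrak r_1}(z_1,u)\cdots\mathcal A_{\mathfrak r_n}(z_n,u)\big\rangle$$ is independent of the ordering of the pairs $(z_i,\mathfrak r_i)$: for every permutation $\sigma$, replacing the product of operators by $\mathcal A_{\mathfrak r_{\sigma(1)}}(z_{\sigma(1)},u)\cdots\mathcal A_{\mathfrak r_{\sigma(n)}}(z_{\sigma(n)},u)$ gives the same formal series. 3. This series is an element of $\prod_{i:\ \mathfrak r_i=0}z_i^{-1}\;\mathbb C[u^{\pm1}][[z_1,\dots,z_n]]$. -/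

import Mathlib

noncomputable section

namespace OrbiFock

/-! ### The group extension `R = ℤ_r ×_β K` -/

/-- The underlying set `ℤ_r × K` of the extension of `ℤ_r` by `K` determined by `κ ∈ K`. -/
@[ext]
structure Ext (r : ℕ) (K : Type*) (κ : K) where
  a : ZMod r
  k : K

section ExtGroup

variable {r : ℕ} {K : Type*} [AddCommGroup K]

/-- The cocycle: `β(a, b) = κ` if adding the representatives `0 ≤ a, b < r` produces a carry, and
`0` otherwise. -/
def cocycle (κ : K) (a b : ZMod r) : K := if r ≤ a.val + b.val then κ else 0

theorem cocycle_comm (κ : K) (a b : ZMod r) : cocycle κ a b = cocycle κ b a := by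
  simp only [cocycle, add_comm]

theorem cocycle_assoc [NeZero r] (κ : K) (a b c : ZMod r) :
    cocycle κ a b + cocycle κ (a + b) c = cocycle κ b c + cocycle κ a (b + c) := by
  have ha := a.val_lt
  have hb := b.val_lt
  have hc := c.val_lt
  unfold cocycle
  by_cases h1 : r ≤ a.val + b.val <;> by_cases h2 : r ≤ b.val + c.val
  · have e1 := ZMod.val_add_val_of_le h1
    have e2 := ZMod.val_add_val_of_le h2
    have h3 : (r ≤ (a + b).val + c.val) ↔ (r ≤ a.val + (b + c).val) := by omega
    simp [h1, h2, h3]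
  · have e1 := ZMod.val_add_val_of_le h1
    have e2 := ZMod.val_add_of_lt (not_le.mp h2)
    have h3 : ¬ (r ≤ (a + b).val + c.val) := by omega
    have h4 : (r ≤ a.val + (b + c).val) := by omega
    simp [h1, h2, h3, h4]
  · have e1 := ZMod.val_add_of_lt (not_le.mp h1)
    have e2 := ZMod.val_add_val_of_le h2
    have h3 : (r ≤ (a + b).val + c.val) := by omega
    have h4 : ¬ (r ≤ a.val + (b + c).val) := by omega
    simp [h1, h2, h3, h4]
  · have e1 := ZMod.val_add_of_lt (not_le.mp h1)
    have e2 := ZMod.val_add_of_lt (not_le.mp h2)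
    have h3 : (r ≤ (a + b).val + c.val) ↔ (r ≤ a.val + (b + c).val) := by omega
    simp [h1, h2, h3]

theorem cocycle_zero_left [NeZero r] (κ : K) (a : ZMod r) : cocycle κ 0 a = 0 := by
  have ha := a.val_lt
  simp [cocycle, ZMod.val_zero, ha]

/-- The group law of `ℤ_r ×_β K`:  `(a, k) + (b, l) = (a + b, k + l + β(a, b))`. -/
instance (κ : K) : Add (Ext r K κ) :=
  ⟨fun x y => ⟨x.a + y.a, x.k + y.k + cocycle κ x.a y.a⟩⟩

instance (κ : K) : Zero (Ext r K κ) := ⟨⟨0, 0⟩⟩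

instance (κ : K) : Neg (Ext r K κ) := ⟨fun x => ⟨-x.a, -x.k - cocycle κ (-x.a) x.a⟩⟩

instance [NeZero r] (κ : K) : AddCommGroup (Ext r K κ) where
  nsmul := nsmulRec
  zsmul := zsmulRec
  add_assoc x y z := by
    apply Ext.ext
    · exact add_assoc _ _ _
    · change x.k + y.k + cocycle κ x.a y.a + z.k + cocycle κ (x.a + y.a) z.a
        = x.k + (y.k + z.k + cocycle κ y.a z.a) + cocycle κ x.a (y.a + z.a)
      have h := cocycle_assoc κ x.a y.a z.a
      calc _ = x.k + y.k + z.k + (cocycle κ x.a y.a + cocycle κ (x.a + y.a) z.a) := by abel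
        _ = x.k + y.k + z.k + (cocycle κ y.a z.a + cocycle κ x.a (y.a + z.a)) := by rw [h]
        _ = _ := by abel
  zero_add x := by
    apply Ext.ext
    · exact zero_add _
    · change 0 + x.k + cocycle κ 0 x.a = x.k
      rw [cocycle_zero_left]; abel
  add_zero x := by
    apply Ext.ext
    · exact add_zero _
    · change x.k + 0 + cocycle κ x.a 0 = x.k
      rw [cocycle_comm, cocycle_zero_left]; abel
  neg_add_cancel x := by
    apply Ext.ext
    · exact neg_add_cancel _
    · change -x.k - cocycle κ (-x.a) x.a + x.k + cocycle κ (-x.a) x.a = 0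
      abel
  add_comm x y := by
    apply Ext.ext
    · exact add_comm _ _
    · change x.k + y.k + cocycle κ x.a y.a = y.k + x.k + cocycle κ y.a x.a
      rw [cocycle_comm κ y.a x.a]; abel

end ExtGroup

/-! ### The infinite wedge

Throughout, the integer `m` stands for the half-integer `m + 1/2`; so `m + 1/2 > 0` iff `0 ≤ m`. -/

/-- The set `{i₁ > i₂ > ⋯}` of half-integers occurring in a basis vector `i₁ ∧ i₂ ∧ ⋯`
of the infinite wedge. -/
@[ext]
structure Maya where
  carrier : Set ℤ
  finite_pos : {m : ℤ | 0 ≤ m ∧ m ∈ carrier}.Finite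
  finite_neg : {m : ℤ | m < 0 ∧ m ∉ carrier}.Finite

namespace Maya

/-- The vacuum `-1/2 ∧ -3/2 ∧ -5/2 ∧ ⋯`. -/
def vacuum : Maya where
  carrier := {m | m < 0}
  finite_pos := by
    convert Set.finite_empty (α := ℤ)
    ext m; simp
  finite_neg := by
    convert Set.finite_empty (α := ℤ)
    ext m; simp

def insert (S : Maya) (j : ℤ) : Maya where
  carrier := Insert.insert j S.carrier
  finite_pos := (S.finite_pos.insert j).subset (by
    rintro m ⟨h1, h2⟩
    rcases h2 with h2 | h2
    · exact Or.inl h2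
    · exact Or.inr ⟨h1, h2⟩)
  finite_neg := S.finite_neg.subset (by
    rintro m ⟨h1, h2⟩
    exact ⟨h1, fun h => h2 (Or.inr h)⟩)

def erase (S : Maya) (j : ℤ) : Maya where
  carrier := S.carrier \ {j}
  finite_pos := S.finite_pos.subset (by
    rintro m ⟨h1, h2⟩
    exact ⟨h1, h2.1⟩)
  finite_neg := (S.finite_neg.insert j).subset (by
    rintro m ⟨h1, h2⟩
    by_cases h : m = j
    · exact Or.inl h
    · exact Or.inr ⟨h1, fun hm => h2 ⟨hm, h⟩⟩)

/-- `(-1)` to the number of elements greater than `j`. -/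
def sign (S : Maya) (j : ℤ) : ℂ := (-1) ^ {m : ℤ | m ∈ S.carrier ∧ j < m}.ncard

/-- The charge, i.e. the eigenvalue of the charge operator on the basis vector. -/
def charge (S : Maya) : ℤ :=
  ({m : ℤ | 0 ≤ m ∧ m ∈ S.carrier}.ncard : ℤ) - ({m : ℤ | m < 0 ∧ m ∉ S.carrier}.ncard : ℤ)

end Maya

/-- The infinite wedge space, with its basis of wedges. -/
abbrev Wedge : Type := Maya →₀ ℂ

open Classical in
/-- The creation operator `ψ_j`, i.e. wedging on the left with the basis vector `j`. -/
def psi (j : ℤ) : Wedge →ₗ[ℂ] Wedge :=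
  Finsupp.linearCombination ℂ fun S : Maya =>
    if j ∈ S.carrier then (0 : Wedge) else Finsupp.single (S.insert j) (S.sign j)

open Classical in
/-- The annihilation operator `ψ_j^*`. -/
def psiStar (j : ℤ) : Wedge →ₗ[ℂ] Wedge :=
  Finsupp.linearCombination ℂ fun S : Maya =>
    if j ∈ S.carrier then Finsupp.single (S.erase j) (S.sign j) else (0 : Wedge)

/-- The normally ordered operator `E_{i,j} = :ψ_i ψ_j^*:`. -/
def elemOp (i j : ℤ) : Wedge →ₗ[ℂ] Wedge :=
  if 0 ≤ j then psi i ∘ₗ psiStar j else -(psiStar j ∘ₗ psi i)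

/-- The orthonormal basis `v_λ` of the charge zero subspace, indexed by the wedges of charge
zero (equivalently, by partitions: `λ` gives `λ_1 - 1/2, λ_2 - 3/2, ...`). -/
abbrev Maya0 : Type := {S : Maya // S.charge = 0}

theorem charge_vacuum : Maya.vacuum.charge = 0 := by
  have h1 : {m : ℤ | 0 ≤ m ∧ m ∈ Maya.vacuum.carrier} = ∅ := by
    ext m; simp [Maya.vacuum]
  have h2 : {m : ℤ | m < 0 ∧ m ∉ Maya.vacuum.carrier} = ∅ := by
    ext m; simp [Maya.vacuum]
  simp [Maya.charge, h1, h2]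

/-- The vacuum vector of the charge zero subspace. -/
def vac0 : Maya0 := ⟨Maya.vacuum, charge_vacuum⟩

/-! ### Formal series in `u` and `z` -/

/-- The field `ℂ((u))` of Laurent series in `u`. -/
def USeries : Type := LaurentSeries ℂ

instance : Field USeries := inferInstanceAs (Field (LaurentSeries ℂ))

instance : Algebra ℂ USeries := inferInstanceAs (Algebra ℂ (LaurentSeries ℂ))

/-- The coefficient of `u ^ m`. -/
def USeries.coeffHom (m : ℤ) : USeries →+ ℂ :=
  (HahnSeries.coeff.addMonoidHom m : LaurentSeries ℂ →+ ℂ)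

/-- Laurent series in `z` whose coefficients are Laurent series in `u`. -/
abbrev ZSeries : Type := LaurentSeries USeries

def uVar : USeries := (HahnSeries.single 1 1 : LaurentSeries ℂ)

def zVar : ZSeries := HahnSeries.single 1 1

/-- A Laurent series in `u`, seen as constant in `z`. -/
def const (c : USeries) : ZSeries := HahnSeries.C c

/-- A complex number, seen as a constant series. -/
def scalar (c : ℂ) : ZSeries := const (algebraMap ℂ USeries c)

/-- `exp (c z)` -/
def expZ (c : USeries) : ZSeries :=
  ((PowerSeries.mk fun k : ℕ => c ^ k / (k.factorial : USeries) : PowerSeries USeries) : ZSeries)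

/-- `ς(c z) = exp (c z / 2) - exp (- c z / 2)` -/
def sigmaZ (c : USeries) : ZSeries := expZ (c / 2) - expZ (-(c / 2))

/-- `𝒮(c z) = ς(c z) / (c z)` -/
def calS (c : USeries) : ZSeries := sigmaZ c / (const c * zVar)

/-- The binomial coefficient `x (x - 1) ⋯ (x - k + 1) / k!`. -/
def binom (x : ZSeries) (k : ℕ) : ZSeries :=
  (∏ j ∈ Finset.range k, (x - (j : ZSeries))) / (k.factorial : ZSeries)

/-- The power `f ^ x = ∑ₖ binom x k (f - 1) ^ k`, for `f ∈ 1 + z USeries[[z]]` and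
`x ∈ USeries[[z]]`: as `(f - 1) ^ k` is divisible by `z ^ k`, the terms with `k ≤ N` determine
the coefficient of `z ^ N`. -/
def powZ (f x : ZSeries) : ZSeries :=
  ((PowerSeries.mk fun N : ℕ =>
    (∑ k ∈ Finset.range (N + 1), binom x k * (f - 1) ^ k).coeff (N : ℤ) :
      PowerSeries USeries) : ZSeries)

/-- The Pochhammer symbol `(x + 1)_n` for `n ∈ ℤ`. -/
def poch (x : ZSeries) : ℤ → ZSeries
  | Int.ofNat n => ∏ j ∈ Finset.range n, (x + ((j + 1 : ℕ) : ZSeries))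
  | Int.negSucc n => (∏ j ∈ Finset.range (n + 1), (x - ((j : ℕ) : ZSeries)))⁻¹

/-! ### The operators -/

open Classical in
/-- The matrix element `(𝓔_k(c z) v_S, v_T)` of
`𝓔_k(c z) = ∑_l exp (c z (l - k / 2)) E_{l-k,l} + δ_{k,0} / ς(c z)`, the sum being over
half-integers. For given `S` and `T` only finitely many terms are nonzero. -/
def calE (c : USeries) (k : ℤ) (S T : Maya0) : ZSeries :=
  (∑ᶠ l : ℤ, scalar (elemOp (l - k) l (Finsupp.single S.1 1) T.1) *
      expZ (c * algebraMap ℂ USeries ((l : ℂ) + 1 / 2 - (k : ℂ) / 2)))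
    + if k = 0 ∧ S = T then (sigmaZ c)⁻¹ else 0

section Operators

variable (r : ℕ) (K : Type*) [AddCommGroup K]

/-- Index set of the orthonormal basis of `⨂_γ Λ₀`, where `γ` runs over the characters of `K`. -/
abbrev State : Type _ := AddChar K ℂ → Maya0

def vacState : State K := fun _ => vac0

open Classical in
/-- Matrix elements of `M^γ = Id ⊗ ⋯ ⊗ M ⊗ ⋯ ⊗ Id`, with `M` in the factor labelled `γ`. -/
def onFactor (γ : AddChar K ℂ) (M : Maya0 → Maya0 → ZSeries) (Λ Λ' : State K) : ZSeries :=
  if ∀ γ', γ' ≠ γ → Λ γ' = Λ' γ' then M (Λ γ) (Λ' γ) else 0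

/-- The order `|K|`, as a coefficient. -/
def ordK : USeries := (Nat.card K : USeries)

/-- The order `|R| = r |K|`, as a coefficient. -/
def ordR : USeries := (r : USeries) * (Nat.card K : USeries)

/-- Matrix elements `(𝓐^γ_{a/r}(z,u) v_Λ, v_Λ')`, where
`𝓐^γ_{a/r}(z,u) = z ρ^a / (z + a) · 𝒮(|R|uz)^{(z+a)/r} ·
  ∑_{i ∈ ℤ} z^i 𝒮(|R|uz)^i / (1 + (z+a)/r)_i · 𝓔^γ_{ir+a}(|K|uz)`
and `ρ = ρ_γ` is an `r`-th root of `γ(-κ) r`. For given `Λ` and `Λ'` at most one term of the sum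
over `i` is nonzero. -/
def opChar (ρ : AddChar K ℂ → ℂ) (γ : AddChar K ℂ) (a : ℕ) (Λ Λ' : State K) : ZSeries :=
  scalar (ρ γ ^ a) * (zVar / (zVar + (a : ZSeries)) *
    powZ (calS (ordR r K * uVar)) ((zVar + (a : ZSeries)) / (r : ZSeries)) *
    ∑ᶠ i : ℤ, zVar ^ i * calS (ordR r K * uVar) ^ i /
      poch ((zVar + (a : ZSeries)) / (r : ZSeries)) i *
      onFactor K γ (calE (ordK K * uVar) (i * r + a)) Λ Λ')

variable {K} [Finite K] {κ : K}

/-- Matrix elements of `𝓐_{(a,k)}(z,u) = ∑_γ γ(-k) 𝓐^γ_{a/r}(z,u)`, where `0 ≤ a < r`. -/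
def opA (ρ : AddChar K ℂ → ℂ) (x : Ext r K κ) (Λ Λ' : State K) : ZSeries :=
  ∑ γ : AddChar K ℂ, scalar (γ (-x.k)) * opChar r K ρ γ x.a.val Λ Λ'

/-- Sequences of basis vectors `Λ⁰, …, Λⁿ` that start and end at the vacuum. -/
def VacuumPath (K : Type*) [AddCommGroup K] (n : ℕ) : Type _ :=
  {Λ : Fin (n + 1) → State K // Λ 0 = vacState K ∧ Λ (Fin.last n) = vacState K}

/-- The contribution of the intermediate vectors `Λ⁰, …, Λⁿ` to the coefficient of
`z_1^{p_1} ⋯ z_n^{p_n}` in `⟨𝓐_{x_1}(z_1,u) ⋯ 𝓐_{x_n}(z_n,u)⟩`, that is, this coefficient of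
`∏_j (𝓐_{x_j}(z_j,u) Λ^j, Λ^{j-1})`. -/
def pathTerm (ρ : AddChar K ℂ → ℂ) {n : ℕ} (x : Fin n → Ext r K κ) (p : Fin n → ℤ)
    (Λ : VacuumPath K n) : USeries :=
  ∏ j : Fin n, (opA r ρ (x j) (Λ.1 j.succ) (Λ.1 j.castSucc)).coeff (p j)

end Operators

/-! ### Iterated Laurent series in several variables -/

/-- The iterated Laurent series `A((z_n))⋯((z_1))`: formal series in `z_1^{±1}, …, z_n^{±1}`
whose set of exponents is well-ordered lexicographically, the exponent of `z_1` being compared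
first. If `A` is a field, so is this ring. -/
abbrev IterLaurent (n : ℕ) (A : Type*) [Zero A] : Type _ := HahnSeries (Lex (Fin n → ℤ)) A

/-- The inclusion of the polynomials in `z_1, …, z_n`. -/
def ofPoly {n : ℕ} (A : Type*) [CommRing A] [Algebra ℂ A] :
    MvPolynomial (Fin n) ℂ →ₐ[ℂ] IterLaurent n A :=
  MvPolynomial.aeval fun i => HahnSeries.single (toLex (Pi.single i (1 : ℤ))) (1 : A)

/-- The coefficient of `u ^ m`, taken in each coefficient of `F`. -/
def uCoeff {n : ℕ} (m : ℤ) (F : IterLaurent n USeries) : IterLaurent n ℂ :=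
  F.map (USeries.coeffHom m)

section Statement

variable {r : ℕ} {K : Type*} [AddCommGroup K] {κ : K}

/-- `F = ⟨𝓐_{x_1}(z_1,u) ⋯ 𝓐_{x_n}(z_n,u)⟩` as an iterated Laurent series: each coefficient of
the vacuum expectation is a sum over intermediate basis vectors with only finitely many nonzero
terms, and `F` has these coefficients. -/
def IsVacuumExpectation [Finite K] (ρ : AddChar K ℂ → ℂ) {n : ℕ}
    (x : Fin n → Ext r K κ) (F : IterLaurent n USeries) : Prop :=
  ∀ p : Fin n → ℤ, (Function.support (pathTerm r ρ x p)).Finite ∧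
    F.coeff (toLex p) = ∑ᶠ Λ : VacuumPath K n, pathTerm r ρ x p Λ

open Classical in
/-- `∏ (z_i + z_j)` over the pairs `i < j` with `x_i + x_j = 0`. -/
def pairFactor [NeZero r] {n : ℕ} (x : Fin n → Ext r K κ) : MvPolynomial (Fin n) ℂ :=
  ∏ q ∈ (Finset.univ : Finset (Fin n × Fin n)).filter (fun q => q.1 < q.2 ∧ x q.1 + x q.2 = 0),
    (MvPolynomial.X q.1 + MvPolynomial.X q.2)

open Classical in
/-- `∏ z_i` over the `i` with `x_i = 0`. -/
def zeroFactor [NeZero r] {n : ℕ} (x : Fin n → Ext r K κ) : MvPolynomial (Fin n) ℂ :=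
  ∏ i ∈ (Finset.univ : Finset (Fin n)).filter (fun i => x i = 0), MvPolynomial.X i

/-- The series `∏_{i<j, x_i+x_j=0} (z_i + z_j) · F`. -/
def cleared [NeZero r] {n : ℕ} (x : Fin n → Ext r K κ) (F : IterLaurent n USeries) :
    IterLaurent n USeries :=
  ofPoly USeries (pairFactor x) * F

end Statement

end OrbiFock

end

/-!
Multiplied by `∏ (z_i + z_j)` over the pairs with `x_i + x_j = 0`, the vacuum expectation becomes
symmetric, and symmetry spreads the bounds available for the outermost operators to all variables.

**Commutators.** The coefficient of `z ^ p` of a vertex operator is a column-finite matrix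
(`vertexOp`, `stateOp`). The canonical anticommutation relations give the commutator of two modes
`𝓔_k(c z)` and `𝓔_l(c w)` as a multiple of `𝓔_{k+l}(c (z + w))` plus a central term
(`regE_commutator`). In the commutator of two vertex operators on one tensor factor, the coefficient
of a given `𝓔_{mr+a+b}(c (z + w))` is then a bilateral sum over the modes `i` and `m - i`. With
`x = (z + a) / r` and `y = (w + b) / r`, this sum is the difference of two sums
`∑ᵢ z ^ i * w ^ (m - i) * f ^ (x + i) * g ^ (y + m - i) / ((x + 1)_i * (y + 1)_{m - i})`, one for each
of two pairs of bases `(f, g)`. Expanding the powers by the binomial series and using that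
`binom (x + i) s / (x + 1)_i = 1 / (s! * (x + 1)_{i - s})`, one finds a series in the powers of
`z (f - 1) + w (g - 1)` (`biSum_pw_mul_pw`), and this combination is the same for the two pairs
(`bases_symm`). So the non-central part cancels (`biSum_coreCoeff_mul_sub`), and the commutator is a
scalar (`vertexEnt_commutator`). The central term times `ς(c (z + w))` is a sum of the same kind, and
therefore the scalar is annihilated by `z + w` (`vertexBracket_add`): it is a multiple of the formal
delta function supported on `z + w = 0`.

**Characters.** The commutator of `𝓐_x` and `𝓐_y` is this scalar times a sum over the characters `γ`,
which is proportional to `∑ γ(-(x + y))`, the relation `ρ_γ ^ r = γ(-κ) r` accounting for the cocycle;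
it vanishes unless `x + y = 0` (`stateBracket_eq_zero`). Thus the product `∏ (z_i + z_j)` annihilates
the effect of each exchange of adjacent operators, and the product with the vacuum expectation is
independent of the ordering (`clearedCorrel_perm`).

**Bounds.** The energy is nonnegative, has finite level sets, and is lowered by `i r + a` by
`𝓔_{ir+a}`, which comes with the power `z ^ i`. This makes all sums finite and the set of exponents
well-ordered (`finite_support_pathTerm`, `isPWO_support_correl`). The leftmost operator, applied to
the vacuum on the left, has no negative powers of its variable except for the pole of `𝓔_0`, which
survives the sum over the characters only for `x = 0`
(`exponent_bound_of_coeff_opA_vac_ne_zero`). The rightmost operator, applied to the vacuum, involves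
for each power of `u` only boundedly many powers of its variable (`last_exponent_bound`), since the
pole order in `u` of every operator is at most one (`opA_mem_slab_u`). By symmetry both bounds hold
for all variables, so each power of `u` has a polynomial coefficient, after multiplication by the
product of the `z_i` with `x_i = 0` (`exists_uCoeff_eq`). Finally, the matrix elements have Laurent
polynomials in `u` as coefficients, hence so has the vacuum expectation (`correl_mem_laurentPoly`).
-/

noncomputable section

namespace OrbiFock

open Finset

/-! ### Powers with arbitrary exponents in power series rings -/

section Pow

open PowerSeries

variable {R : Type*} [CommRing R] [Algebra ℚ R]

/-- The binomial coefficient `x (x - 1) ⋯ (x - k + 1) / k!` in a `ℚ`-algebra. -/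
def binomQ {S : Type*} [CommRing S] [Algebra ℚ S] (x : S) (k : ℕ) : S :=
  ((k.factorial : ℚ)⁻¹) • ∏ j ∈ range k, (x - (j : S))

/-- The power `f ^ x = ∑ₖ binomQ x k (f - 1) ^ k` of a power series `f` with constant
coefficient `1`; the terms with `k ≤ N` determine the coefficient of degree `N`. -/
def pw (f x : R⟦X⟧) : R⟦X⟧ :=
  PowerSeries.mk fun N => coeff N (∑ k ∈ range (N + 1), binomQ x k * (f - 1) ^ k)

omit [Algebra ℚ R] in
theorem coeff_mul_pow_of_lt {g : R⟦X⟧} (hg : constantCoeff g = 0) (a : R⟦X⟧) {n k : ℕ}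
    (h : n < k) : coeff n (a * g ^ k) = 0 := by
  have h1 : X ^ k ∣ a * g ^ k :=
    Dvd.dvd.mul_left (pow_dvd_pow_of_dvd (X_dvd_iff.mpr hg) k) a
  exact X_pow_dvd_iff.mp h1 n h

/-- The defining series of `f ^ x` may be truncated at any order beyond the coefficient in
question. -/
theorem coeff_pw {f : R⟦X⟧} (hf : constantCoeff f = 1) (x : R⟦X⟧) {n M : ℕ} (h : n ≤ M) :
    coeff n (pw f x) = coeff n (∑ k ∈ range (M + 1), binomQ x k * (f - 1) ^ k) := by
  have hg : constantCoeff (f - 1) = 0 := by simp [hf]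
  rw [pw, coeff_mk, map_sum, map_sum]
  apply Finset.sum_subset
  · intro k; simp only [mem_range]; omega
  · intro k _ hk
    exact coeff_mul_pow_of_lt hg _ (by simpa [mem_range] using hk)

theorem constantCoeff_pw {f : R⟦X⟧} (hf : constantCoeff f = 1) (x : R⟦X⟧) :
    constantCoeff (pw f x) = 1 := by
  rw [← coeff_zero_eq_constantCoeff_apply, coeff_pw hf x le_rfl]
  simp [binomQ]

theorem binomQ_natCast {S : Type*} [CommRing S] [Algebra ℚ S] (n k : ℕ) :
    binomQ (n : S) k = (n.choose k : S) := by
  have h : (∏ j ∈ range k, ((n : S) - (j : S))) = ((n.descFactorial k : ℕ) : S) := by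
    induction k with
    | zero => simp
    | succ k ih =>
      rw [prod_range_succ, ih, Nat.descFactorial_succ]
      by_cases hk : k ≤ n
      · push_cast [Nat.cast_sub hk]; ring
      · have : n.descFactorial k = 0 := Nat.descFactorial_eq_zero_iff_lt.mpr (by omega)
        simp [this]
  have h3 : ((k.factorial : ℕ) : S) = algebraMap ℚ S (k.factorial : ℚ) := by simp
  have h2 : (k.factorial : ℚ) ≠ 0 := by exact_mod_cast k.factorial_ne_zero
  rw [binomQ, h, Nat.descFactorial_eq_factorial_mul_choose, Nat.cast_mul, h3,
    ← Algebra.smul_def, smul_smul, inv_mul_cancel₀ h2, one_smul]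

theorem pw_natCast {f : R⟦X⟧} (hf : constantCoeff f = 1) (n : ℕ) :
    pw f (n : R⟦X⟧) = f ^ n := by
  ext N
  rw [coeff_pw hf _ (le_max_left N n)]
  conv_rhs => rw [show f = (f - 1) + 1 by ring, add_pow]
  congr 1
  symm
  apply Finset.sum_subset_zero_on_sdiff
  · intro k; simp only [mem_range]; omega
  · intro k hk
    rw [mem_sdiff, mem_range, mem_range] at hk
    rw [binomQ_natCast, Nat.choose_eq_zero_of_lt (by omega)]; simp
  · intro k _
    rw [binomQ_natCast]; simp [mul_comm]

/-- A function on power series which modulo each power of the variable is a polynomial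
function. -/
def IsPolyLike (g : R⟦X⟧ → R⟦X⟧) : Prop :=
  ∀ N : ℕ, ∃ p : Polynomial R⟦X⟧, ∀ x, ∀ n ≤ N, coeff n (g x) = coeff n (p.eval x)

namespace IsPolyLike

omit [Algebra ℚ R] in
theorem of_eval (p : Polynomial R⟦X⟧) : IsPolyLike (fun x => p.eval x) :=
  fun _ => ⟨p, fun _ _ _ => rfl⟩

omit [Algebra ℚ R] in
theorem const (a : R⟦X⟧) : IsPolyLike (fun _ => a) := by
  simpa using of_eval (Polynomial.C a)

omit [Algebra ℚ R] in
theorem mul {g h : R⟦X⟧ → R⟦X⟧} (hg : IsPolyLike g) (hh : IsPolyLike h) :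
    IsPolyLike (fun x => g x * h x) := by
  intro N
  obtain ⟨p, hp⟩ := hg N
  obtain ⟨q, hq⟩ := hh N
  refine ⟨p * q, fun x n hn => ?_⟩
  rw [Polynomial.eval_mul, coeff_mul, coeff_mul]
  refine Finset.sum_congr rfl fun ij hij => ?_
  have := mem_antidiagonal.mp hij
  rw [hp x _ (by omega), hq x _ (by omega)]

/-- The power `f ^ x` depends polynomially on `x`, which may be replaced by a polynomial. -/
theorem pw {f : R⟦X⟧} (hf : constantCoeff f = 1) (q : Polynomial R⟦X⟧) :
    IsPolyLike (fun x => pw f (q.eval x)) := by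
  intro N
  refine ⟨∑ k ∈ range (N + 1), Polynomial.C (algebraMap ℚ R⟦X⟧ (k.factorial : ℚ)⁻¹) *
      (∏ j ∈ range k, (q - Polynomial.C (j : R⟦X⟧))) * Polynomial.C ((f - 1) ^ k),
    fun x n hn => ?_⟩
  rw [coeff_pw hf _ hn, Polynomial.eval_finsetSum]
  congr 1
  refine Finset.sum_congr rfl fun k _ => ?_
  rw [Polynomial.eval_mul, Polynomial.eval_mul, Polynomial.eval_prod, binomQ, Algebra.smul_def]
  simp only [Polynomial.eval_C, Polynomial.eval_sub]

/-- Over a `ℚ`-algebra, polynomial functions are determined by their values on `ℕ`. -/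
theorem ext_nat {g h : R⟦X⟧ → R⟦X⟧} (hg : IsPolyLike g) (hh : IsPolyLike h)
    (e : ∀ n : ℕ, g n = h n) : g = h := by
  funext x
  ext N
  obtain ⟨p, hp⟩ := hg N
  obtain ⟨q, hq⟩ := hh N
  rw [hp x N le_rfl, hq x N le_rfl, ← sub_eq_zero, ← map_sub, ← Polynomial.eval_sub]
  set s := p - q with hs
  have h0 : ∀ (m : ℕ), ∀ n ≤ N, coeff n (s.eval (m : R⟦X⟧)) = 0 := by
    intro m n hn
    rw [hs, Polynomial.eval_sub, map_sub, ← hp _ n hn, ← hq _ n hn, e, sub_self]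
  -- the coefficients of `s` vanish up to degree `N`, as all rational functionals of them do
  have h1 : ∀ k, ∀ n ≤ N, coeff n (s.coeff k) = 0 := by
    intro k n hn
    rw [← Module.forall_dual_apply_eq_zero_iff ℚ]
    intro φ
    let t : Polynomial ℚ := ∑ i ∈ range (s.natDegree + 1),
      Polynomial.monomial i (φ (coeff n (s.coeff i)))
    have ht : t = 0 := by
      apply Polynomial.eq_zero_of_infinite_isRoot
      refine Set.Infinite.mono ?_ (Set.infinite_range_of_injective (Nat.cast_injective (R := ℚ)))
      rintro _ ⟨m, rfl⟩
      have h2 := congrArg φ (h0 m n hn)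
      rw [Polynomial.eval_eq_sum_range, map_sum, map_sum, map_zero] at h2
      change Polynomial.eval (m : ℚ) t = 0
      rw [← h2, Polynomial.eval_finsetSum]
      refine Finset.sum_congr rfl fun i _ => ?_
      have : s.coeff i * (m : R⟦X⟧) ^ i = ((m : ℚ) ^ i) • s.coeff i := by
        rw [Algebra.smul_def, mul_comm]; simp
      rw [this, Polynomial.eval_monomial, PowerSeries.coeff_smul, map_smul, smul_eq_mul, mul_comm]
    have hk : t.coeff k = if k < s.natDegree + 1 then φ (coeff n (s.coeff k)) else 0 := by
      simp only [t, Polynomial.finsetSum_coeff, Polynomial.coeff_monomial]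
      rw [Finset.sum_ite_eq' (range (s.natDegree + 1)) k]
      simp
    by_cases hlt : k < s.natDegree + 1
    · rw [ht, if_pos hlt] at hk
      simpa using hk.symm
    · rw [Polynomial.coeff_eq_zero_of_natDegree_lt (by omega)]; simp
  rw [Polynomial.eval_eq_sum_range, map_sum]
  refine Finset.sum_eq_zero fun k _ => ?_
  rw [coeff_mul]
  refine Finset.sum_eq_zero fun ij hij => ?_
  rw [h1 k _ (by have := mem_antidiagonal.mp hij; omega), zero_mul]

end IsPolyLike

section

variable {f g : R⟦X⟧} (hf : constantCoeff f = 1) (hg : constantCoeff g = 1)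

include hf

theorem pw_add_natCast (x : R⟦X⟧) (n : ℕ) : pw f (x + n) = pw f x * f ^ n := by
  have h1 := IsPolyLike.pw hf (Polynomial.X + Polynomial.C (n : R⟦X⟧))
  have h2 := (IsPolyLike.pw hf Polynomial.X).mul (IsPolyLike.const (f ^ n))
  have h3 := congrFun (h1.ext_nat h2 fun m => ?_) x
  · simpa using h3
  · simp only [Polynomial.eval_add, Polynomial.eval_X, Polynomial.eval_C]
    rw [pw_natCast hf, ← Nat.cast_add, pw_natCast hf, pow_add]

theorem pw_add (x y : R⟦X⟧) : pw f (x + y) = pw f x * pw f y := by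
  have h1 := IsPolyLike.pw hf (Polynomial.C x + Polynomial.X)
  have h2 := (IsPolyLike.const (pw f x)).mul (IsPolyLike.pw hf Polynomial.X)
  have h3 := congrFun (h1.ext_nat h2 fun m => ?_) y
  · simpa using h3
  · simp only [Polynomial.eval_add, Polynomial.eval_X, Polynomial.eval_C]
    rw [pw_natCast hf, pw_add_natCast hf]

theorem pw_zero : pw f 0 = 1 := by
  simpa using pw_natCast hf 0

theorem pw_one : pw f 1 = f := by
  simpa using pw_natCast hf 1

theorem pw_neg_mul (x : R⟦X⟧) : pw f (-x) * pw f x = 1 := by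
  rw [← pw_add hf, neg_add_cancel, pw_zero hf]

theorem pw_mul (x y : R⟦X⟧) : pw (pw f y) x = pw f (y * x) := by
  have h1 := IsPolyLike.pw (constantCoeff_pw hf y) Polynomial.X
  have h2 := IsPolyLike.pw hf (Polynomial.C y * Polynomial.X)
  have h3 := congrFun (h1.ext_nat h2 fun m => ?_) x
  · simpa using h3
  · simp only [Polynomial.eval_mul, Polynomial.eval_X, Polynomial.eval_C]
    rw [pw_natCast (constantCoeff_pw hf y)]
    induction m with
    | zero => simp [pw_zero hf]
    | succ m ih => rw [pow_succ, ih, ← pw_add hf]; push_cast; ring_nf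

include hg in
theorem mul_pw (x : R⟦X⟧) : pw (f * g) x = pw f x * pw g x := by
  have hfg : constantCoeff (f * g) = 1 := by simp [hf, hg]
  have h1 := IsPolyLike.pw hfg Polynomial.X
  have h2 := (IsPolyLike.pw hf Polynomial.X).mul (IsPolyLike.pw hg Polynomial.X)
  have h3 := congrFun (h1.ext_nat h2 fun m => ?_) x
  · simpa using h3
  · simp only [Polynomial.eval_X]
    rw [pw_natCast hf, pw_natCast hg, pw_natCast hfg, mul_pow]

end

theorem pw_exp_C (c : R) : pw (exp R) (C c) = rescale c (exp R) := by
  have h1 := IsPolyLike.pw (constantCoeff_exp (A := R)) Polynomial.X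
  let G : R⟦X⟧ → R⟦X⟧ := fun x => PowerSeries.mk fun N =>
    coeff N (∑ k ∈ range (N + 1), x ^ k * (algebraMap ℚ R⟦X⟧ (1 / k.factorial) * X ^ k))
  have hG : ∀ x, ∀ n N, n ≤ N → coeff n (G x) = coeff n
      (∑ k ∈ range (N + 1), x ^ k * (algebraMap ℚ R⟦X⟧ (1 / k.factorial) * X ^ k)) := by
    intro x n N hn
    simp only [G, coeff_mk, map_sum]
    apply Finset.sum_subset
    · intro k; simp only [mem_range]; omega
    · intro k _ hk
      rw [← mul_assoc]
      exact coeff_mul_pow_of_lt (by simp) _ (by simpa [mem_range] using hk)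
  have h2 : IsPolyLike G := by
    intro N
    refine ⟨∑ k ∈ range (N + 1), Polynomial.X ^ k *
      Polynomial.C (algebraMap ℚ R⟦X⟧ (1 / k.factorial) * X ^ k), fun x n hn => ?_⟩
    rw [hG x n N hn, Polynomial.eval_finsetSum]
    simp only [Polynomial.eval_mul, Polynomial.eval_pow, Polynomial.eval_X, Polynomial.eval_C]
  have h3 : ∀ c : R, G (C c) = rescale c (exp R) := by
    intro c
    ext N
    simp only [G, coeff_mk, map_sum]
    rw [Finset.sum_eq_single N]
    · rw [← map_pow, coeff_C_mul, coeff_rescale, coeff_exp, PowerSeries.algebraMap_apply,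
        coeff_C_mul_X_pow, if_pos rfl]
    · intro k _ hk
      simp only [PowerSeries.algebraMap_apply]
      rw [← map_pow, coeff_C_mul, coeff_C_mul_X_pow, if_neg (Ne.symm hk), mul_zero]
    · simp
  have h4 := congrFun (h1.ext_nat h2 fun m => ?_) (C c)
  · simp only [Polynomial.eval_X] at h4
    rw [h4, h3]
  · simp only [Polynomial.eval_X]
    have : ((m : ℕ) : R⟦X⟧) = C (m : R) := by simp
    rw [pw_natCast (constantCoeff_exp (A := R)), this, h3, exp_pow_eq_rescale_exp]

theorem map_binomQ {S T : Type*} [CommRing S] [Algebra ℚ S] [CommRing T] [Algebra ℚ T]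
    (φ : S →+* T) (x : S) (k : ℕ) : φ (binomQ x k) = binomQ (φ x) k := by
  rw [binomQ, binomQ, map_rat_smul φ, map_prod]
  simp

/-- Powers are compatible with ring homomorphisms acting degree by degree. -/
theorem map_pw {S : Type*} [CommRing S] [Algebra ℚ S] (φ : R⟦X⟧ →+* S⟦X⟧)
    (χ : ℕ → R → S) (hφ : ∀ n a, coeff n (φ a) = χ n (coeff n a)) (f x : R⟦X⟧) :
    φ (pw f x) = pw (φ f) (φ x) := by
  ext N
  rw [hφ, pw, pw, coeff_mk, coeff_mk, ← hφ, map_sum]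
  simp only [map_mul, map_binomQ, map_pow, map_sub, map_one]

end Pow

/-! ### Bilateral sums of power series in two variables -/

/-- Polynomials in two variables. -/
abbrev BiPoly (A : Type*) [CommRing A] : Type _ := Polynomial (Polynomial A)

namespace BiPoly

variable {A : Type*} [CommRing A]

/-- The first variable. -/
def z : BiPoly A := Polynomial.C Polynomial.X

/-- The second variable. -/
def w : BiPoly A := Polynomial.X

/-- The coefficient of `z ^ α * w ^ β`, which is zero if an exponent is negative. -/
def cf (f : BiPoly A) (α β : ℤ) : A :=
  if 0 ≤ α ∧ 0 ≤ β then (f.coeff β.toNat).coeff α.toNat else 0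

theorem cf_of_neg {f : BiPoly A} {α β : ℤ} (h : ¬ (0 ≤ α ∧ 0 ≤ β)) : cf f α β = 0 := if_neg h

@[simp] theorem cf_zero (α β : ℤ) : cf (0 : BiPoly A) α β = 0 := by simp [cf]

theorem cf_add (f g : BiPoly A) (α β : ℤ) : cf (f + g) α β = cf f α β + cf g α β := by
  unfold cf; split_ifs <;> simp

theorem cf_sum {ι : Type*} (s : Finset ι) (f : ι → BiPoly A) (α β : ℤ) :
    cf (∑ i ∈ s, f i) α β = ∑ i ∈ s, cf (f i) α β :=
  map_sum (⟨⟨fun f => cf f α β, cf_zero α β⟩, fun f g => cf_add f g α β⟩ : BiPoly A →+ A) f s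

theorem cf_const_mul (a : A) (f : BiPoly A) (α β : ℤ) :
    cf (Polynomial.C (Polynomial.C a) * f) α β = a * cf f α β := by
  unfold cf; split_ifs <;> simp

theorem cf_z_mul (f : BiPoly A) (α β : ℤ) : cf (z * f) α β = cf f (α - 1) β := by
  unfold cf z
  by_cases h : 0 ≤ α ∧ 0 ≤ β
  · rw [if_pos h, Polynomial.coeff_C_mul]
    by_cases h1 : 1 ≤ α
    · rw [if_pos (by omega), show α.toNat = (α - 1).toNat + 1 by omega, Polynomial.coeff_X_mul]
    · rw [if_neg (by omega), show α.toNat = 0 by omega, Polynomial.coeff_X_mul_zero]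
  · rw [if_neg h, if_neg (by omega)]

theorem cf_w_mul (f : BiPoly A) (α β : ℤ) : cf (w * f) α β = cf f α (β - 1) := by
  unfold cf w
  by_cases h : 0 ≤ α ∧ 0 ≤ β
  · rw [if_pos h]
    by_cases h1 : 1 ≤ β
    · rw [if_pos (by omega), show β.toNat = (β - 1).toNat + 1 by omega, Polynomial.coeff_X_mul]
    · rw [if_neg (by omega), show β.toNat = 0 by omega, Polynomial.coeff_X_mul_zero]; simp
  · rw [if_neg h, if_neg (by omega)]

end BiPoly

section Bilateral

open PowerSeries BiPoly

variable {A : Type*} [CommRing A]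

/-- The bilateral sum `∑_{i ∈ ℤ} z ^ i * w ^ (m - i) * F i`: its coefficient of `z ^ p * w ^ q`,
where the part of degree `d` in the auxiliary variable is taken. -/
def biSum (m : ℤ) (F : ℤ → (BiPoly A)⟦X⟧) (d : ℕ) (p q : ℤ) : A :=
  ∑ᶠ i : ℤ, cf (coeff d (F i)) (p - i) (q - m + i)

theorem biSum_support (m : ℤ) (F : ℤ → (BiPoly A)⟦X⟧) (d : ℕ) (p q : ℤ) :
    (Function.support fun i : ℤ => cf (coeff d (F i)) (p - i) (q - m + i)) ⊆
      (Icc (m - q) p : Finset ℤ) := by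
  intro i hi
  by_contra h
  apply hi
  apply cf_of_neg
  simp only [coe_Icc, Set.mem_Icc] at h
  omega

theorem biSum_support_finite (m : ℤ) (F : ℤ → (BiPoly A)⟦X⟧) (d : ℕ) (p q : ℤ) :
    (Function.support fun i : ℤ => cf (coeff d (F i)) (p - i) (q - m + i)).Finite :=
  (Finset.finite_toSet _).subset (biSum_support m F d p q)

theorem biSum_eq_sum (m : ℤ) (F : ℤ → (BiPoly A)⟦X⟧) (d : ℕ) (p q : ℤ) :
    biSum m F d p q = ∑ i ∈ Icc (m - q) p, cf (coeff d (F i)) (p - i) (q - m + i) :=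
  finsum_eq_sum_of_support_subset _ (biSum_support m F d p q)

theorem biSum_congr {m : ℤ} {F G : ℤ → (BiPoly A)⟦X⟧} {d : ℕ}
    (h : ∀ i, coeff d (F i) = coeff d (G i)) (p q : ℤ) : biSum m F d p q = biSum m G d p q := by
  simp only [biSum, h]

theorem biSum_add (m : ℤ) (F G : ℤ → (BiPoly A)⟦X⟧) (d : ℕ) (p q : ℤ) :
    biSum m (fun i => F i + G i) d p q = biSum m F d p q + biSum m G d p q := by
  simp only [biSum_eq_sum, map_add, cf_add, sum_add_distrib]

theorem biSum_zero (m : ℤ) (d : ℕ) (p q : ℤ) :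
    biSum m (fun _ => (0 : (BiPoly A)⟦X⟧)) d p q = 0 := by
  simp [biSum_eq_sum]

theorem biSum_sum {ι : Type*} (s : Finset ι) (m : ℤ) (F : ι → ℤ → (BiPoly A)⟦X⟧) (d : ℕ)
    (p q : ℤ) : biSum m (fun i => ∑ j ∈ s, F j i) d p q = ∑ j ∈ s, biSum m (F j) d p q := by
  simp only [biSum_eq_sum, map_sum, cf_sum]
  exact sum_comm

theorem biSum_const_mul (a : A) (m : ℤ) (F : ℤ → (BiPoly A)⟦X⟧) (d : ℕ) (p q : ℤ) :
    biSum m (fun i => C (Polynomial.C (Polynomial.C a)) * F i) d p q = a * biSum m F d p q := by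
  simp only [biSum_eq_sum, coeff_C_mul, cf_const_mul, mul_sum]

theorem biSum_comp_sub_one (m : ℤ) (F : ℤ → (BiPoly A)⟦X⟧) (d : ℕ) (p q : ℤ) :
    biSum m (fun i => F (i - 1)) d p q = biSum (m - 1) (fun i => C z * F i) d p q := by
  unfold biSum
  rw [← finsum_comp_equiv (Equiv.addRight (1 : ℤ))]
  refine finsum_congr fun i => ?_
  rw [coeff_C_mul, cf_z_mul]
  simp only [Equiv.coe_addRight, add_sub_cancel_right]
  congr 1 <;> ring

theorem biSum_w_mul (m : ℤ) (F : ℤ → (BiPoly A)⟦X⟧) (d : ℕ) (p q : ℤ) :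
    biSum m F d p q = biSum (m - 1) (fun i => C w * F i) d p q := by
  unfold biSum
  refine finsum_congr fun i => ?_
  rw [coeff_C_mul, cf_w_mul]
  congr 1; ring

theorem biSum_comp_sub (s : ℕ) (m : ℤ) (F : ℤ → (BiPoly A)⟦X⟧) (d : ℕ) (p q : ℤ) :
    biSum m (fun i => F (i - s)) d p q = biSum (m - s) (fun i => C z ^ s * F i) d p q := by
  induction s generalizing m F with
  | zero => simp
  | succ s ih =>
    have h1 := biSum_comp_sub_one m (fun i => F (i - s)) d p q
    have h2 := ih (m - 1) (fun i => C z * F i)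
    calc _ = biSum m (fun i => F (i - 1 - s)) d p q := by
            congr 1; funext i; congr 1; push_cast; ring
      _ = _ := h1
      _ = _ := h2
      _ = _ := by
        congr 1
        · push_cast; ring
        · funext i; ring

theorem biSum_w_pow_mul (s : ℕ) (m : ℤ) (F : ℤ → (BiPoly A)⟦X⟧) (d : ℕ) (p q : ℤ) :
    biSum m F d p q = biSum (m - s) (fun i => C w ^ s * F i) d p q := by
  induction s generalizing m F with
  | zero => simp
  | succ s ih =>
    rw [biSum_w_mul, ih]
    congr 1
    · push_cast; ring
    · funext i; ring

/-- Multiplication by a polynomial preserves the vanishing of a bilateral sum. -/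
theorem biSum_C_mul_eq_zero {m : ℤ} {F : ℤ → (BiPoly A)⟦X⟧} {d : ℕ}
    (h : ∀ p q, biSum m F d p q = 0) (g : BiPoly A) (p q : ℤ) :
    biSum m (fun i => C g * F i) d p q = 0 := by
  have hz : ∀ G : ℤ → (BiPoly A)⟦X⟧, (∀ p q, biSum m G d p q = 0) →
      ∀ p q, biSum m (fun i => C z * G i) d p q = 0 := by
    intro G hG p q
    rw [← hG (p - 1) q]
    simp only [biSum, coeff_C_mul, cf_z_mul]
    refine finsum_congr fun i => ?_
    congr 1; ring
  have hw : ∀ G : ℤ → (BiPoly A)⟦X⟧, (∀ p q, biSum m G d p q = 0) →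
      ∀ p q, biSum m (fun i => C w * G i) d p q = 0 := by
    intro G hG p q
    rw [← hG p (q - 1)]
    simp only [biSum, coeff_C_mul, cf_w_mul]
    refine finsum_congr fun i => ?_
    congr 1; ring
  have hc : ∀ g : Polynomial A, ∀ G : ℤ → (BiPoly A)⟦X⟧, (∀ p q, biSum m G d p q = 0) →
      ∀ p q, biSum m (fun i => C (Polynomial.C g) * G i) d p q = 0 := by
    intro g
    induction g using Polynomial.induction_on with
    | C a => intro G hG p q; rw [biSum_const_mul, hG, mul_zero]
    | add f g hf hg =>
      intro G hG p q
      simp only [map_add, add_mul]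
      rw [biSum_add, hf G hG, hg G hG, add_zero]
    | monomial n a ih =>
      intro G hG p q
      refine (biSum_congr (fun i => ?_) p q).trans (hz _ (ih G hG) p q)
      have e : (C (Polynomial.C (Polynomial.C a * Polynomial.X ^ (n + 1))) : (BiPoly A)⟦X⟧) =
          C z * C (Polynomial.C (Polynomial.C a * Polynomial.X ^ n)) := by
        rw [z, ← map_mul, ← map_mul]
        exact congrArg (fun t => C (Polynomial.C t)) (by ring)
      rw [e, mul_assoc]
  revert p q
  induction g using Polynomial.induction_on with
  | C a => exact hc a F h
  | add f g hf hg =>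
    intro p q
    simp only [map_add, add_mul]
    rw [biSum_add, hf, hg, add_zero]
  | monomial n a ih =>
    intro p q
    refine (biSum_congr (fun i => ?_) p q).trans (hw _ ih p q)
    have e : (C (Polynomial.C a * Polynomial.X ^ (n + 1)) : (BiPoly A)⟦X⟧) =
        C w * C (Polynomial.C a * Polynomial.X ^ n) := by
      rw [w, ← map_mul]
      exact congrArg (fun t => C t) (by ring)
    rw [e, mul_assoc]

/-- Multiplication by a power series preserves the vanishing of a bilateral sum. -/
theorem biSum_mul_eq_zero {m : ℤ} {F : ℤ → (BiPoly A)⟦X⟧}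
    (h : ∀ d p q, biSum m F d p q = 0) (g : (BiPoly A)⟦X⟧) (d : ℕ) (p q : ℤ) :
    biSum m (fun i => g * F i) d p q = 0 := by
  have h1 : ∀ st ∈ antidiagonal d,
      ∑ i ∈ Icc (m - q) p, cf (coeff st.1 g * coeff st.2 (F i)) (p - i) (q - m + i) = 0 := by
    intro st _
    have := biSum_C_mul_eq_zero (h st.2) (coeff st.1 g) p q
    simpa only [biSum_eq_sum, coeff_C_mul] using this
  rw [biSum_eq_sum]
  simp only [coeff_mul, cf_sum]
  rw [sum_comm]
  exact sum_eq_zero h1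

variable [Algebra ℚ A]

/-- Up to degree `d`, a product of two powers is a finite sum over the total order. -/
theorem coeff_pw_mul_pw {R : Type*} [CommRing R] [Algebra ℚ R] {f g : R⟦X⟧}
    (hf : constantCoeff f = 1) (hg : constantCoeff g = 1) (x y : R⟦X⟧) {n d : ℕ} (h : n ≤ d) :
    coeff n (pw f x * pw g y) = coeff n (∑ j ∈ range (d + 1), ∑ st ∈ antidiagonal j,
      (binomQ x st.1 * (f - 1) ^ st.1) * (binomQ y st.2 * (g - 1) ^ st.2)) := by
  have hf0 : constantCoeff (f - 1) = 0 := by simp [hf]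
  have hg0 : constantCoeff (g - 1) = 0 := by simp [hg]
  have h1 : coeff n (pw f x * pw g y) = coeff n
      ((∑ s ∈ range (d + 1), binomQ x s * (f - 1) ^ s) *
        (∑ t ∈ range (d + 1), binomQ y t * (g - 1) ^ t)) := by
    rw [coeff_mul, coeff_mul]
    refine sum_congr rfl fun ij hij => ?_
    have := mem_antidiagonal.mp hij
    rw [coeff_pw hf x (show ij.1 ≤ d by omega), coeff_pw hg y (show ij.2 ≤ d by omega)]
  rw [h1, sum_mul_sum, ← sum_product', map_sum, sum_sigma', map_sum]
  symm
  apply sum_of_injOn (fun a : (_ : ℕ) × ℕ × ℕ => a.2)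
  · rintro ⟨j, s, t⟩ h1 ⟨j', s', t'⟩ h2 h3
    simp only [coe_sigma, Set.mem_sigma_iff, mem_coe, HasAntidiagonal.mem_antidiagonal] at h1 h2
    simp only [Prod.mk.injEq] at h3
    obtain ⟨rfl, rfl⟩ := h3
    have : j = j' := by omega
    subst this; rfl
  · rintro ⟨j, s, t⟩ h1
    simp only [coe_sigma, Set.mem_sigma_iff, mem_coe, HasAntidiagonal.mem_antidiagonal, mem_range] at h1
    simp only [coe_product, Set.mem_prod, mem_coe, mem_range]
    omega
  · rintro ⟨s, t⟩ h1 h2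
    have hst : n < s + t := by
      by_contra h3
      apply h2
      refine ⟨⟨s + t, s, t⟩, ?_, rfl⟩
      simp only [coe_sigma, Set.mem_sigma_iff, mem_coe, HasAntidiagonal.mem_antidiagonal, mem_range]
      exact ⟨by omega, trivial⟩
    have : X ^ (s + t) ∣ binomQ x s * (f - 1) ^ s * (binomQ y t * (g - 1) ^ t) := by
      rw [pow_add]
      exact mul_dvd_mul (Dvd.dvd.mul_left (pow_dvd_pow_of_dvd (X_dvd_iff.mpr hf0) s) _)
        (Dvd.dvd.mul_left (pow_dvd_pow_of_dvd (X_dvd_iff.mpr hg0) t) _)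
    exact X_pow_dvd_iff.mp this n hst
  · intros; rfl

/-- For a sequence behaving like the inverse Pochhammer symbols `1 / (x + 1)_i`, multiplication by
a binomial coefficient in `x + i` is a shift of the index. -/
theorem binomQ_mul_of_rec {S : Type*} [CommRing S] [Algebra ℚ S] {x : S} {a : ℤ → S}
    (ha : ∀ i : ℤ, (x + i) * a i = a (i - 1)) (i : ℤ) (s : ℕ) :
    binomQ (x + i) s * a i = ((s.factorial : ℚ)⁻¹) • a (i - s) := by
  rw [binomQ, smul_mul_assoc]
  congr 1
  induction s with
  | zero => simp
  | succ s ih =>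
    rw [prod_range_succ, mul_right_comm, ih, mul_comm]
    have := ha (i - s)
    rw [show i - ((s + 1 : ℕ) : ℤ) = i - s - 1 by push_cast; ring, ← this]
    push_cast; ring

/-- Bilateral binomial expansion: if `(x + i) a_i = a_{i-1}` and `(y + i) b_i = b_{i-1}`, the sum
`∑ᵢ z ^ i * w ^ (m - i) * a_i * b_{m-i} * f ^ (x + i) * g ^ (y + m - i)` is a series in powers of
`z (f - 1) + w (g - 1)`. -/
theorem biSum_pw_mul_pw {x y : (BiPoly A)⟦X⟧} {a b : ℤ → (BiPoly A)⟦X⟧}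
    (ha : ∀ i : ℤ, (x + i) * a i = a (i - 1)) (hb : ∀ i : ℤ, (y + i) * b i = b (i - 1))
    {f g : (BiPoly A)⟦X⟧} (hf : constantCoeff f = 1) (hg : constantCoeff g = 1)
    (m : ℤ) (d : ℕ) (p q : ℤ) :
    biSum m (fun i => a i * b (m - i) * (pw f (x + i) * pw g (y + (m - i : ℤ)))) d p q =
      ∑ j ∈ range (d + 1), biSum (m - j) (fun i => ((j.factorial : ℚ)⁻¹) •
        (a i * b (m - j - i) * (C z * (f - 1) + C w * (g - 1)) ^ j)) d p q := by
  have h1 : ∀ i : ℤ, coeff d (a i * b (m - i) * (pw f (x + i) * pw g (y + (m - i : ℤ)))) =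
      coeff d (∑ j ∈ range (d + 1), ∑ st ∈ antidiagonal j, a i * b (m - i) *
        ((binomQ (x + i) st.1 * (f - 1) ^ st.1) *
          (binomQ (y + (m - i : ℤ)) st.2 * (g - 1) ^ st.2))) := by
    intro i
    simp only [← mul_sum]
    rw [coeff_mul, coeff_mul]
    refine sum_congr rfl fun ij hij => ?_
    have := mem_antidiagonal.mp hij
    rw [coeff_pw_mul_pw hf hg _ _ (show ij.2 ≤ d by omega)]
  rw [biSum_congr h1, biSum_sum]
  refine sum_congr rfl fun j _ => ?_
  rw [biSum_sum]
  have h2 : ∀ st ∈ antidiagonal j, biSum m (fun i => a i * b (m - i) *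
        ((binomQ (x + i) st.1 * (f - 1) ^ st.1) *
          (binomQ (y + (m - i : ℤ)) st.2 * (g - 1) ^ st.2))) d p q =
      biSum (m - j) (fun i => a i * b (m - j - i) * (((st.1.factorial : ℚ)⁻¹) •
        (C z * (f - 1)) ^ st.1 * ((st.2.factorial : ℚ)⁻¹) • (C w * (g - 1)) ^ st.2)) d p q := by
    rintro ⟨s, t⟩ hst
    have hst' : s + t = j := mem_antidiagonal.mp hst
    simp only
    let G : ℤ → (BiPoly A)⟦X⟧ := fun i => (((s.factorial : ℚ)⁻¹) • a i) *
      (((t.factorial : ℚ)⁻¹) • b (m - j - i)) * ((f - 1) ^ s * (g - 1) ^ t)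
    have e1 : (fun i => a i * b (m - i) * ((binomQ (x + i) s * (f - 1) ^ s) *
          (binomQ (y + (m - i : ℤ)) t * (g - 1) ^ t))) = fun i => G (i - s) := by
      funext i
      have e2 := binomQ_mul_of_rec ha i s
      have e3 := binomQ_mul_of_rec hb (m - i) t
      simp only [G]
      rw [← e2, show m - j - (i - s) = m - i - t by omega, ← e3]
      ring
    rw [e1, biSum_comp_sub, biSum_w_pow_mul t, show m - (s : ℤ) - (t : ℤ) = m - j by omega]
    refine biSum_congr (fun i => congrArg (coeff d) ?_) p q
    simp only [G, mul_pow, smul_mul_assoc, mul_smul_comm]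
    refine congrArg _ (congrArg _ ?_)
    ring
  rw [sum_congr rfl h2, ← biSum_sum]
  refine biSum_congr (fun i => congrArg (coeff d) ?_) p q
  rw [← mul_sum, ← mul_smul_comm]
  refine congrArg _ ?_
  rw [(Commute.all _ _).add_pow', smul_sum]
  refine sum_congr rfl fun st hst => ?_
  have hst' : st.1 + st.2 = j := mem_antidiagonal.mp hst
  rw [smul_mul_assoc, mul_smul_comm, smul_smul, ← Nat.cast_smul_eq_nsmul ℚ, smul_smul]
  congr 1
  have h3 := Nat.choose_mul_factorial_mul_factorial (show st.1 ≤ j by omega)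
  rw [show j - st.1 = st.2 by omega] at h3
  have h4 : (j.factorial : ℚ) ≠ 0 := by exact_mod_cast j.factorial_ne_zero
  have h5 : (st.1.factorial : ℚ) ≠ 0 := by exact_mod_cast st.1.factorial_ne_zero
  have h6 : (st.2.factorial : ℚ) ≠ 0 := by exact_mod_cast st.2.factorial_ne_zero
  have h7 : (j.choose st.1 : ℚ) * st.1.factorial * st.2.factorial = j.factorial := by
    exact_mod_cast h3
  field_simp
  linarith

/-- The bilateral binomial sum depends on the bases `f` and `g` only through `z f + w g`. -/
theorem biSum_pw_mul_pw_congr {x y : (BiPoly A)⟦X⟧} {a b : ℤ → (BiPoly A)⟦X⟧}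
    (ha : ∀ i : ℤ, (x + i) * a i = a (i - 1)) (hb : ∀ i : ℤ, (y + i) * b i = b (i - 1))
    {f g f' g' : (BiPoly A)⟦X⟧} (hf : constantCoeff f = 1) (hg : constantCoeff g = 1)
    (hf' : constantCoeff f' = 1) (hg' : constantCoeff g' = 1)
    (h : C z * f + C w * g = C z * f' + C w * g') (m : ℤ) (d : ℕ) (p q : ℤ) :
    biSum m (fun i => a i * b (m - i) * (pw f (x + i) * pw g (y + (m - i : ℤ)))) d p q =
      biSum m (fun i => a i * b (m - i) * (pw f' (x + i) * pw g' (y + (m - i : ℤ)))) d p q := by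
  have h1 : C z * (f - 1) + C w * (g - 1) = C z * (f' - 1) + C w * (g' - 1) := by
    linear_combination h
  rw [biSum_pw_mul_pw ha hb hf hg, biSum_pw_mul_pw ha hb hf' hg', h1]

end Bilateral

/-! ### The bilateral sum behind the commutators -/

section BilateralExp

open PowerSeries BiPoly

variable {A : Type*} [Field A]

/-- Substitution of a polynomial, weighted by the auxiliary variable: `f ↦ f(t l)`. -/
def inL (l : BiPoly A) : A⟦X⟧ →+* (BiPoly A)⟦X⟧ :=
  (rescale l).comp (PowerSeries.map (Polynomial.C.comp Polynomial.C))

theorem coeff_inL (l : BiPoly A) (n : ℕ) (f : A⟦X⟧) :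
    coeff n (inL l f) = l ^ n * Polynomial.C (Polynomial.C (coeff n f)) := by
  simp [inL, coeff_rescale]

theorem constantCoeff_inL (l : BiPoly A) {f : A⟦X⟧} (h : constantCoeff f = 1) :
    constantCoeff (inL l f) = 1 := by
  rw [← coeff_zero_eq_constantCoeff_apply, coeff_inL, coeff_zero_eq_constantCoeff_apply, h]
  simp

theorem inL_X (l : BiPoly A) : inL l (X : A⟦X⟧) = C l * X := by
  ext1 n
  rw [coeff_inL, coeff_C_mul, coeff_X]
  by_cases h : n = 1
  · subst h; simp
  · rw [if_neg h, map_zero, map_zero, mul_zero, coeff_X, if_neg h, mul_zero]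

theorem inL_C (l : BiPoly A) (a : A) : inL l (C a) = C (Polynomial.C (Polynomial.C a)) := by
  ext1 n
  rw [coeff_inL, coeff_C, coeff_C]
  by_cases h : n = 0
  · subst h; simp
  · rw [if_neg h, if_neg h, map_zero, map_zero, mul_zero]

/-- The reciprocal of the Pochhammer symbol `(x + 1)_n` for `n ∈ ℤ`. -/
def invPoch (x : A⟦X⟧) : ℤ → A⟦X⟧
  | Int.ofNat n => (∏ j ∈ range n, (x + ((j + 1 : ℕ) : A⟦X⟧)))⁻¹
  | Int.negSucc n => ∏ j ∈ range (n + 1), (x - ((j : ℕ) : A⟦X⟧))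

/-- The recursion of the inverse Pochhammer symbols, valid for all integers `i`. -/
theorem add_mul_invPoch {x : A⟦X⟧}
    (hx : ∀ n : ℕ, constantCoeff (x + ((n + 1 : ℕ) : A⟦X⟧)) ≠ 0) (i : ℤ) :
    (x + (i : A⟦X⟧)) * invPoch x i = invPoch x (i - 1) := by
  match i with
  | Int.ofNat 0 =>
    rw [show Int.ofNat 0 - 1 = Int.negSucc 0 from rfl]
    simp only [invPoch]
    simp
  | Int.ofNat (n + 1) =>
    rw [show Int.ofNat (n + 1) - 1 = Int.ofNat n by simp]
    simp only [invPoch]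
    have h0 : ∀ n : ℕ,
        constantCoeff (∏ j ∈ range n, (x + ((j + 1 : ℕ) : A⟦X⟧))) ≠ 0 := by
      intro n
      rw [map_prod]
      exact prod_ne_zero_iff.mpr fun j _ => hx j
    rw [PowerSeries.eq_inv_iff_mul_eq_one (h0 n)]
    have h1 := PowerSeries.inv_mul_cancel _ (h0 (n + 1))
    rw [mul_right_comm, ← h1]
    conv_rhs => rw [mul_comm]
    congr 1
    rw [prod_range_succ, mul_comm]
    simp
  | Int.negSucc n =>
    rw [show Int.negSucc n - 1 = Int.negSucc (n + 1) from rfl]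
    simp only [invPoch]
    rw [prod_range_succ _ (n + 1), mul_comm]
    congr 1
    rw [Int.cast_negSucc]; ring

variable [CharZero A]

/-- The exponent `(X + a) / r`. -/
def xExp (A : Type*) [Field A] (r a : ℕ) : A⟦X⟧ := C ((r : A)⁻¹) * (X + C (a : A))

theorem constantCoeff_xExp_add_ne_zero (r a : ℕ) (n : ℕ) :
    constantCoeff (xExp A r a + ((n + 1 : ℕ) : A⟦X⟧)) ≠ 0 := by
  simp only [xExp, map_add, map_mul, constantCoeff_C, constantCoeff_X, zero_add, map_natCast]
  have h : (0 : ℚ) < (r : ℚ)⁻¹ * a + (n + 1 : ℕ) := by positivity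
  have h2 : ((r : A)⁻¹ * a + (n + 1 : ℕ)) = (((r : ℚ)⁻¹ * a + (n + 1 : ℕ) : ℚ) : A) := by
    push_cast; ring
  rw [h2]
  exact_mod_cast h.ne'

/-- The series `exp (c X / 2) - exp (- c X / 2)`. -/
def sigmaPow (c : A) : A⟦X⟧ := rescale (c / 2) (exp A) - rescale (-(c / 2)) (exp A)

/-- The series `(exp (c X / 2) - exp (- c X / 2)) / (c X)`. -/
def calSPow (c : A) : A⟦X⟧ := C c⁻¹ * PowerSeries.mk fun n => coeff (n + 1) (sigmaPow c)

theorem constantCoeff_sigmaPow (c : A) : constantCoeff (sigmaPow c) = 0 := by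
  rw [← coeff_zero_eq_constantCoeff_apply, sigmaPow, map_sub, coeff_rescale, coeff_rescale]
  simp

theorem C_mul_X_mul_calSPow {c : A} (hc : c ≠ 0) : C c * X * calSPow c = sigmaPow c := by
  have h := sub_const_eq_X_mul_shift (sigmaPow c)
  rw [constantCoeff_sigmaPow] at h
  simp only [map_zero, sub_zero] at h
  rw [calSPow, mul_mul_mul_comm, ← map_mul, mul_inv_cancel₀ hc, map_one, one_mul]
  exact h.symm

theorem constantCoeff_calSPow {c : A} (hc : c ≠ 0) : constantCoeff (calSPow c) = 1 := by
  rw [← coeff_zero_eq_constantCoeff_apply, calSPow, coeff_C_mul, coeff_mk, sigmaPow, map_sub,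
    coeff_rescale, coeff_rescale, coeff_exp]
  simp
  field_simp

/-- `exp (t l)` for a polynomial `l`. -/
def expBi (l : BiPoly A) : (BiPoly A)⟦X⟧ := rescale l (exp (BiPoly A))

theorem expBi_add (l l' : BiPoly A) : expBi (l + l') = expBi l * expBi l' :=
  (exp_mul_exp_eq_exp_add l l').symm

theorem constantCoeff_expBi (l : BiPoly A) : constantCoeff (expBi l) = 1 := by
  rw [expBi, ← coeff_zero_eq_constantCoeff_apply, coeff_rescale]
  simp

theorem expBi_eq_pw (l : BiPoly A) : expBi l = pw (exp (BiPoly A)) (C l) := (pw_exp_C l).symm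

theorem pw_expBi (l : BiPoly A) (x : (BiPoly A)⟦X⟧) :
    pw (expBi l) x = pw (exp (BiPoly A)) (C l * x) := by
  rw [expBi_eq_pw, pw_mul constantCoeff_exp]

/-- A constant, as a polynomial in two variables. -/
abbrev BiPoly.const (a : A) : BiPoly A := Polynomial.C (Polynomial.C a)

omit [CharZero A] in
theorem BiPoly.const_neg_mul (a : A) (l : BiPoly A) :
    BiPoly.const (-a) * l = -(BiPoly.const a * l) := by
  simp only [BiPoly.const, map_neg]
  ring

theorem inL_rescale_exp (l : BiPoly A) (a : A) :
    inL l (rescale a (exp A)) = expBi (BiPoly.const a * l) := by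
  ext1 n
  rw [coeff_inL, expBi, coeff_rescale, coeff_rescale, coeff_exp, coeff_exp, mul_pow, map_mul,
    map_mul, map_pow, map_pow]
  simp only [Polynomial.algebraMap_apply]
  ring

theorem inL_pw (l : BiPoly A) (f x : A⟦X⟧) : inL l (pw f x) = pw (inL l f) (inL l x) :=
  map_pw (inL l) (fun n a => l ^ n * Polynomial.C (Polynomial.C a)) (coeff_inL l) f x

/-- The combination of bases on which the bilateral sums depend is symmetric in `c ↦ -c`. -/
theorem bases_symm {c : A} (hc : c ≠ 0) :
    C z * (inL z (calSPow c) * expBi (BiPoly.const (c / 2) * w)) +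
      C w * (inL w (calSPow c) * expBi (-(BiPoly.const (c / 2) * z))) =
    C z * (inL z (calSPow c) * expBi (-(BiPoly.const (c / 2) * w))) +
      C w * (inL w (calSPow c) * expBi (BiPoly.const (c / 2) * z)) := by
  have hz := congrArg (inL z) (C_mul_X_mul_calSPow hc)
  have hw := congrArg (inL w) (C_mul_X_mul_calSPow hc)
  simp only [map_mul, inL_C, inL_X, sigmaPow, map_sub, inL_rescale_exp, BiPoly.const_neg_mul] at hz hw
  have hreg : (C (BiPoly.const c) * X : (BiPoly A)⟦X⟧) ≠ 0 := by
    refine mul_ne_zero ?_ X_ne_zero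
    intro h
    apply hc
    have h2 : BiPoly.const c = 0 := by
      have := congrArg constantCoeff h
      simpa using this
    simpa using h2
  apply mul_left_cancel₀ hreg
  linear_combination (expBi (BiPoly.const (c / 2) * w) - expBi (-(BiPoly.const (c / 2) * w))) * hz
    + (expBi (-(BiPoly.const (c / 2) * z)) - expBi (BiPoly.const (c / 2) * z)) * hw

/-- The exponent `c (k w - l z) / (2 r)` for `k = a + i r` and `l = b + (m - i) r`. -/
def wedgeExp (c : A) (r a b : ℕ) (m i : ℤ) : BiPoly A :=
  BiPoly.const (c / (2 * r)) *
    (((a + i * r : ℤ) : BiPoly A) * w - ((b + (m - i) * r : ℤ) : BiPoly A) * z)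

/-- The exponential factors of the bases in `bases_symm`, raised to the exponents that occur in
the bilateral sum, combine to the exponential occurring in the commutators of the modes. -/
theorem pw_expBi_mul_pw_expBi {r : ℕ} (hr : r ≠ 0) (c : A) (a b : ℕ) (m i : ℤ) :
    pw (expBi (BiPoly.const (c / 2) * w)) (inL z (xExp A r a) + (i : (BiPoly A)⟦X⟧)) *
      pw (expBi (-(BiPoly.const (c / 2) * z))) (inL w (xExp A r b) + ((m - i : ℤ) : (BiPoly A)⟦X⟧)) =
    expBi (wedgeExp c r a b m i) := by
  have hr' : (r : A) ≠ 0 := by exact_mod_cast hr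
  rw [pw_expBi, pw_expBi, ← pw_add constantCoeff_exp, expBi_eq_pw]
  congr 1
  simp only [xExp, map_mul, map_add, inL_C, inL_X, wedgeExp, map_neg, map_sub,
    BiPoly.const]
  have e1 : (C (Polynomial.C (Polynomial.C (c / 2))) : (BiPoly A)⟦X⟧) =
      C (Polynomial.C (Polynomial.C (c / (2 * r)))) * (r : (BiPoly A)⟦X⟧) := by
    have : c / 2 = c / (2 * r) * r := by field_simp
    rw [this]; simp
  have e2 : (C (Polynomial.C (Polynomial.C ((r : A)⁻¹))) : (BiPoly A)⟦X⟧) *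
      (r : (BiPoly A)⟦X⟧) = 1 := by
    have : (r : (BiPoly A)⟦X⟧) = C (Polynomial.C (Polynomial.C (r : A))) := by simp
    rw [this, ← map_mul, ← map_mul, ← map_mul, inv_mul_cancel₀ hr']; simp
  simp only [map_natCast, map_intCast]
  rw [e1]
  push_cast
  linear_combination (C (Polynomial.C (Polynomial.C (c / (2 * r)))) *
    (C w * (C z * X + (a : (BiPoly A)⟦X⟧)) - C z * (C w * X + (b : (BiPoly A)⟦X⟧)))) * e2

/-- The coefficient of `𝓔_{ir+a}(c z / r)` in `𝓐_{a/r}(z)`, without the power `z ^ i` and the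
prefactor `ρ ^ a * z / (z + a)`. -/
def coreCoeff (c : A) (r a : ℕ) (i : ℤ) : A⟦X⟧ :=
  invPoch (xExp A r a) i * pw (calSPow c) (xExp A r a + i)

/-- The vanishing of the bilateral sum that makes the operators commute up to a scalar: the two
exponentials turn it into two bilateral binomial sums, for the two pairs of bases of `bases_symm`. -/
theorem biSum_coreCoeff_mul_sub {c : A} (hc : c ≠ 0) {r : ℕ} (hr : r ≠ 0) (a b : ℕ) (m : ℤ)
    (d : ℕ) (p q : ℤ) :
    biSum m (fun i => inL z (coreCoeff c r a i) * inL w (coreCoeff c r b (m - i)) *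
      (expBi (wedgeExp c r a b m i) - expBi (-wedgeExp c r a b m i))) d p q = 0 := by
  have hS := constantCoeff_calSPow hc
  have hSz := constantCoeff_inL z hS
  have hSw := constantCoeff_inL w hS
  have ha : ∀ i : ℤ, (inL z (xExp A r a) + i) * inL z (invPoch (xExp A r a) i) =
      inL z (invPoch (xExp A r a) (i - 1)) := by
    intro i
    rw [← add_mul_invPoch (constantCoeff_xExp_add_ne_zero r a), map_mul, map_add, map_intCast]
  have hb : ∀ i : ℤ, (inL w (xExp A r b) + i) * inL w (invPoch (xExp A r b) i) =
      inL w (invPoch (xExp A r b) (i - 1)) := by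
    intro i
    rw [← add_mul_invPoch (constantCoeff_xExp_add_ne_zero r b), map_mul, map_add, map_intCast]
  have hE := constantCoeff_expBi (A := A)
  have h1 : ∀ f g : (BiPoly A)⟦X⟧, constantCoeff f = 1 → constantCoeff g = 1 →
      constantCoeff (f * g) = 1 := by
    intro f g hf hg; rw [map_mul, hf, hg, one_mul]
  have key := biSum_pw_mul_pw_congr ha hb (h1 _ _ hSz (hE _)) (h1 _ _ hSw (hE _))
    (h1 _ _ hSz (hE _)) (h1 _ _ hSw (hE _)) (bases_symm hc) m d p q
  rw [← sub_eq_zero] at key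
  rw [← key, sub_eq_add_neg, ← neg_one_mul, ← biSum_const_mul, ← biSum_add]
  refine biSum_congr (fun i => congrArg (coeff d) ?_) p q
  have e1 := pw_expBi_mul_pw_expBi hr c a b m i
  have e2 := pw_expBi_mul_pw_expBi hr (-c) a b m i
  have e3 : wedgeExp (-c) r a b m i = -wedgeExp c r a b m i := by
    rw [wedgeExp, wedgeExp, neg_div, BiPoly.const_neg_mul]
  rw [e3, neg_div, BiPoly.const_neg_mul, BiPoly.const_neg_mul, neg_neg] at e2
  rw [mul_pw hSz (hE _), mul_pw hSw (hE _), mul_pw hSz (hE _), mul_pw hSw (hE _), ← e1, ← e2,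
    coreCoeff, coreCoeff, map_mul, map_mul, inL_pw, inL_pw, map_add, map_add, map_intCast,
    map_intCast]
  simp only [map_neg, map_one]
  ring

/-- Dividing the coefficients by `exp (t l) - exp (- t l)` for `l = c (z + w) / 2` leaves a
bilateral sum which is annihilated by `z + w`. -/
theorem biSum_add_eq_zero_of_mul {c : A} (hc : c ≠ 0) {m : ℤ} {F : ℤ → (BiPoly A)⟦X⟧}
    (h : ∀ d p q, biSum m (fun i => F i * inL (z + w) (sigmaPow c)) d p q = 0) (d : ℕ)
    (p q : ℤ) : biSum m F d (p - 1) q + biSum m F d p (q - 1) = 0 := by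
  have hu : constantCoeff (inL (z + w) (calSPow c)) = 1 :=
    constantCoeff_inL _ (constantCoeff_calSPow hc)
  have h1 := biSum_mul_eq_zero h
    (C (BiPoly.const c⁻¹) * pw (inL (z + w) (calSPow c)) (-1)) (d + 1) p q
  have h2 : ∀ i, C (BiPoly.const c⁻¹) * pw (inL (z + w) (calSPow c)) (-1) *
      (F i * inL (z + w) (sigmaPow c)) = X * (C (z + w) * F i) := by
    intro i
    have e1 := pw_neg_mul hu 1
    rw [pw_one hu] at e1
    have e2 : C (BiPoly.const c⁻¹) * C (BiPoly.const c) = (1 : (BiPoly A)⟦X⟧) := by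
      rw [← map_mul, ← map_mul, ← map_mul, inv_mul_cancel₀ hc]; simp
    rw [← C_mul_X_mul_calSPow hc, map_mul, map_mul, inL_C, inL_X]
    linear_combination (C (BiPoly.const c⁻¹) * C (BiPoly.const c) * (X * (C (z + w) * F i))) * e1
      + (X * (C (z + w) * F i)) * e2
  simp only [h2, biSum, coeff_succ_X_mul, coeff_C_mul, add_mul, cf_add, cf_z_mul, cf_w_mul] at h1
  rw [← h1]
  unfold biSum
  rw [← finsum_add_distrib]
  · refine finsum_congr fun i => ?_
    congr 2 <;> ring
  · exact biSum_support_finite m F d (p - 1) q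
  · exact biSum_support_finite m F d p (q - 1)

end BilateralExp

/-! ### Fermions -/

namespace Maya

theorem mem_insert_carrier {S : Maya} {j m : ℤ} :
    m ∈ (S.insert j).carrier ↔ m = j ∨ m ∈ S.carrier := Iff.rfl

theorem mem_erase_carrier {S : Maya} {j m : ℤ} :
    m ∈ (S.erase j).carrier ↔ m ∈ S.carrier ∧ m ≠ j := Iff.rfl

theorem finite_above (S : Maya) (j : ℤ) : {m : ℤ | m ∈ S.carrier ∧ j < m}.Finite := by
  refine (S.finite_pos.union (Set.finite_Ioo j 0)).subset ?_
  rintro m ⟨h1, h2⟩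
  by_cases h : 0 ≤ m
  · exact Or.inl ⟨h, h1⟩
  · exact Or.inr ⟨h2, by omega⟩

theorem sign_mul_self (S : Maya) (j : ℤ) : S.sign j * S.sign j = 1 := by
  rw [sign, ← pow_add, ← two_mul, pow_mul]; simp

/-- Inserting `j` changes the sign at `i` exactly if `j` is greater than `i`. -/
theorem sign_insert {S : Maya} {j : ℤ} (hj : j ∉ S.carrier) (i : ℤ) :
    (S.insert j).sign i = (if i < j then -1 else 1) * S.sign i := by
  split_ifs with h
  · have : {m : ℤ | m ∈ (S.insert j).carrier ∧ i < m} =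
        Insert.insert j {m : ℤ | m ∈ S.carrier ∧ i < m} := by
      ext m
      simp only [mem_insert_carrier, Set.mem_ofPred_eq, Set.mem_insert_iff]
      constructor
      · rintro ⟨h1 | h1, h2⟩
        · exact Or.inl h1
        · exact Or.inr ⟨h1, h2⟩
      · rintro (rfl | ⟨h1, h2⟩)
        · exact ⟨Or.inl rfl, h⟩
        · exact ⟨Or.inr h1, h2⟩
    rw [sign, sign, this, Set.ncard_insert_of_notMem (fun h => hj h.1) (S.finite_above i), pow_succ]
    ring
  · have : {m : ℤ | m ∈ (S.insert j).carrier ∧ i < m} = {m : ℤ | m ∈ S.carrier ∧ i < m} := by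
      ext m
      simp only [mem_insert_carrier, Set.mem_ofPred_eq]
      constructor
      · rintro ⟨rfl | h1, h2⟩
        · exact absurd h2 h
        · exact ⟨h1, h2⟩
      · rintro ⟨h1, h2⟩
        exact ⟨Or.inr h1, h2⟩
    rw [sign, sign, this, one_mul]

theorem insert_erase {S : Maya} {j : ℤ} (hj : j ∈ S.carrier) : (S.erase j).insert j = S := by
  ext m
  rw [mem_insert_carrier, mem_erase_carrier]
  by_cases h : m = j
  · simp [h, hj]
  · simp [h]

theorem erase_insert {S : Maya} {j : ℤ} (hj : j ∉ S.carrier) : (S.insert j).erase j = S := by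
  ext m
  rw [mem_erase_carrier, mem_insert_carrier]
  by_cases h : m = j
  · simp [h, hj]
  · simp [h]

theorem insert_insert_comm (S : Maya) (i j : ℤ) : (S.insert i).insert j = (S.insert j).insert i := by
  ext m
  simp only [mem_insert_carrier]
  tauto

theorem erase_erase_comm (S : Maya) (i j : ℤ) : (S.erase i).erase j = (S.erase j).erase i := by
  ext m
  simp only [mem_erase_carrier]
  tauto

theorem erase_insert_comm (S : Maya) {i j : ℤ} (h : i ≠ j) :
    (S.insert i).erase j = (S.erase j).insert i := by
  ext m
  simp only [mem_erase_carrier, mem_insert_carrier]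
  constructor
  · rintro ⟨h1 | h1, h2⟩
    · exact Or.inl h1
    · exact Or.inr ⟨h1, h2⟩
  · rintro (rfl | ⟨h1, h2⟩)
    · exact ⟨Or.inl rfl, h⟩
    · exact ⟨Or.inr h1, h2⟩

theorem sign_erase {S : Maya} {j : ℤ} (hj : j ∈ S.carrier) (i : ℤ) :
    (S.erase j).sign i = (if i < j then -1 else 1) * S.sign i := by
  have h := sign_insert (S := S.erase j) (j := j) (fun h => h.2 rfl) i
  rw [insert_erase hj] at h
  rw [h, ← mul_assoc]
  split_ifs <;> simp

end Maya

theorem psi_single_of_mem {j : ℤ} {S : Maya} (h : j ∈ S.carrier) (c : ℂ) :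
    psi j (Finsupp.single S c) = 0 := by
  simp [psi, h]

theorem psi_single_of_notMem {j : ℤ} {S : Maya} (h : j ∉ S.carrier) (c : ℂ) :
    psi j (Finsupp.single S c) = Finsupp.single (S.insert j) (c * S.sign j) := by
  simp [psi, h]

theorem psiStar_single_of_mem {j : ℤ} {S : Maya} (h : j ∈ S.carrier) (c : ℂ) :
    psiStar j (Finsupp.single S c) = Finsupp.single (S.erase j) (c * S.sign j) := by
  simp [psiStar, h]

theorem psiStar_single_of_notMem {j : ℤ} {S : Maya} (h : j ∉ S.carrier) (c : ℂ) :
    psiStar j (Finsupp.single S c) = 0 := by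
  simp [psiStar, h]

theorem psi_mul_psi (i j : ℤ) (v : Wedge) : psi i (psi j v) = -psi j (psi i v) := by
  induction v using Finsupp.induction_linear with
  | zero => simp
  | add f g hf hg => simp only [map_add, hf, hg, neg_add]
  | single S c =>
    by_cases hj : j ∈ S.carrier
    · rw [psi_single_of_mem hj, map_zero]
      by_cases hi : i ∈ S.carrier
      · rw [psi_single_of_mem hi]; simp
      · rw [psi_single_of_notMem hi, psi_single_of_mem (Or.inr hj)]; simp
    · rw [psi_single_of_notMem hj]
      by_cases hi : i ∈ S.carrier
      · rw [psi_single_of_mem hi, psi_single_of_mem (Or.inr hi)]; simp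
      · rw [psi_single_of_notMem hi]
        by_cases hij : i = j
        · subst hij
          rw [psi_single_of_mem (Or.inl rfl)]; simp
        · rw [psi_single_of_notMem, psi_single_of_notMem, Maya.sign_insert hj, Maya.sign_insert hi,
            Maya.insert_insert_comm, ← Finsupp.single_neg]
          · congr 1
            rcases lt_or_gt_of_ne hij with h | h
            · rw [if_pos h, if_neg (by omega)]; ring
            · rw [if_neg (by omega), if_pos h]; ring
          · rintro (h | h)
            · exact hij h.symm
            · exact hj h
          · rintro (h | h)
            · exact hij h
            · exact hi h

theorem psiStar_mul_psiStar (i j : ℤ) (v : Wedge) :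
    psiStar i (psiStar j v) = -psiStar j (psiStar i v) := by
  induction v using Finsupp.induction_linear with
  | zero => simp
  | add f g hf hg => simp only [map_add, hf, hg, neg_add]
  | single S c =>
    by_cases hj : j ∈ S.carrier
    · rw [psiStar_single_of_mem hj]
      by_cases hi : i ∈ S.carrier
      · rw [psiStar_single_of_mem hi]
        by_cases hij : i = j
        · subst hij
          rw [psiStar_single_of_notMem (fun h => (Maya.mem_erase_carrier.mp h).2 rfl)]; simp
        · rw [psiStar_single_of_mem (Maya.mem_erase_carrier.mpr ⟨hi, hij⟩), psiStar_single_of_mem (Maya.mem_erase_carrier.mpr ⟨hj, Ne.symm hij⟩),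
            Maya.sign_erase hj, Maya.sign_erase hi, Maya.erase_erase_comm, ← Finsupp.single_neg]
          congr 1
          rcases lt_or_gt_of_ne hij with h | h
          · rw [if_pos h, if_neg (by omega)]; ring
          · rw [if_neg (by omega), if_pos h]; ring
      · rw [psiStar_single_of_notMem hi, psiStar_single_of_notMem (fun h => hi (Maya.mem_erase_carrier.mp h).1)]; simp
    · rw [psiStar_single_of_notMem hj]
      by_cases hi : i ∈ S.carrier
      · rw [psiStar_single_of_mem hi, psiStar_single_of_notMem (fun h => hj (Maya.mem_erase_carrier.mp h).1)]; simp
      · rw [psiStar_single_of_notMem hi]; simp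

/-- The canonical anticommutation relation. -/
theorem psiStar_mul_psi (i j : ℤ) (v : Wedge) :
    psiStar j (psi i v) = (if i = j then v else 0) - psi i (psiStar j v) := by
  induction v using Finsupp.induction_linear with
  | zero => simp
  | add f g hf hg =>
    simp only [map_add, hf, hg]
    split_ifs <;> abel
  | single S c =>
    by_cases hij : i = j
    · subst hij
      rw [if_pos rfl]
      by_cases hi : i ∈ S.carrier
      · rw [psi_single_of_mem hi, psiStar_single_of_mem hi, psi_single_of_notMem (fun h => (Maya.mem_erase_carrier.mp h).2 rfl),
          Maya.sign_erase hi, Maya.insert_erase hi]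
        simp [mul_assoc, Maya.sign_mul_self]
      · rw [psi_single_of_notMem hi, psiStar_single_of_notMem hi, psiStar_single_of_mem (Or.inl rfl),
          Maya.sign_insert hi, Maya.erase_insert hi]
        simp [mul_assoc, Maya.sign_mul_self]
    · rw [if_neg hij]
      by_cases hi : i ∈ S.carrier
      · rw [psi_single_of_mem hi]
        by_cases hj : j ∈ S.carrier
        · rw [psiStar_single_of_mem hj, psi_single_of_mem (Maya.mem_erase_carrier.mpr ⟨hi, hij⟩)]; simp
        · rw [psiStar_single_of_notMem hj]; simp
      · rw [psi_single_of_notMem hi]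
        by_cases hj : j ∈ S.carrier
        · rw [psiStar_single_of_mem hj, psi_single_of_notMem (fun h => hi (Maya.mem_erase_carrier.mp h).1),
            psiStar_single_of_mem (Or.inr hj), Maya.sign_insert hi, Maya.sign_erase hj,
            Maya.erase_insert_comm S hij, zero_sub, ← Finsupp.single_neg]
          congr 1
          rcases lt_or_gt_of_ne hij with h | h
          · rw [if_neg (by omega), if_pos h]; ring
          · rw [if_pos h, if_neg (by omega)]; ring
        · rw [psiStar_single_of_notMem hj, psiStar_single_of_notMem]
          · simp
          · rintro (h | h)
            · exact hij h.symm
            · exact hj h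

/-- The constant subtracted in normal ordering. -/
def theta (j : ℤ) : ℂ := if j < 0 then 1 else 0

theorem elemOp_apply (i j : ℤ) (v : Wedge) :
    elemOp i j v = psi i (psiStar j v) - (if i = j then theta j else 0) • v := by
  unfold elemOp theta
  by_cases h : 0 ≤ j
  · rw [if_pos h]; simp [not_lt.mpr h]
  · rw [if_neg h, if_pos (not_le.mp h)]
    simp only [LinearMap.neg_apply, LinearMap.comp_apply, psiStar_mul_psi]
    split_ifs <;> simp

/-- The commutation relations of the operators `E_{i,j}`, with their central extension. -/
theorem elemOp_commutator (i j k l : ℤ) (v : Wedge) :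
    elemOp i j (elemOp k l v) - elemOp k l (elemOp i j v) =
      (if j = k then elemOp i l v else 0) - (if i = l then elemOp k j v else 0)
        + (if j = k ∧ i = l then theta i - theta j else 0) • v := by
  have h1 : psi i (psiStar j (psi k (psiStar l v))) - psi k (psiStar l (psi i (psiStar j v))) =
      (if j = k then psi i (psiStar l v) else 0) - (if i = l then psi k (psiStar j v) else 0) := by
    rw [psiStar_mul_psi k j, psiStar_mul_psi i l, map_sub, map_sub, psi_mul_psi i k,
      psiStar_mul_psiStar j l]
    simp only [map_neg, neg_neg]
    by_cases hjk : j = k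
    · subst hjk
      split_ifs <;> simp <;> abel
    · rw [if_neg (Ne.symm hjk), if_neg hjk]
      split_ifs <;> simp <;> abel
  have h2 : elemOp i j (elemOp k l v) - elemOp k l (elemOp i j v) =
      psi i (psiStar j (psi k (psiStar l v))) - psi k (psiStar l (psi i (psiStar j v))) := by
    simp only [elemOp_apply, map_sub, map_smul, smul_sub, smul_smul]
    rw [mul_comm (if k = l then theta l else 0)]
    abel
  rw [h2, h1]
  by_cases hjk : j = k
  · subst hjk
    by_cases hil : i = l
    · subst hil
      simp only [if_true, and_self, elemOp_apply]
      by_cases hij : i = j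
      · subst hij; simp
      · module
    · simp [hil, elemOp_apply]
  · by_cases hil : i = l
    · subst hil
      simp [hjk, elemOp_apply, Ne.symm hjk]
    · simp [hjk, hil]

/-! ### Charge and energy -/

namespace Maya

/-- The sum of `g` over the elements of a Maya diagram, relative to the vacuum. -/
def weight (g : ℤ → ℤ) (S : Maya) : ℤ :=
  ∑ m ∈ S.finite_pos.toFinset, g m - ∑ m ∈ S.finite_neg.toFinset, g m

theorem weight_insert (g : ℤ → ℤ) {S : Maya} {j : ℤ} (hj : j ∉ S.carrier) :
    (S.insert j).weight g = S.weight g + g j := by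
  unfold weight
  by_cases h : 0 ≤ j
  · have h1 : (S.insert j).finite_pos.toFinset = Insert.insert j S.finite_pos.toFinset := by
      ext m
      simp only [Set.Finite.mem_toFinset, Finset.mem_insert, Set.mem_ofPred_eq, mem_insert_carrier]
      constructor
      · rintro ⟨h1, h2 | h2⟩
        · exact Or.inl h2
        · exact Or.inr ⟨h1, h2⟩
      · rintro (rfl | ⟨h1, h2⟩)
        · exact ⟨h, Or.inl rfl⟩
        · exact ⟨h1, Or.inr h2⟩
    have h2 : (S.insert j).finite_neg.toFinset = S.finite_neg.toFinset := by
      ext m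
      simp only [Set.Finite.mem_toFinset, Set.mem_ofPred_eq, mem_insert_carrier, not_or]
      constructor
      · rintro ⟨h1, h2, h3⟩
        exact ⟨h1, h3⟩
      · rintro ⟨h1, h2⟩
        exact ⟨h1, by omega, h2⟩
    rw [h1, h2, sum_insert (by simp [hj])]
    ring
  · have h1 : (S.insert j).finite_pos.toFinset = S.finite_pos.toFinset := by
      ext m
      simp only [Set.Finite.mem_toFinset, Set.mem_ofPred_eq, mem_insert_carrier]
      constructor
      · rintro ⟨h1, h2 | h2⟩
        · omega
        · exact ⟨h1, h2⟩
      · rintro ⟨h1, h2⟩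
        exact ⟨h1, Or.inr h2⟩
    have h2 : S.finite_neg.toFinset = Insert.insert j (S.insert j).finite_neg.toFinset := by
      ext m
      simp only [Set.Finite.mem_toFinset, Finset.mem_insert, Set.mem_ofPred_eq, mem_insert_carrier,
        not_or]
      constructor
      · rintro ⟨h1, h2⟩
        by_cases h3 : m = j
        · exact Or.inl h3
        · exact Or.inr ⟨h1, h3, h2⟩
      · rintro (rfl | ⟨h1, h2, h3⟩)
        · exact ⟨by omega, hj⟩
        · exact ⟨h1, h3⟩
    rw [h1, h2, sum_insert (by simp [mem_insert_carrier])]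
    ring

theorem weight_erase (g : ℤ → ℤ) {S : Maya} {j : ℤ} (hj : j ∈ S.carrier) :
    (S.erase j).weight g = S.weight g - g j := by
  have h := weight_insert g (S := S.erase j) (j := j) (fun h => h.2 rfl)
  rw [insert_erase hj] at h
  omega

theorem charge_eq_weight (S : Maya) : S.charge = S.weight fun _ => 1 := by
  rw [charge, weight, Set.ncard_eq_toFinset_card _ S.finite_pos,
    Set.ncard_eq_toFinset_card _ S.finite_neg]
  simp

/-- The energy of a Maya diagram of charge zero. -/
abbrev energy (S : Maya) : ℤ := S.weight fun m => m

theorem le_energy_of_mem {S : Maya} {m : ℤ} (h0 : 0 ≤ m) (h : m ∈ S.carrier) : m ≤ S.energy := by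
  have h1 : m ≤ ∑ m ∈ S.finite_pos.toFinset, m :=
    single_le_sum (f := fun m : ℤ => m) (fun i hi => by simp at hi; exact hi.1) (by simp [h0, h])
  have h2 : ∑ m ∈ S.finite_neg.toFinset, m ≤ 0 :=
    sum_nonpos fun i hi => by simp at hi; omega
  simp only [energy, weight]
  omega

theorem neg_le_energy_of_notMem {S : Maya} {m : ℤ} (h0 : m < 0) (h : m ∉ S.carrier) :
    -m ≤ S.energy := by
  have h1 : 0 ≤ ∑ m ∈ S.finite_pos.toFinset, m :=
    sum_nonneg fun i hi => by simp at hi; exact hi.1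
  have h2 : -m ≤ ∑ m ∈ S.finite_neg.toFinset, -m :=
    single_le_sum (f := fun m : ℤ => -m) (fun i hi => by simp at hi; omega) (by simp [h0, h])
  rw [sum_neg_distrib] at h2
  simp only [energy, weight]
  omega

theorem energy_nonneg (S : Maya) : 0 ≤ S.energy := by
  have h1 : 0 ≤ ∑ m ∈ S.finite_pos.toFinset, m :=
    sum_nonneg fun i hi => by simp at hi; exact hi.1
  have h2 : ∑ m ∈ S.finite_neg.toFinset, m ≤ 0 :=
    sum_nonpos fun i hi => by simp at hi; omega
  simp only [energy, weight]
  omega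

theorem energy_vacuum : vacuum.energy = 0 := by
  unfold energy weight
  rw [sum_eq_zero, sum_eq_zero]
  · simp
  · intro m hm; simp [vacuum] at hm; omega
  · intro m hm; simp [vacuum] at hm; omega

/-- The energy bounds the positions of the particles and of the holes, so each energy level is
finite. -/
theorem finite_energy_le (N : ℤ) : {S : Maya | S.energy ≤ N}.Finite := by
  have hfin : (𝒫 (Set.Icc (-N) N)).Finite := (Set.finite_Icc (-N) N).finite_subsets
  refine Set.Finite.of_finite_image (f := fun S : Maya => S.carrier ∩ Set.Icc (-N) N)
    (hfin.subset ?_) ?_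
  · rintro _ ⟨S, _, rfl⟩
    exact Set.inter_subset_right
  · intro S hS T hT h
    ext m
    have h1 := Set.ext_iff.mp h m
    simp only [Set.mem_inter_iff, Set.mem_Icc] at h1
    have hS' : S.energy ≤ N := hS
    have hT' : T.energy ≤ N := hT
    by_cases hm : -N ≤ m ∧ m ≤ N
    · tauto
    · have hN := S.energy_nonneg
      by_cases h0 : 0 ≤ m
      · have a1 : m ∉ S.carrier := fun h => by have := le_energy_of_mem h0 h; omega
        have a2 : m ∉ T.carrier := fun h => by have := le_energy_of_mem h0 h; omega
        tauto
      · have a1 : m ∈ S.carrier := by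
          by_contra h; have := neg_le_energy_of_notMem (by omega) h; omega
        have a2 : m ∈ T.carrier := by
          by_contra h; have := neg_le_energy_of_notMem (by omega) h; omega
        tauto

end Maya

/-- The diagrams of charge zero and energy at most `N`. -/
theorem finite_maya0_energy_le (N : ℤ) : {S : Maya0 | S.1.energy ≤ N}.Finite :=
  ((Maya.finite_energy_le N).preimage (f := Subtype.val) Subtype.val_injective.injOn).subset
    fun _ h => h

/-- `E_{i,j}` moves a particle from `j` to `i`; this gives both the conservation of charge and the
change of energy. -/
theorem weight_of_elemOp_ne_zero {i j : ℤ} {S T : Maya}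
    (h : elemOp i j (Finsupp.single S 1) T ≠ 0) (g : ℤ → ℤ) :
    T.weight g = S.weight g + g i - g j := by
  classical
  rw [elemOp_apply] at h
  by_cases hj : j ∈ S.carrier
  · rw [psiStar_single_of_mem hj] at h
    by_cases hi : i ∈ (S.erase j).carrier
    · rw [psi_single_of_mem hi] at h
      by_cases hij : i = j
      · by_cases hST : S = T
        · subst hST hij; ring
        · simp [hij, hST] at h
      · simp [hij] at h
    · rw [psi_single_of_notMem hi] at h
      by_cases hT : (S.erase j).insert i = T
      · rw [← hT, Maya.weight_insert g hi, Maya.weight_erase g hj]; ring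
      · by_cases hij : i = j
        · by_cases hST : S = T
          · subst hST hij; ring
          · simp [hij, hST, Finsupp.single_apply] at h
            rw [hij] at hT
            exact absurd h.1 (by simpa using hT)
        · simp [hij, hT] at h
  · rw [psiStar_single_of_notMem hj] at h
    by_cases hij : i = j
    · by_cases hST : S = T
      · subst hST hij; ring
      · simp [hij, hST] at h
    · simp [hij] at h

/-- Only finitely many particles of `S` can be moved by `k`, so `∑_j E_{j-k,j}` is defined on
basis vectors. -/
theorem finite_elemOp_ne_zero (k : ℤ) (S : Maya) :
    {j : ℤ | elemOp (j - k) j (Finsupp.single S 1) ≠ 0}.Finite := by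
  have h1 : {j : ℤ | j - k < 0 ∧ j - k ∉ S.carrier}.Finite :=
    (S.finite_neg.preimage (f := fun j => j - k) (sub_left_injective.injOn)).subset
      fun j hj => hj
  refine ((S.finite_pos.union h1).union (Set.finite_Icc k (-1))).subset ?_
  intro j hj
  by_contra hcon
  apply hj
  simp only [Set.mem_union, Set.mem_ofPred_eq, Set.mem_Icc, not_or, not_and, not_not, not_le] at hcon
  obtain ⟨⟨c1, c2⟩, c3⟩ := hcon
  rw [elemOp_apply]
  by_cases h0 : 0 ≤ j
  · rw [psiStar_single_of_notMem (c1 h0)]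
    by_cases hk : k = 0
    · simp [theta, not_lt.mpr h0]
    · rw [if_neg (by omega)]; simp
  · have c4 : j - k ∈ S.carrier := c2 (by by_contra; have := c3 (by omega); omega)
    by_cases hk : k = 0
    · subst hk
      rw [sub_zero] at c4 ⊢
      rw [psiStar_single_of_mem c4,
        psi_single_of_notMem (fun h => (Maya.mem_erase_carrier.mp h).2 rfl),
        Maya.sign_erase c4, Maya.insert_erase c4]
      simp [theta, not_le.mp h0, Maya.sign_mul_self]
    · rw [if_neg (by omega)]
      by_cases hjS : j ∈ S.carrier
      · rw [psiStar_single_of_mem hjS,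
          psi_single_of_mem (Maya.mem_erase_carrier.mpr ⟨c4, by omega⟩)]
        simp
      · rw [psiStar_single_of_notMem hjS]; simp

/-! ### Commutators of the modes -/

section Modes

/-- The matrix element `(E_{i,j} v_S, v_T)`. -/
def ent (i j : ℤ) (S T : Maya0) : ℂ := elemOp i j (Finsupp.single S.1 1) T.1

theorem energy_of_ent_ne_zero {k j : ℤ} {S T : Maya0} (h : ent (j - k) j S T ≠ 0) :
    S.1.energy = T.1.energy + k := by
  have := weight_of_elemOp_ne_zero h fun m => m
  simp only [Maya.energy] at *
  omega

/-- The finitely many `j` for which `E_{j-k,j}` does not annihilate `v_S`. -/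
def modeSupp (k : ℤ) (S : Maya0) : Finset ℤ := (finite_elemOp_ne_zero k S.1).toFinset

theorem mem_modeSupp {k j : ℤ} {S T : Maya0} (h : ent (j - k) j S T ≠ 0) : j ∈ modeSupp k S := by
  rw [modeSupp, Set.Finite.mem_toFinset]
  intro h0
  apply h
  rw [ent, h0]; simp

/-- Composition of operators in terms of matrix elements. -/
theorem elemOp_elemOp_apply (i j i' j' : ℤ) (S T : Maya0) (s : Finset Maya0)
    (hs : ∀ U : Maya0, ent i' j' S U ≠ 0 → U ∈ s) :
    elemOp i j (elemOp i' j' (Finsupp.single S.1 1)) T.1 =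
      ∑ U ∈ s, ent i j U T * ent i' j' S U := by
  have h1 : elemOp i' j' (Finsupp.single S.1 1) =
      ∑ U ∈ s, ent i' j' S U • (Finsupp.single U.1 1 : Wedge) := by
    ext U
    by_cases hU : elemOp i' j' (Finsupp.single S.1 1) U = 0
    · rw [hU, Finsupp.finsetSum_apply, sum_eq_zero]
      intro V _
      by_cases hV : V.1 = U
      · rw [ent, hV, hU]; simp
      · simp [hV]
    · have hc : U.charge = 0 := by
        rw [Maya.charge_eq_weight, weight_of_elemOp_ne_zero hU, ← Maya.charge_eq_weight, S.2]
        simp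
      have hm : (⟨U, hc⟩ : Maya0) ∈ s := hs ⟨U, hc⟩ hU
      rw [Finsupp.finsetSum_apply, sum_eq_single_of_mem _ hm]
      · simp [ent]
      · intro V _ hV
        have : V.1 ≠ U := fun h => hV (Subtype.ext h)
        simp [this]
  rw [h1, map_sum, Finsupp.finsetSum_apply]
  refine sum_congr rfl fun U _ => ?_
  rw [map_smul, Finsupp.smul_apply, smul_eq_mul, mul_comm]
  rfl

variable {P : Type*} [CommRing P] [Algebra ℂ P]

/-- The matrix element `(∑ⱼ φ j • E_{j-k,j} v_S, v_T)`. -/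
def modeEnt (k : ℤ) (φ : ℤ → P) (S T : Maya0) : P :=
  ∑ᶠ j : ℤ, algebraMap ℂ P (ent (j - k) j S T) * φ j

theorem modeEnt_eq_sum (k : ℤ) (φ : ℤ → P) (S T : Maya0) {J : Finset ℤ} (hJ : modeSupp k S ⊆ J) :
    modeEnt k φ S T = ∑ j ∈ J, algebraMap ℂ P (ent (j - k) j S T) * φ j := by
  apply finsum_eq_sum_of_support_subset
  intro j hj
  apply hJ
  apply mem_modeSupp (T := T)
  intro h
  apply hj
  simp [h]

theorem energy_of_modeEnt_ne_zero {k : ℤ} {φ : ℤ → P} {S T : Maya0} (h : modeEnt k φ S T ≠ 0) :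
    S.1.energy = T.1.energy + k := by
  by_contra hne
  apply h
  rw [modeEnt_eq_sum k φ S T subset_rfl]
  refine sum_eq_zero fun j _ => ?_
  have : ent (j - k) j S T = 0 := by
    by_contra h; exact hne (energy_of_ent_ne_zero h)
  simp [this]

theorem map_modeEnt {P' : Type*} [CommRing P'] [Algebra ℂ P'] (f : P →+* P')
    (hf : ∀ x : ℂ, f (algebraMap ℂ P x) = algebraMap ℂ P' x) (k : ℤ) (φ : ℤ → P) (S T : Maya0) :
    f (modeEnt k φ S T) = modeEnt k (fun j => f (φ j)) S T := by
  rw [modeEnt_eq_sum k φ S T subset_rfl, modeEnt_eq_sum k _ S T subset_rfl, map_sum]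
  simp only [map_mul, hf]

/-- The finite set of diagrams of charge zero and energy at most `N`. -/
def levelSet (N : ℤ) : Finset Maya0 := (finite_maya0_energy_le N).toFinset

theorem mem_levelSet {N : ℤ} {S : Maya0} : S ∈ levelSet N ↔ S.1.energy ≤ N := by
  simp [levelSet]

/-- A product of two modes as a double sum over a sufficiently large range. -/
theorem sum_modeEnt_mul_modeEnt (k l : ℤ) (φ ψ : ℤ → P) (S T : Maya0) {N : ℤ}
    (hN : S.1.energy - l ≤ N) {J : Finset ℤ} (hJ1 : modeSupp l S ⊆ J)
    (hJ2 : ∀ U ∈ levelSet N, modeSupp k U ⊆ J) :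
    ∑ U ∈ levelSet N, modeEnt k φ U T * modeEnt l ψ S U =
      ∑ i ∈ J, ∑ j ∈ J, algebraMap ℂ P
        (elemOp (i - k) i (elemOp (j - l) j (Finsupp.single S.1 1)) T.1) * (φ i * ψ j) := by
  have h1 : ∀ U ∈ levelSet N, modeEnt k φ U T * modeEnt l ψ S U = ∑ i ∈ J, ∑ j ∈ J,
      algebraMap ℂ P (ent (i - k) i U T * ent (j - l) j S U) * (φ i * ψ j) := by
    intro U hU
    rw [modeEnt_eq_sum k φ U T (hJ2 U hU), modeEnt_eq_sum l ψ S U hJ1, sum_mul_sum]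
    refine sum_congr rfl fun i _ => sum_congr rfl fun j _ => ?_
    rw [map_mul]; ring
  rw [sum_congr rfl h1, sum_comm]
  refine sum_congr rfl fun i _ => ?_
  rw [sum_comm]
  refine sum_congr rfl fun j _ => ?_
  rw [← sum_mul, ← map_sum, elemOp_elemOp_apply _ _ _ _ S T (levelSet N)]
  intro U hU
  rw [mem_levelSet]
  have := energy_of_ent_ne_zero hU
  omega

theorem finite_theta_sub (k : ℤ) : {j : ℤ | theta (j - k) - theta j ≠ 0}.Finite := by
  refine ((Set.finite_Ico 0 k).union (Set.finite_Ico k 0)).subset ?_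
  intro j hj
  by_contra h
  apply hj
  simp only [Set.mem_union, Set.mem_Ico, not_or, not_and, not_lt] at h
  unfold theta
  by_cases h1 : j < 0
  · rw [if_pos h1, if_pos (by have := h.2; omega), sub_self]
  · rw [if_neg h1, if_neg (by have := h.1; omega), sub_self]

/-- A finite range containing finitely many prescribed supports and their shifts. -/
theorem exists_large_range (k l : ℤ) (S : Maya0) (s : Finset Maya0) (J0 : Finset ℤ) :
    ∃ J : Finset ℤ, modeSupp k S ⊆ J ∧ modeSupp l S ⊆ J ∧ (∀ U ∈ s, modeSupp k U ⊆ J) ∧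
      (∀ U ∈ s, modeSupp l U ⊆ J) ∧ (∀ j ∈ J0, j ∈ J) ∧ (∀ j ∈ J0, j - l ∈ J) ∧
      (∀ j ∈ J0, j - k ∈ J) := by
  refine ⟨modeSupp k S ∪ modeSupp l S ∪ s.biUnion (modeSupp k) ∪ s.biUnion (modeSupp l) ∪ J0 ∪
    J0.image (fun j => j - l) ∪ J0.image (fun j => j - k), ?_, ?_, ?_, ?_, ?_, ?_, ?_⟩
  · intro j hj; simp [hj]
  · intro j hj; simp [hj]
  · intro U hU j hj
    have := subset_biUnion_of_mem (modeSupp k) hU hj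
    simp only [mem_union, this, true_or, or_true]
  · intro U hU j hj
    have := subset_biUnion_of_mem (modeSupp l) hU hj
    simp only [mem_union, this, true_or, or_true]
  · intro j hj
    simp only [mem_union, hj, true_or, or_true]
  · intro j hj
    have := mem_image_of_mem (fun j => j - l) hj
    simp only [mem_union, this, true_or, or_true]
  · intro j hj
    have := mem_image_of_mem (fun j => j - k) hj
    simp only [mem_union, this, or_true]

open Classical in
/-- The contribution of a single pair of elementary operators to the commutator of two modes. -/
theorem modeEnt_commutator_term (k l : ℤ) (φ ψ : ℤ → P) (S T : Maya0) (i j : ℤ) :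
    algebraMap ℂ P
        (elemOp (i - k) i (elemOp (j - l) j (Finsupp.single S.1 1)) T.1) * (φ i * ψ j) -
      algebraMap ℂ P
        (elemOp (j - l) j (elemOp (i - k) i (Finsupp.single S.1 1)) T.1) * (ψ j * φ i) =
      (if i = j - l then algebraMap ℂ P (ent (j - (k + l)) j S T) * (φ (j - l) * ψ j) else 0) -
      (if j = i - k then algebraMap ℂ P (ent (i - (k + l)) i S T) * (φ i * ψ (i - k)) else 0) +
      (if j = i - k then (if k + l = 0 ∧ S = T then
        algebraMap ℂ P (theta (i - k) - theta i) * (φ i * ψ (i - k)) else 0) else 0) := by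
  have h2 := congrArg (fun v : Wedge => v T.1)
    (elemOp_commutator (i - k) i (j - l) j (Finsupp.single S.1 1))
  simp only [Finsupp.sub_apply, Finsupp.add_apply, Finsupp.smul_apply, smul_eq_mul] at h2
  rw [mul_comm (ψ j), ← sub_mul, ← map_sub, h2]
  have e1 : (if i = j - l then elemOp (i - k) j (Finsupp.single S.1 1) else 0) T.1 =
      if i = j - l then ent (j - (k + l)) j S T else 0 := by
    split_ifs with h
    · rw [ent, h, show j - l - k = j - (k + l) by ring]
    · rfl
  have e2 : (if i - k = j then elemOp (j - l) i (Finsupp.single S.1 1) else 0) T.1 =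
      if j = i - k then ent (i - (k + l)) i S T else 0 := by
    by_cases h : j = i - k
    · rw [if_pos h, if_pos h.symm, ent, h, show i - k - l = i - (k + l) by ring]
    · rw [if_neg h, if_neg (Ne.symm h)]; rfl
  have e3 : (if i = j - l ∧ i - k = j then theta (i - k) - theta i else 0) *
      (Finsupp.single S.1 (1 : ℂ)) T.1 = if j = i - k then (if k + l = 0 ∧ S = T then
      theta (i - k) - theta i else 0) else 0 := by
    by_cases h : j = i - k
    · rw [if_pos h, Finsupp.single_apply]
      by_cases h3 : S = T
      · have : S.1 = T.1 := congrArg Subtype.val h3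
        by_cases h4 : k + l = 0
        · rw [if_pos ⟨by omega, h.symm⟩, if_pos this, if_pos ⟨h4, h3⟩, mul_one]
        · rw [if_neg (by omega : ¬(i = j - l ∧ i - k = j)),
            if_neg (fun h' : k + l = 0 ∧ S = T => h4 h'.1), zero_mul]
      · have : S.1 ≠ T.1 := fun h => h3 (Subtype.ext h)
        rw [if_neg this, if_neg (fun h' : k + l = 0 ∧ S = T => h3 h'.2), mul_zero]
    · rw [if_neg h, if_neg (fun h' => h h'.2.symm), zero_mul]
  rw [e1, e2, e3, map_add, map_sub, add_mul, sub_mul]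
  congr 1
  · congr 1
    · by_cases h : i = j - l
      · rw [if_pos h, if_pos h, h]
      · rw [if_neg h, if_neg h]; simp
    · by_cases h : j = i - k
      · rw [if_pos h, if_pos h, h]
      · rw [if_neg h, if_neg h]; simp
  · by_cases h : j = i - k
    · rw [if_pos h, if_pos h]
      split_ifs
      · rw [h]
      · simp
    · rw [if_neg h, if_neg h]; simp

open Classical in
/-- The commutator of two modes. -/
theorem modeEnt_commutator (k l : ℤ) (φ ψ : ℤ → P) (S T : Maya0) {N : ℤ}
    (hk : S.1.energy - k ≤ N) (hl : S.1.energy - l ≤ N) :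
    ∑ U ∈ levelSet N, modeEnt k φ U T * modeEnt l ψ S U -
        ∑ U ∈ levelSet N, modeEnt l ψ U T * modeEnt k φ S U =
      modeEnt (k + l) (fun j => φ (j - l) * ψ j - φ j * ψ (j - k)) S T +
        if k + l = 0 ∧ S = T then
          ∑ᶠ j : ℤ, algebraMap ℂ P (theta (j - k) - theta j) * (φ j * ψ (j - k)) else 0 := by
  let J0 : Finset ℤ := modeSupp (k + l) S ∪ (finite_theta_sub k).toFinset
  obtain ⟨J, hJ1, hJ2, hJ3, hJ4, hJ5, hJ6, hJ7⟩ := exists_large_range k l S (levelSet N) J0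
  have hsupp : modeSupp (k + l) S ⊆ J := fun j hj => hJ5 j (mem_union_left _ hj)
  rw [sum_modeEnt_mul_modeEnt k l φ ψ S T hl hJ2 hJ3,
    sum_modeEnt_mul_modeEnt l k ψ φ S T hk hJ1 hJ4]
  conv_lhs => enter [2]; rw [sum_comm]
  rw [← sum_sub_distrib]
  simp only [← sum_sub_distrib]
  simp only [modeEnt_commutator_term k l φ ψ S T, sum_add_distrib, sum_sub_distrib]
  congr 1
  · rw [modeEnt_eq_sum _ _ S T hsupp]
    simp only [mul_sub, sum_sub_distrib]
    congr 1
    · rw [sum_comm]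
      refine sum_congr rfl fun j _ => ?_
      rw [sum_ite_eq' J (j - l)]
      split_ifs with h
      · rfl
      · have : ent (j - (k + l)) j S T = 0 := by
          by_contra h2
          exact h (hJ6 j (mem_union_left _ (mem_modeSupp h2)))
        simp [this]
    · refine sum_congr rfl fun i _ => ?_
      rw [sum_ite_eq' J (i - k)]
      split_ifs with h
      · rfl
      · have : ent (i - (k + l)) i S T = 0 := by
          by_contra h2
          exact h (hJ7 i (mem_union_left _ (mem_modeSupp h2)))
        simp [this]
  · by_cases hc : k + l = 0 ∧ S = T
    · simp only [if_pos hc]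
      have hmem : ∀ i, theta (i - k) - theta i ≠ 0 → i ∈ J0 := fun i hi =>
        mem_union_right _ (by simpa using hi)
      rw [finsum_eq_sum_of_support_subset (s := J)]
      · refine sum_congr rfl fun i _ => ?_
        rw [sum_ite_eq' J (i - k)]
        split_ifs with h
        · rfl
        · have : theta (i - k) - theta i = 0 := by
            by_contra h2
            exact h (hJ7 i (hmem i h2))
          simp [this]
      · intro i hi
        apply hJ5 i (hmem i _)
        intro h
        apply hi
        simp [h]
    · simp [hc]

/-- Telescoping of the central term. -/
theorem finsum_theta_sub (g : ℤ → P) (k : ℤ) :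
    ∑ᶠ j : ℤ, algebraMap ℂ P (theta (j - k) - theta j) * (g (j + 1) - g j) = g k - g 0 := by
  have hfin : ∀ k : ℤ, (Function.support fun j : ℤ =>
      algebraMap ℂ P (theta (j - k) - theta j) * (g (j + 1) - g j)).Finite := fun k =>
    (finite_theta_sub k).subset fun j hj h => hj (by simp [h])
  have hstep : ∀ k : ℤ, ∑ᶠ j : ℤ,
      algebraMap ℂ P (theta (j - (k + 1)) - theta j) * (g (j + 1) - g j) =
      ∑ᶠ j : ℤ, algebraMap ℂ P (theta (j - k) - theta j) * (g (j + 1) - g j) +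
        (g (k + 1) - g k) := by
    intro k
    have h1 : ∀ j : ℤ, algebraMap ℂ P (theta (j - (k + 1)) - theta j) * (g (j + 1) - g j) =
        algebraMap ℂ P (theta (j - k) - theta j) * (g (j + 1) - g j) +
          if j = k then g (j + 1) - g j else 0 := by
      intro j
      unfold theta
      by_cases h : j = k
      · subst h
        by_cases h3 : j < 0
        · simp [h3]
        · simp [h3]
      · rw [if_neg h, add_zero]
        by_cases h2 : j - k < 0
        · rw [if_pos h2, if_pos (by omega)]
        · rw [if_neg h2, if_neg (by omega)]
    rw [finsum_congr h1, finsum_add_distrib (hfin k),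
      finsum_eq_single (fun j => if j = k then g (j + 1) - g j else 0) k]
    · rw [if_pos rfl]
    · intro j hj; rw [if_neg hj]
    · exact (Set.finite_singleton k).subset fun j hj => by
        by_contra h; exact hj (if_neg h)
  induction k using Int.induction_on with
  | zero => simp
  | succ n ih => rw [hstep, ih]; ring
  | pred n ih =>
    have h := hstep (-(n : ℤ) - 1)
    rw [show -(n : ℤ) - 1 + 1 = -n by ring, ih] at h
    linear_combination -h

end Modes

/-! ### Commutators of the vertex operators on one factor -/

section Vertex

open PowerSeries BiPoly

variable {A : Type*} [Field A] [CharZero A] [Algebra ℂ A]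

/-- The coefficients `exp (c (j + 1/2 - k/2) X)` of the modes. -/
def expMode (c : A) (k j : ℤ) : A⟦X⟧ :=
  rescale (c * algebraMap ℂ A ((j : ℂ) + 1 / 2 - (k : ℂ) / 2)) (exp A)

/-- Matrix elements of `𝓔_k(c X)` without the constant term. -/
def regE (c : A) (k : ℤ) (S T : Maya0) : A⟦X⟧ := modeEnt k (expMode c k) S T

omit [CharZero A] in
theorem inL_algebraMap (l : BiPoly A) (x : ℂ) :
    inL l (algebraMap ℂ A⟦X⟧ x) = algebraMap ℂ (BiPoly A)⟦X⟧ x := by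
  rw [PowerSeries.algebraMap_apply, PowerSeries.algebraMap_apply, inL_C]
  rfl

theorem inL_regE (l : BiPoly A) (c : A) (k : ℤ) (S T : Maya0) :
    inL l (regE c k S T) = modeEnt k (fun j =>
      expBi (BiPoly.const (c * algebraMap ℂ A ((j : ℂ) + 1 / 2 - (k : ℂ) / 2)) * l)) S T := by
  rw [regE, map_modeEnt (inL l) (inL_algebraMap l)]
  simp only [expMode, inL_rescale_exp]

/-- The exponent `c (k w - l z) / 2`. -/
def crossExp (c : A) (k l : ℤ) : BiPoly A :=
  BiPoly.const (c / 2) * ((k : BiPoly A) * w - (l : BiPoly A) * z)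

/-- The central term in the commutator of `𝓔_k(c z)` and `𝓔_{-k}(c w)`. -/
def centralTerm (c : A) (k : ℤ) : (BiPoly A)⟦X⟧ :=
  ∑ᶠ j : ℤ, algebraMap ℂ (BiPoly A)⟦X⟧ (theta (j - k) - theta j) *
    expBi (BiPoly.const (c * algebraMap ℂ A ((j : ℂ) + 1 / 2 - (k : ℂ) / 2)) * (z + w))

theorem const_mul_eq (c : A) (x : ℂ) :
    BiPoly.const (c * algebraMap ℂ A x) = BiPoly.const (c / 2) * BiPoly.const (algebraMap ℂ A (2 * x)) := by
  have : c * algebraMap ℂ A x = c / 2 * algebraMap ℂ A (2 * x) := by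
    rw [map_mul, map_ofNat (algebraMap ℂ A) 2]; ring
  rw [this]; simp only [BiPoly.const, map_mul]

omit [CharZero A] in
theorem const_algebraMap_int (n : ℤ) : BiPoly.const (algebraMap ℂ A (n : ℂ)) = (n : BiPoly A) := by
  rw [map_intCast]; simp only [BiPoly.const, map_intCast]

/-- Products of the exponential weights of the modes. The exponents are half-integers, so twice
the exponents are compared, which reduces the identity to one between integral combinations of `l`
and `l'`. -/
theorem expBi_mul_eq (c : A) {x y v : ℂ} {l l' : BiPoly A} {n n' n'' : ℤ} (hx : 2 * x = (n : ℂ))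
    (hy : 2 * y = (n' : ℂ)) (hv : 2 * v = (n'' : ℂ)) {d : BiPoly A}
    (h : (n : BiPoly A) * l + (n' : BiPoly A) * l' = d + (n'' : BiPoly A) * (l + l')) :
    expBi (BiPoly.const (c * algebraMap ℂ A x) * l) *
        expBi (BiPoly.const (c * algebraMap ℂ A y) * l') =
      expBi (BiPoly.const (c / 2) * d) *
        expBi (BiPoly.const (c * algebraMap ℂ A v) * (l + l')) := by
  rw [← expBi_add, ← expBi_add, const_mul_eq, const_mul_eq, const_mul_eq, hx, hy, hv,
    const_algebraMap_int, const_algebraMap_int, const_algebraMap_int, mul_assoc, mul_assoc,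
    mul_assoc, ← mul_add, ← mul_add, h]

/-- The weights of the two orders of multiplication of `E_{i-k,i}` and `E_{j-l,j}` differ by a
factor that does not depend on the position `j`. -/
theorem expBi_commutator (c : A) (k l j : ℤ) :
    expBi (BiPoly.const (c * algebraMap ℂ A (((j - l : ℤ) : ℂ) + 1 / 2 - (k : ℂ) / 2)) * z) *
        expBi (BiPoly.const (c * algebraMap ℂ A ((j : ℂ) + 1 / 2 - (l : ℂ) / 2)) * w) -
      expBi (BiPoly.const (c * algebraMap ℂ A ((j : ℂ) + 1 / 2 - (k : ℂ) / 2)) * z) *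
        expBi (BiPoly.const (c * algebraMap ℂ A (((j - k : ℤ) : ℂ) + 1 / 2 - (l : ℂ) / 2)) * w) =
      (expBi (crossExp c k l) - expBi (-crossExp c k l)) *
        expBi (BiPoly.const (c * algebraMap ℂ A ((j : ℂ) + 1 / 2 - ((k + l : ℤ) : ℂ) / 2)) *
          (z + w)) := by
  have hv : (2 * ((j : ℂ) + 1 / 2 - ((k + l : ℤ) : ℂ) / 2)) = ((2 * j + 1 - (k + l) : ℤ) : ℂ) := by
    push_cast; ring
  rw [expBi_mul_eq c (n := 2 * (j - l) + 1 - k) (n' := 2 * j + 1 - l) (by push_cast; ring)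
    (by push_cast; ring) hv (d := (k : BiPoly A) * w - (l : BiPoly A) * z) (by push_cast; ring),
    expBi_mul_eq c (n := 2 * j + 1 - k) (n' := 2 * (j - k) + 1 - l) (by push_cast; ring)
    (by push_cast; ring) hv (d := -((k : BiPoly A) * w - (l : BiPoly A) * z)) (by push_cast; ring), crossExp, sub_mul,
    show BiPoly.const (c / 2) * -((k : BiPoly A) * w - (l : BiPoly A) * z) =
      -(BiPoly.const (c / 2) * ((k : BiPoly A) * w - (l : BiPoly A) * z)) by ring]

open Classical in
/-- The commutation relation of the operators `𝓔_k(c z)` and `𝓔_l(c w)`. -/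
theorem regE_commutator (c : A) (k l : ℤ) (S T : Maya0) {N : ℤ}
    (hk : S.1.energy - k ≤ N) (hl : S.1.energy - l ≤ N) :
    ∑ U ∈ levelSet N, inL z (regE c k U T) * inL w (regE c l S U) -
        ∑ U ∈ levelSet N, inL w (regE c l U T) * inL z (regE c k S U) =
      (expBi (crossExp c k l) - expBi (-crossExp c k l)) *
        inL (z + w) (regE c (k + l) S T) +
        if k + l = 0 ∧ S = T then centralTerm c k else 0 := by
  have h := modeEnt_commutator k l
    (fun j => expBi (BiPoly.const (c * algebraMap ℂ A ((j : ℂ) + 1 / 2 - (k : ℂ) / 2)) * z))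
    (fun j => expBi (BiPoly.const (c * algebraMap ℂ A ((j : ℂ) + 1 / 2 - (l : ℂ) / 2)) * w))
    S T hk hl
  simp only [← inL_regE] at h
  rw [h]
  refine congrArg₂ (· + ·) ?_ ?_
  · rw [inL_regE, modeEnt_eq_sum _ _ S T subset_rfl, modeEnt_eq_sum _ _ S T subset_rfl, mul_sum]
    refine sum_congr rfl fun j _ => ?_
    rw [mul_left_comm, expBi_commutator]
  · by_cases h : k + l = 0 ∧ S = T
    · rw [if_pos h, if_pos h, centralTerm]
      refine finsum_congr fun j => ?_
      congr 1
      rw [← expBi_add]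
      congr 1
      obtain rfl : l = -k := by omega
      have e1 : (((j - k : ℤ) : ℂ) + 1 / 2 - ((-k : ℤ) : ℂ) / 2) = ((j : ℂ) + 1 / 2 - (k : ℂ) / 2) := by
        push_cast; ring
      rw [e1, mul_add]
    · rw [if_neg h, if_neg h]

/-- The central term is a sum over `|k|` consecutive positions, a geometric progression, which
telescopes upon multiplication by `ς(c (z + w))`. -/
theorem centralTerm_mul (c : A) (k : ℤ) :
    centralTerm c k * inL (z + w) (sigmaPow c) =
      expBi (crossExp c k (-k)) - expBi (-crossExp c k (-k)) := by
  let g : ℤ → (BiPoly A)⟦X⟧ := fun j =>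
    expBi (BiPoly.const (c / 2) * (((2 * j - k : ℤ) : BiPoly A) * (z + w)))
  have hg : ∀ j : ℤ,
      expBi (BiPoly.const (c * algebraMap ℂ A ((j : ℂ) + 1 / 2 - (k : ℂ) / 2)) * (z + w)) *
        inL (z + w) (sigmaPow c) = g (j + 1) - g j := by
    intro j
    have e1 : (2 * ((j : ℂ) + 1 / 2 - (k : ℂ) / 2)) = ((2 * j + 1 - k : ℤ) : ℂ) := by
      push_cast; ring
    rw [sigmaPow, map_sub (inL (z + w)), inL_rescale_exp, inL_rescale_exp, BiPoly.const_neg_mul, mul_sub,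
      ← expBi_add, ← expBi_add, const_mul_eq, e1, const_algebraMap_int]
    congr 2
    · push_cast; ring
    · push_cast; ring
  have h2 := finsum_theta_sub g k
  rw [← finsum_congr fun j => by rw [← hg j, ← mul_assoc]] at h2
  rw [centralTerm, finsum_mul, h2]
  simp only [g, crossExp]
  congr 2
  · push_cast; ring
  · push_cast; ring

omit [CharZero A] [Algebra ℂ A] in
theorem cf_z_pow_mul (s : ℕ) (f : BiPoly A) (α β : ℤ) : cf (z ^ s * f) α β = cf f (α - s) β := by
  induction s generalizing α with
  | zero => simp
  | succ s ih => rw [pow_succ', mul_assoc, cf_z_mul, ih]; congr 1; push_cast; ring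

omit [CharZero A] [Algebra ℂ A] in
theorem cf_w_pow_mul (s : ℕ) (f : BiPoly A) (α β : ℤ) : cf (w ^ s * f) α β = cf f α (β - s) := by
  induction s generalizing β with
  | zero => simp
  | succ s ih => rw [pow_succ', mul_assoc, cf_w_mul, ih]; congr 1; push_cast; ring

omit [CharZero A] [Algebra ℂ A] in
theorem cf_const (a : A) (α β : ℤ) : cf (BiPoly.const a) α β = if α = 0 ∧ β = 0 then a else 0 := by
  unfold cf
  by_cases h : α = 0 ∧ β = 0
  · obtain ⟨rfl, rfl⟩ := h; simp
  · rw [if_neg h]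
    split_ifs with h1
    · rw [Polynomial.coeff_C]
      split_ifs with h2
      · rw [Polynomial.coeff_C, if_neg (by omega)]
      · simp
    · rfl

/-- The coefficient of degree `p`, which is zero for negative `p`. -/
def coefZ (f : A⟦X⟧) (p : ℤ) : A := if 0 ≤ p then coeff p.toNat f else 0

omit [CharZero A] [Algebra ℂ A] in
theorem coefZ_zero (p : ℤ) : coefZ (0 : A⟦X⟧) p = 0 := by simp [coefZ]

omit [CharZero A] [Algebra ℂ A] in
/-- Coefficients of a product of a series in `z` and a series in `w`. -/
theorem cf_coeff_inL_mul_inL (f g : A⟦X⟧) {d : ℕ} {α β : ℤ} (h : α + β = d) :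
    cf (coeff d (inL z f * inL w g)) α β = coefZ f α * coefZ g β := by
  have h1 : ∀ st : ℕ × ℕ, cf (coeff st.1 (inL z f) * coeff st.2 (inL w g)) α β =
      if α = st.1 ∧ β = st.2 then coeff st.1 f * coeff st.2 g else 0 := by
    intro st
    have e : coeff st.1 (inL z f) * coeff st.2 (inL w g) =
        z ^ st.1 * (w ^ st.2 * BiPoly.const (coeff st.1 f * coeff st.2 g)) := by
      rw [coeff_inL, coeff_inL, BiPoly.const, map_mul, map_mul]; ring
    rw [e, cf_z_pow_mul, cf_w_pow_mul, cf_const]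
    congr 1
    simp only [sub_eq_zero]
  rw [coeff_mul, cf_sum]
  simp only [h1]
  unfold coefZ
  by_cases hα : 0 ≤ α
  · by_cases hβ : 0 ≤ β
    · rw [if_pos hα, if_pos hβ, sum_eq_single_of_mem (α.toNat, β.toNat)]
      · rw [if_pos]; exact ⟨by simp; omega, by simp; omega⟩
      · rw [HasAntidiagonal.mem_antidiagonal]; omega
      · rintro ⟨s, t⟩ _ hne
        rw [if_neg]
        rintro ⟨h1, h2⟩
        apply hne
        simp only at h1 h2
        ext <;> simp <;> omega
    · rw [if_neg hβ, mul_zero]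
      refine sum_eq_zero fun st _ => if_neg (by omega)
  · rw [if_neg hα, zero_mul]
    refine sum_eq_zero fun st _ => if_neg (by omega)

/-- The prefactor `X / (X + a)`. -/
def preFactor (A : Type*) [Field A] (a : ℕ) : A⟦X⟧ :=
  if a = 0 then 1 else X * (X + C (a : A))⁻¹

/-- The coefficient of `z ^ i * 𝓔_{ir+a}(c z)` in the vertex operator. -/
def vertexCoeff (c : A) (r a : ℕ) (i : ℤ) : A⟦X⟧ :=
  preFactor A a * coreCoeff (c * r) r a i

/-- The coefficients of the matrix elements of
`∑ᵢ z ^ i * vertexCoeff i (z) * 𝓔_{ir+a}(c z)`, without the constant term of `𝓔_0`. -/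
def vertexEnt (c : A) (r a : ℕ) (p : ℤ) (S T : Maya0) : A :=
  ∑ᶠ i : ℤ, coefZ (vertexCoeff c r a i * regE c (i * r + a) S T) (p - i)

theorem energy_of_regE_ne_zero {c : A} {k : ℤ} {S T : Maya0} (h : regE c k S T ≠ 0) :
    S.1.energy = T.1.energy + k := energy_of_modeEnt_ne_zero h

theorem energy_of_coefZ_ne_zero {c : A} {k : ℤ} {f : A⟦X⟧} {q : ℤ} {S T : Maya0}
    (h : coefZ (f * regE c k S T) q ≠ 0) : 0 ≤ q ∧ S.1.energy = T.1.energy + k := by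
  constructor
  · by_contra h1; exact h (if_neg h1)
  · apply energy_of_regE_ne_zero (c := c)
    intro h1; rw [h1, mul_zero, coefZ_zero] at h; exact h rfl

/-- Energy conservation leaves at most one term of the sum over the modes. -/
theorem vertexEnt_eq {c : A} {r a : ℕ} (hr : r ≠ 0) {p i : ℤ} {S T : Maya0}
    (h : S.1.energy = T.1.energy + (i * r + a)) :
    vertexEnt c r a p S T = coefZ (vertexCoeff c r a i * regE c (i * r + a) S T) (p - i) := by
  apply finsum_eq_single
  intro i' hi'
  by_contra h1
  have h2 := (energy_of_coefZ_ne_zero h1).2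
  have hr' : (r : ℤ) ≠ 0 := by exact_mod_cast hr
  exact hi' (mul_right_cancel₀ hr' (by omega))

/-- The regular part of `𝓔_{ir+a}` lowers the energy by `ir + a` and carries the factor `z ^ i`,
so a large loss of energy requires a large power of `z`. -/
theorem exists_of_vertexEnt_ne_zero {c : A} {r a : ℕ} {p : ℤ} {S T : Maya0}
    (h : vertexEnt c r a p S T ≠ 0) :
    ∃ i ≤ p, S.1.energy = T.1.energy + (i * r + a) := by
  by_contra hcon
  apply h
  rw [vertexEnt]
  have : ∀ i : ℤ, coefZ (vertexCoeff c r a i * regE c (i * r + a) S T) (p - i) = 0 := by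
    intro i
    by_contra h1
    have h2 := energy_of_coefZ_ne_zero h1
    exact hcon ⟨i, by omega, h2.2⟩
  simp [this]

omit [CharZero A] [Algebra ℂ A] in
/-- A product of two sums with only one pair of matching indices `i + j = m` as a sum over `i`. -/
theorem finsum_mul_finsum_eq_sum {F G : ℤ → A} {m p q : ℤ} (hF : ∀ i, F i ≠ 0 → i ≤ p)
    (hG : ∀ j, G j ≠ 0 → j ≤ q) (hFG : ∀ i j, F i ≠ 0 → G j ≠ 0 → i + j = m) :
    (∑ᶠ i, F i) * ∑ᶠ j, G j = ∑ i ∈ Icc (m - q) p, F i * G (m - i) := by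
  by_cases h1 : ∃ i, F i ≠ 0
  · by_cases h2 : ∃ j, G j ≠ 0
    · obtain ⟨i, hi⟩ := h1
      obtain ⟨j, hj⟩ := h2
      have hij := hFG i j hi hj
      have e1 : ∀ i', i' ≠ i → F i' = 0 := fun i' hne => by
        by_contra h; have := hFG i' j h hj; omega
      have e2 : ∀ j', j' ≠ j → G j' = 0 := fun j' hne => by
        by_contra h; have := hFG i j' hi h; omega
      rw [finsum_eq_single F i e1, finsum_eq_single G j e2, sum_eq_single_of_mem i]
      · rw [show m - i = j by omega]
      · have := hF i hi
        have := hG j hj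
        rw [mem_Icc]; omega
      · intro i' _ hne
        rw [e1 i' hne, zero_mul]
    · push Not at h2
      simp [h2]
  · push Not at h1
    simp [h1]

/-- The total energy difference `m r + a + b` fixes the sum of the two mode indices. -/
theorem vertexEnt_mul_vertexEnt {c : A} {r : ℕ} (hr : r ≠ 0) (a b : ℕ) (p q m : ℤ)
    {S U S' U' : Maya0}
    (hm : S.1.energy - U.1.energy + (S'.1.energy - U'.1.energy) = m * r + a + b) :
    vertexEnt c r a p S U * vertexEnt c r b q S' U' =
      ∑ i ∈ Icc (m - q) p, coefZ (vertexCoeff c r a i * regE c (i * r + a) S U) (p - i) *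
        coefZ (vertexCoeff c r b (m - i) * regE c ((m - i) * r + b) S' U') (q - m + i) := by
  have e : ∀ i : ℤ, q - m + i = q - (m - i) := fun i => by ring
  simp only [e]
  apply finsum_mul_finsum_eq_sum
    (G := fun j => coefZ (vertexCoeff c r b j * regE c (j * r + b) S' U') (q - j))
  · intro i hi
    have := (energy_of_coefZ_ne_zero hi).1
    omega
  · intro j hj
    have := (energy_of_coefZ_ne_zero hj).1
    omega
  · intro i j hi hj
    have h1 := (energy_of_coefZ_ne_zero hi).2
    have h2 := (energy_of_coefZ_ne_zero hj).2
    have hr' : (r : ℤ) ≠ 0 := by exact_mod_cast hr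
    apply mul_right_cancel₀ hr'
    rw [add_mul]
    omega

/-- A product of two vertex operators as a bilateral sum. -/
theorem sum_vertexEnt_mul {c : A} {r : ℕ} (hr : r ≠ 0) (a b : ℕ) (p q m : ℤ) {S T : Maya0}
    (hm : S.1.energy = T.1.energy + (m * r + a + b)) (s : Finset Maya0) :
    ∑ U ∈ s, vertexEnt c r a p U T * vertexEnt c r b q S U =
      biSum m (fun i => inL z (vertexCoeff c r a i) * inL w (vertexCoeff c r b (m - i)) *
        ∑ U ∈ s, inL z (regE c (i * r + a) U T) * inL w (regE c ((m - i) * r + b) S U))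
        (p + q - m).toNat p q := by
  rw [sum_congr rfl fun U _ => vertexEnt_mul_vertexEnt hr a b p q m (by omega), sum_comm,
    biSum_eq_sum]
  refine sum_congr rfl fun i hi => ?_
  rw [mem_Icc] at hi
  rw [mul_sum, map_sum, cf_sum]
  refine sum_congr rfl fun U _ => ?_
  rw [← cf_coeff_inL_mul_inL _ _ (show (p - i) + (q - m + i) = ((p + q - m).toNat : ℤ) by omega),
    map_mul (inL z), map_mul (inL w), mul_mul_mul_comm]

/-- The reverse product of two vertex operators as a bilateral sum. -/
theorem sum_vertexEnt_mul_rev {c : A} {r : ℕ} (hr : r ≠ 0) (a b : ℕ) (p q m : ℤ) {S T : Maya0}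
    (hm : S.1.energy = T.1.energy + (m * r + a + b)) (s : Finset Maya0) :
    ∑ U ∈ s, vertexEnt c r b q U T * vertexEnt c r a p S U =
      biSum m (fun i => inL z (vertexCoeff c r a i) * inL w (vertexCoeff c r b (m - i)) *
        ∑ U ∈ s, inL w (regE c ((m - i) * r + b) U T) * inL z (regE c (i * r + a) S U))
        (p + q - m).toNat p q := by
  rw [sum_congr rfl fun U _ => (mul_comm _ _).trans
    (vertexEnt_mul_vertexEnt hr a b p q m (by omega)), sum_comm, biSum_eq_sum]
  refine sum_congr rfl fun i hi => ?_
  rw [mem_Icc] at hi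
  rw [mul_sum, map_sum, cf_sum]
  refine sum_congr rfl fun U _ => ?_
  rw [← cf_coeff_inL_mul_inL _ _ (show (p - i) + (q - m + i) = ((p + q - m).toNat : ℤ) by omega),
    map_mul (inL z), map_mul (inL w), mul_mul_mul_comm, mul_comm (inL z (regE _ _ _ _))]

/-- The coefficients of the scalar to which the commutator of two vertex operators of opposite
total energy `m r + a + b = 0` is equal. -/
def vertexBracket (c : A) (r a b : ℕ) (m p q : ℤ) : A :=
  biSum m (fun i => inL z (vertexCoeff c r a i) * inL w (vertexCoeff c r b (m - i)) *
    centralTerm c (i * r + a)) (p + q - m).toNat p q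

omit [Algebra ℂ A] in
theorem crossExp_eq_wedgeExp {c : A} {r : ℕ} (hr : r ≠ 0) (a b : ℕ) (m i : ℤ) :
    crossExp c (i * r + a) ((m - i) * r + b) = wedgeExp (c * r) r a b m i := by
  have hr' : (r : A) ≠ 0 := by exact_mod_cast hr
  rw [crossExp, wedgeExp, show c * r / (2 * r) = c / 2 by field_simp]
  congr 3 <;> congr 1 <;> ring

omit [Algebra ℂ A] in
/-- The bilateral sum multiplying the non-central part of the commutator of two vertex operators
vanishes. -/
theorem biSum_vertexCoeff_mul_sub {c : A} (hc : c ≠ 0) {r : ℕ} (hr : r ≠ 0) (a b : ℕ) (m : ℤ)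
    (d : ℕ) (p q : ℤ) :
    biSum m (fun i => inL z (vertexCoeff c r a i) * inL w (vertexCoeff c r b (m - i)) *
      (expBi (crossExp c (i * r + a) ((m - i) * r + b)) -
        expBi (-crossExp c (i * r + a) ((m - i) * r + b)))) d p q = 0 := by
  have hr' : (r : A) ≠ 0 := by exact_mod_cast hr
  have h := biSum_mul_eq_zero (biSum_coreCoeff_mul_sub (mul_ne_zero hc hr') hr a b m)
    (inL z (preFactor A a) * inL w (preFactor A b)) d p q
  rw [← h]
  refine biSum_congr (fun i => congrArg (coeff d) ?_) p q
  rw [crossExp_eq_wedgeExp hr, vertexCoeff, vertexCoeff, map_mul, map_mul]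
  ring

open Classical in
/-- The commutator of two vertex operators on one factor is a scalar. -/
theorem vertexEnt_commutator {c : A} (hc : c ≠ 0) {r : ℕ} (hr : r ≠ 0) (a b : ℕ) (p q m : ℤ)
    {S T : Maya0} (hm : S.1.energy = T.1.energy + (m * r + a + b)) {N : ℤ}
    (hp : T.1.energy + p * r + a ≤ N) (hq : T.1.energy + q * r + b ≤ N) :
    ∑ U ∈ levelSet N, vertexEnt c r a p U T * vertexEnt c r b q S U -
      ∑ U ∈ levelSet N, vertexEnt c r b q U T * vertexEnt c r a p S U =
      if m * r + a + b = 0 ∧ S = T then vertexBracket c r a b m p q else 0 := by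
  rw [sum_vertexEnt_mul hr a b p q m hm, sum_vertexEnt_mul_rev hr a b p q m hm]
  have key : ∀ i ∈ Icc (m - q) p,
      ∑ U ∈ levelSet N, inL z (regE c (i * r + a) U T) * inL w (regE c ((m - i) * r + b) S U) -
      ∑ U ∈ levelSet N, inL w (regE c ((m - i) * r + b) U T) * inL z (regE c (i * r + a) S U) =
      (expBi (crossExp c (i * r + a) ((m - i) * r + b)) -
        expBi (-crossExp c (i * r + a) ((m - i) * r + b))) *
        inL (z + w) (regE c (m * r + a + b) S T) +
        if m * r + a + b = 0 ∧ S = T then centralTerm c (i * r + a) else 0 := by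
    intro i hi
    rw [mem_Icc] at hi
    have hr0 : (0 : ℤ) ≤ r := by positivity
    have e1 : i * r ≤ p * r := mul_le_mul_of_nonneg_right hi.2 hr0
    have e2 : (m - i) * r ≤ q * r := mul_le_mul_of_nonneg_right (by omega) hr0
    have e3 : (m - i) * r = m * r - i * r := by ring
    rw [regE_commutator c _ _ S T (by omega) (by omega),
      show i * (r : ℤ) + a + ((m - i) * r + b) = m * r + a + b by ring]
  have h0 : biSum m (fun i => (inL z (vertexCoeff c r a i) * inL w (vertexCoeff c r b (m - i)) *
      (expBi (crossExp c (i * r + a) ((m - i) * r + b)) -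
        expBi (-crossExp c (i * r + a) ((m - i) * r + b)))) *
        inL (z + w) (regE c (m * r + a + b) S T)) (p + q - m).toNat p q = 0 := by
    have := biSum_mul_eq_zero (biSum_vertexCoeff_mul_sub hc hr a b m)
      (inL (z + w) (regE c (m * r + a + b) S T)) (p + q - m).toNat p q
    simpa only [mul_comm] using this
  rw [sub_eq_iff_eq_add]
  have h1 : (if m * r + a + b = 0 ∧ S = T then vertexBracket c r a b m p q else 0) =
      biSum m (fun i => inL z (vertexCoeff c r a i) * inL w (vertexCoeff c r b (m - i)) *
        if m * r + a + b = 0 ∧ S = T then centralTerm c (i * r + a) else 0)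
        (p + q - m).toNat p q := by
    split_ifs
    · rfl
    · simp only [mul_zero, biSum_zero]
  rw [h1, ← zero_add (biSum m (fun i => _ * ite _ _ _) _ _ _), ← h0, ← biSum_add, ← biSum_add,
    biSum_eq_sum, biSum_eq_sum]
  refine sum_congr rfl fun i hi => ?_
  have := key i hi
  rw [sub_eq_iff_eq_add] at this
  rw [this]
  congr 2
  ring

/-- The commutators of vertex operators are annihilated by `z + w`. -/
theorem vertexBracket_add {c : A} (hc : c ≠ 0) {r : ℕ} (hr : r ≠ 0) {a b : ℕ} {m : ℤ}
    (hm : m * r + a + b = 0) (p q : ℤ) :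
    vertexBracket c r a b m (p - 1) q + vertexBracket c r a b m p (q - 1) = 0 := by
  unfold vertexBracket
  rw [show p - 1 + q - m = p + q - 1 - m by ring, show p + (q - 1) - m = p + q - 1 - m by ring]
  apply biSum_add_eq_zero_of_mul hc
  intro d p q
  rw [← biSum_vertexCoeff_mul_sub hc hr a b m d p q]
  refine biSum_congr (fun i => congrArg (coeff d) ?_) p q
  have e : (m - i) * r + b = -(i * r + a) := by linear_combination hm
  rw [mul_assoc, centralTerm_mul, e]

end Vertex

/-! ### Matrix elements of the operators in terms of power series -/

section Series

instance : CharZero USeries := charZero_of_injective_algebraMap (algebraMap ℂ USeries).injective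

/-- Power series in `z`, seen as Laurent series. -/
def toZ : PowerSeries USeries →+* ZSeries := HahnSeries.ofPowerSeries ℤ USeries

theorem toZ_injective : Function.Injective toZ := HahnSeries.ofPowerSeries_injective

theorem coeff_toZ (f : PowerSeries USeries) (p : ℤ) : (toZ f).coeff p = coefZ f p := by
  unfold coefZ
  split_ifs with h
  · obtain ⟨n, rfl⟩ := Int.eq_ofNat_of_zero_le h
    exact HahnSeries.ofPowerSeries_apply_coeff f n
  · apply HahnSeries.embDomain_of_notMem_range
    rintro ⟨n, hn⟩
    apply h
    rw [← hn]
    exact Int.natCast_nonneg n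

theorem zVar_zpow (i : ℤ) : zVar ^ i = HahnSeries.single i 1 := by
  cases i with
  | ofNat n => simp [zVar]
  | negSucc n =>
    rw [zpow_negSucc, zVar, HahnSeries.single_pow, HahnSeries.inv_single, Int.negSucc_eq]
    simp

theorem coeff_zVar_zpow_mul (i p : ℤ) (x : ZSeries) : (zVar ^ i * x).coeff p = x.coeff (p - i) := by
  rw [zVar_zpow]
  have := HahnSeries.coeff_single_mul_add (r := (1 : USeries)) (x := x) (a := p - i) (b := i)
  rw [sub_add_cancel, one_mul] at this
  exact this

theorem zVar_ne_zero : zVar ≠ 0 := HahnSeries.single_ne_zero one_ne_zero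

theorem toZ_X : toZ PowerSeries.X = zVar := HahnSeries.ofPowerSeries_X

theorem toZ_C (c : USeries) : toZ (PowerSeries.C c) = const c := HahnSeries.ofPowerSeries_C c

theorem expZ_eq (c : USeries) :
    expZ c = toZ (PowerSeries.rescale c (PowerSeries.exp USeries)) := by
  have : (PowerSeries.mk fun k : ℕ => c ^ k / (k.factorial : USeries)) =
      PowerSeries.rescale c (PowerSeries.exp USeries) := by
    ext k
    rw [PowerSeries.coeff_mk, PowerSeries.coeff_rescale, PowerSeries.coeff_exp]
    simp [div_eq_mul_inv]
  rw [expZ, this]; rfl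

theorem sigmaZ_eq (c : USeries) : sigmaZ c = toZ (sigmaPow c) := by
  rw [sigmaZ, expZ_eq, expZ_eq, sigmaPow, map_sub]

theorem const_ne_zero {c : USeries} (hc : c ≠ 0) : const c ≠ 0 := by
  rw [const]; exact (map_ne_zero _).mpr hc

theorem calS_eq {c : USeries} (hc : c ≠ 0) : calS c = toZ (calSPow c) := by
  rw [calS, sigmaZ_eq, ← C_mul_X_mul_calSPow hc, map_mul, map_mul, toZ_C, toZ_X]
  exact mul_div_cancel_left₀ _ (mul_ne_zero (const_ne_zero hc) zVar_ne_zero)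

theorem natCast_zSeries_ne_zero {r : ℕ} (hr : r ≠ 0) : (r : ZSeries) ≠ 0 := by
  rw [← map_natCast toZ, Ne, map_eq_zero_iff toZ toZ_injective,
    ← map_natCast (PowerSeries.C (R := USeries)), map_eq_zero_iff _ PowerSeries.C_injective]
  exact_mod_cast hr

theorem binomQ_mul_factorial (x : PowerSeries USeries) (k : ℕ) :
    binomQ x k * (k.factorial : PowerSeries USeries) = ∏ j ∈ range k, (x - (j : PowerSeries USeries)) := by
  have h : ((k.factorial : ℕ) : ℚ) ≠ 0 := by exact_mod_cast k.factorial_ne_zero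
  rw [binomQ, Algebra.smul_def, mul_right_comm, ← map_natCast (algebraMap ℚ (PowerSeries USeries)),
    ← map_mul, inv_mul_cancel₀ h, map_one, one_mul]

/-- The binomial coefficients of Laurent series and of power series agree. -/
theorem binom_eq (x : PowerSeries USeries) (k : ℕ) : binom (toZ x) k = toZ (binomQ x k) := by
  rw [binom, div_eq_iff (natCast_zSeries_ne_zero k.factorial_ne_zero),
    ← map_natCast toZ k.factorial, ← map_mul, binomQ_mul_factorial, map_prod]
  simp

theorem powZ_eq (f x : PowerSeries USeries) : powZ (toZ f) (toZ x) = toZ (pw f x) := by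
  rw [powZ, pw]
  change toZ _ = _
  congr 1
  ext N
  rw [PowerSeries.coeff_mk, PowerSeries.coeff_mk]
  have : ∑ k ∈ range (N + 1), binom (toZ x) k * (toZ f - 1) ^ k =
      toZ (∑ k ∈ range (N + 1), binomQ x k * (f - 1) ^ k) := by
    simp only [map_sum, map_mul, map_pow, map_sub, map_one, binom_eq]
  rw [this, coeff_toZ, coefZ, if_pos (by positivity)]
  simp

theorem toZ_inv {f : PowerSeries USeries} (hf : PowerSeries.constantCoeff f ≠ 0) :
    toZ f⁻¹ = (toZ f)⁻¹ := by
  apply eq_inv_of_mul_eq_one_left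
  rw [← map_mul, PowerSeries.inv_mul_cancel _ hf, map_one]

theorem add_div_eq_toZ {r : ℕ} (hr : r ≠ 0) (a : ℕ) :
    (zVar + (a : ZSeries)) / (r : ZSeries) = toZ (xExp USeries r a) := by
  have h := natCast_zSeries_ne_zero hr
  have hr' : (r : USeries) ≠ 0 := by exact_mod_cast hr
  rw [div_eq_iff h, ← map_natCast toZ r, ← map_mul, xExp, mul_comm, ← mul_assoc,
    ← map_natCast (PowerSeries.C (R := USeries)) r, ← map_mul, mul_inv_cancel₀ hr']
  simp [toZ_X]

/-- Dividing by a Pochhammer symbol is multiplying by a power series, also for negative index,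
where the symbol itself is the inverse of a product that may vanish at `z = 0`. -/
theorem div_poch {x : PowerSeries USeries}
    (hx : ∀ n : ℕ, PowerSeries.constantCoeff (x + ((n + 1 : ℕ) : PowerSeries USeries)) ≠ 0)
    (y : ZSeries) (i : ℤ) : y / poch (toZ x) i = y * toZ (invPoch x i) := by
  match i with
  | Int.ofNat n =>
    simp only [poch, invPoch]
    rw [toZ_inv, div_eq_mul_inv, map_prod]
    · simp
    · rw [map_prod]
      exact prod_ne_zero_iff.mpr fun j _ => hx j
  | Int.negSucc n =>
    simp only [poch, invPoch]
    rw [div_inv_eq_mul, map_prod]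
    simp

theorem toZ_pw_intCast {f : PowerSeries USeries} (hf : PowerSeries.constantCoeff f = 1) (i : ℤ) :
    toZ (pw f (i : PowerSeries USeries)) = toZ f ^ i := by
  match i with
  | Int.ofNat n => simp [pw_natCast hf]
  | Int.negSucc n =>
    have h := pw_neg_mul hf ((n + 1 : ℕ) : PowerSeries USeries)
    rw [pw_natCast hf] at h
    rw [zpow_negSucc, Int.cast_negSucc]
    apply eq_inv_of_mul_eq_one_left
    rw [← map_pow, ← map_mul, h, map_one]

theorem div_add_eq_toZ (a : ℕ) : zVar / (zVar + (a : ZSeries)) = toZ (preFactor USeries a) := by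
  unfold preFactor
  split_ifs with h
  · subst h
    rw [Nat.cast_zero, add_zero, div_self zVar_ne_zero, map_one]
  · rw [map_mul, toZ_inv, map_add, toZ_X, toZ_C, div_eq_mul_inv]
    · simp [const]
    · simpa using h

open Classical in
theorem calE_eq (c : USeries) (k : ℤ) (S T : Maya0) :
    calE c k S T = toZ (regE c k S T) + if k = 0 ∧ S = T then (sigmaZ c)⁻¹ else 0 := by
  rw [calE, regE, modeEnt_eq_sum k _ S T subset_rfl,
    finsum_eq_sum_of_support_subset (s := modeSupp k S)]
  · congr 1
    rw [map_sum]
    refine sum_congr rfl fun j _ => ?_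
    rw [map_mul, expMode, expZ_eq, PowerSeries.algebraMap_apply, toZ_C]
    rfl
  · intro j hj
    apply mem_modeSupp (T := T)
    intro h
    apply hj
    have h2 : (elemOp (j - k) j (Finsupp.single S.1 1)) T.1 = 0 := h
    simp [h2, scalar, const]

theorem energy_of_calE_ne_zero {c : USeries} {k : ℤ} {S T : Maya0} (h : calE c k S T ≠ 0) :
    S.1.energy = T.1.energy + k := by
  rw [calE_eq] at h
  by_cases h1 : k = 0 ∧ S = T
  · rw [h1.1, h1.2, add_zero]
  · rw [if_neg h1, add_zero] at h
    apply energy_of_regE_ne_zero (c := c)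
    intro h2
    exact h (by rw [h2, map_zero])

/-- The matrix elements of the vertex operator on one factor, without the root of unity factor. -/
def factorEnt (c : USeries) (r a : ℕ) (S T : Maya0) : ZSeries :=
  zVar / (zVar + (a : ZSeries)) * powZ (calS (c * r)) ((zVar + (a : ZSeries)) / (r : ZSeries)) *
    ∑ᶠ i : ℤ, zVar ^ i * calS (c * r) ^ i / poch ((zVar + (a : ZSeries)) / (r : ZSeries)) i *
      calE c (i * r + a) S T

/-- The contribution of the constant term of `𝓔_0`. -/
def poleTerm (c : USeries) (r : ℕ) : ZSeries := toZ (vertexCoeff c r 0 0) * (sigmaZ c)⁻¹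

/-- The terms of the series defining `𝓐_{a/r}`, rewritten without divisions by series that are not
invertible as power series. -/
theorem factorEnt_summand {c : USeries} (hc : c ≠ 0) {r : ℕ} (hr : r ≠ 0) (a : ℕ) (i : ℤ)
    (y : ZSeries) :
    zVar / (zVar + (a : ZSeries)) * powZ (calS (c * r)) ((zVar + (a : ZSeries)) / (r : ZSeries)) *
      (zVar ^ i * calS (c * r) ^ i / poch ((zVar + (a : ZSeries)) / (r : ZSeries)) i * y) =
      zVar ^ i * (toZ (vertexCoeff c r a i) * y) := by
  have hr' : (r : USeries) ≠ 0 := by exact_mod_cast hr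
  have hcr := mul_ne_zero hc hr'
  rw [add_div_eq_toZ hr, div_add_eq_toZ, calS_eq hcr, powZ_eq,
    div_poch (constantCoeff_xExp_add_ne_zero r a), vertexCoeff, coreCoeff,
    pw_add (constantCoeff_calSPow hcr), map_mul, map_mul, map_mul,
    toZ_pw_intCast (constantCoeff_calSPow hcr)]
  ring

/-- Energy conservation leaves at most one term of the sum over the modes. -/
theorem factorEnt_eq {c : USeries} (hc : c ≠ 0) {r : ℕ} (hr : r ≠ 0) (a : ℕ) {S T : Maya0} {i : ℤ}
    (h : S.1.energy = T.1.energy + (i * r + a)) :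
    factorEnt c r a S T =
      zVar ^ i * (toZ (vertexCoeff c r a i) * calE c (i * r + a) S T) := by
  rw [factorEnt, finsum_eq_single _ i, factorEnt_summand hc hr]
  intro i' hi'
  have : calE c (i' * r + a) S T = 0 := by
    by_contra h1
    have h2 := energy_of_calE_ne_zero h1
    have hr' : (r : ℤ) ≠ 0 := by exact_mod_cast hr
    exact hi' (mul_right_cancel₀ hr' (by omega))
  rw [this, mul_zero]

theorem factorEnt_eq_zero {c : USeries} {r a : ℕ} {S T : Maya0}
    (h : ∀ i : ℤ, S.1.energy ≠ T.1.energy + (i * r + a)) : factorEnt c r a S T = 0 := by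
  have : ∀ i : ℤ, calE c (i * r + a) S T = 0 := by
    intro i
    by_contra h1
    exact h i (energy_of_calE_ne_zero h1)
  simp [factorEnt, this]

open Classical in
/-- As `a < r`, the constant term `1 / ς` of `𝓔_0` enters only for `a = 0` and `i = 0`. -/
theorem coeff_factorEnt {c : USeries} (hc : c ≠ 0) {r a : ℕ} (hr : r ≠ 0) (ha : a < r) (p : ℤ)
    (S T : Maya0) : (factorEnt c r a S T).coeff p =
      vertexEnt c r a p S T + if a = 0 ∧ S = T then (poleTerm c r).coeff p else 0 := by
  by_cases h : ∃ i : ℤ, S.1.energy = T.1.energy + (i * r + a)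
  · obtain ⟨i, hi⟩ := h
    rw [factorEnt_eq hc hr a hi, vertexEnt_eq hr hi, coeff_zVar_zpow_mul, calE_eq, mul_add,
      HahnSeries.coeff_add, ← map_mul, coeff_toZ]
    congr 1
    by_cases h1 : a = 0 ∧ S = T
    · obtain ⟨rfl, rfl⟩ := h1
      have hr' : (r : ℤ) ≠ 0 := by exact_mod_cast hr
      have hi0 : i = 0 := by
        have : i * (r : ℤ) = 0 := by push_cast at hi; omega
        exact (mul_eq_zero.mp this).resolve_right hr'
      subst hi0
      simp [poleTerm]
    · rw [if_neg h1, if_neg]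
      · simp
      · rintro ⟨h2, h3⟩
        apply h1 ⟨_, h3⟩
        -- `0 ≤ a < r` and `r ∣ a`
        have h4 : (r : ℤ) ∣ a := ⟨-i, by linear_combination h2⟩
        have h5 : r ∣ a := by exact_mod_cast h4
        exact Nat.eq_zero_of_dvd_of_lt h5 ha
  · push Not at h
    rw [factorEnt_eq_zero h, if_neg]
    · have : vertexEnt c r a p S T = 0 := by
        by_contra h1
        obtain ⟨i, _, hi⟩ := exists_of_vertexEnt_ne_zero h1
        exact h i hi
      rw [this]; simp
    · rintro ⟨rfl, rfl⟩
      exact h 0 (by simp)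

end Series

/-! ### Column-finite matrices and operators on one tensor factor -/

section Columns

variable {A : Type*} [Field A] {ι : Type*}

/-- The operator `v_T ↦ ∑_S B S T v_S` given by a matrix with finitely supported columns. -/
def ofColumns (B : ι → ι → A) (hB : ∀ T, (Function.support fun S => B S T).Finite) :
    Module.End A (ι →₀ A) :=
  Finsupp.linearCombination A fun T => Finsupp.ofSupportFinite (fun S => B S T) (hB T)

theorem ofColumns_single_apply (B : ι → ι → A)
    (hB : ∀ T, (Function.support fun S => B S T).Finite) (S T : ι) :
    ofColumns B hB (Finsupp.single T 1) S = B S T := by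
  rw [ofColumns, Finsupp.linearCombination_single, one_smul]; rfl

theorem ofColumns_apply (B : ι → ι → A) (hB : ∀ T, (Function.support fun S => B S T).Finite)
    (v : ι →₀ A) (S : ι) {s : Finset ι} (hs : ∀ U, v U ≠ 0 → U ∈ s) :
    ofColumns B hB v S = ∑ U ∈ s, v U * B S U := by
  rw [ofColumns, Finsupp.linearCombination_apply, Finsupp.sum_of_support_subset (s := s),
    Finsupp.finsetSum_apply]
  · rfl
  · intro U hU
    exact hs U (Finsupp.mem_support_iff.mp hU)
  · simp

theorem end_ext_single {f g : Module.End A (ι →₀ A)}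
    (h : ∀ S T, f (Finsupp.single T 1) S = g (Finsupp.single T 1) S) : f = g := by
  apply Finsupp.lhom_ext'
  intro T
  apply LinearMap.ext_ring
  ext S
  exact h S T

/-- The operator on functions on `κ → ι` that acts in the coordinate `γ`. -/
def extAt {κ : Type*} [DecidableEq κ] (γ : κ) :
    Module.End A (ι →₀ A) →ₗ[A] Module.End A ((κ → ι) →₀ A) where
  toFun f := Finsupp.linearCombination A fun Λ : κ → ι =>
    Finsupp.lmapDomain A A (Function.update Λ γ) (f (Finsupp.single (Λ γ) 1))
  map_add' f g := by
    apply Finsupp.lhom_ext'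
    intro Λ
    apply LinearMap.ext_ring
    simp [Finsupp.mapDomain_add]
  map_smul' c f := by
    apply Finsupp.lhom_ext'
    intro Λ
    apply LinearMap.ext_ring
    simp

section ExtAt

variable {κ : Type*} [DecidableEq κ]

theorem extAt_single (γ : κ) (f : Module.End A (ι →₀ A)) (Λ : κ → ι) :
    extAt γ f (Finsupp.single Λ 1) =
      Finsupp.lmapDomain A A (Function.update Λ γ) (f (Finsupp.single (Λ γ) 1)) := by
  simp [extAt]

theorem extAt_lmapDomain (γ : κ) (f : Module.End A (ι →₀ A)) (Λ : κ → ι) (v : ι →₀ A) :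
    extAt γ f (Finsupp.lmapDomain A A (Function.update Λ γ) v) =
      Finsupp.lmapDomain A A (Function.update Λ γ) (f v) := by
  suffices h : extAt γ f ∘ₗ Finsupp.lmapDomain A A (Function.update Λ γ) =
      Finsupp.lmapDomain A A (Function.update Λ γ) ∘ₗ f from LinearMap.congr_fun h v
  apply Finsupp.lhom_ext'
  intro T
  apply LinearMap.ext_ring
  have e : Function.update (Function.update Λ γ T) γ = Function.update Λ γ := by
    funext S; exact Function.update_idem T S Λ
  simp [extAt_single, e, Finsupp.mapDomain_single]

theorem extAt_mul (γ : κ) (f g : Module.End A (ι →₀ A)) :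
    extAt γ (f * g) = extAt γ f * extAt γ g := by
  apply Finsupp.lhom_ext'
  intro Λ
  apply LinearMap.ext_ring
  change extAt γ (f * g) (Finsupp.single Λ 1) = extAt γ f (extAt γ g (Finsupp.single Λ 1))
  rw [extAt_single, extAt_single, extAt_lmapDomain]
  rfl

theorem extAt_one (γ : κ) : extAt γ (1 : Module.End A (ι →₀ A)) = 1 := by
  apply Finsupp.lhom_ext'
  intro Λ
  apply LinearMap.ext_ring
  change extAt γ 1 (Finsupp.single Λ 1) = Finsupp.single Λ 1
  rw [extAt_single]
  simp [Finsupp.mapDomain_single]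

/-- Acting on two different factors yields the tensor product of the two images. -/
theorem extAt_extAt_single {γ γ' : κ} (h : γ ≠ γ') (f g : Module.End A (ι →₀ A)) (Λ : κ → ι) :
    extAt γ f (extAt γ' g (Finsupp.single Λ 1)) =
      Finsupp.linearCombination A (fun T => Finsupp.lmapDomain A A
        (Function.update (Function.update Λ γ' T) γ) (f (Finsupp.single (Λ γ) 1)))
        (g (Finsupp.single (Λ γ') 1)) := by
  rw [extAt_single]
  generalize g (Finsupp.single (Λ γ') 1) = v
  induction v using Finsupp.induction_linear with
  | zero => simp
  | add v w hv hw => simp only [map_add, hv, hw]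
  | single T c =>
    rw [← mul_one c, ← smul_eq_mul, ← Finsupp.smul_single, map_smul, map_smul, map_smul]
    congr 1
    rw [Finsupp.lmapDomain_apply, Finsupp.mapDomain_single, extAt_single,
      Finsupp.linearCombination_single, one_smul, Function.update_of_ne h]

theorem extAt_comm {γ γ' : κ} (h : γ ≠ γ') (f g : Module.End A (ι →₀ A)) :
    extAt γ f * extAt γ' g = extAt γ' g * extAt γ f := by
  apply Finsupp.lhom_ext'
  intro Λ
  apply LinearMap.ext_ring
  change extAt γ f (extAt γ' g (Finsupp.single Λ 1)) = extAt γ' g (extAt γ f (Finsupp.single Λ 1))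
  rw [extAt_extAt_single h, extAt_extAt_single h.symm]
  generalize f (Finsupp.single (Λ γ) 1) = v
  generalize g (Finsupp.single (Λ γ') 1) = w
  induction w using Finsupp.induction_linear with
  | zero => simp [Finsupp.linearCombination_apply]
  | add w w' hv hw =>
    simp only [map_add, Finsupp.linearCombination_apply, smul_add, Finsupp.sum_add] at hv hw ⊢
    rw [hv, hw]
  | single T c =>
    induction v using Finsupp.induction_linear with
    | zero => simp
    | add v v' hv hw => simp only [map_add, ← hv, ← hw]; simp
    | single S d =>
      simp [Finsupp.mapDomain_single, Finsupp.smul_single, Function.update_comm h, mul_comm]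

theorem extAt_single_apply (γ : κ) (f : Module.End A (ι →₀ A)) (Λ Λ' : κ → ι) :
    extAt γ f (Finsupp.single Λ' 1) Λ =
      open Classical in
      if ∀ γ', γ' ≠ γ → Λ γ' = Λ' γ' then f (Finsupp.single (Λ' γ) 1) (Λ γ) else 0 := by
  rw [extAt_single, Finsupp.lmapDomain_apply]
  split_ifs with h
  · have e : Λ = Function.update Λ' γ (Λ γ) := by
      rw [Function.eq_update_iff]
      exact ⟨rfl, h⟩
    conv_lhs => rw [e]
    exact Finsupp.mapDomain_apply (Function.update_injective Λ' γ) _ _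
  · apply Finsupp.mapDomain_of_notMem_range
    rintro ⟨T, rfl⟩
    exact h fun γ' hγ => Function.update_of_ne hγ _ _

end ExtAt

end Columns

/-! ### The commutators on one factor -/

section FactorOp

variable {A : Type*} [Field A] [CharZero A] [Algebra ℂ A]

theorem energy_le_of_vertexEnt_ne_zero {c : A} {r a : ℕ} {p : ℤ} {S T : Maya0}
    (h : vertexEnt c r a p S T ≠ 0) : S.1.energy ≤ T.1.energy + p * r + a := by
  obtain ⟨i, hi, e⟩ := exists_of_vertexEnt_ne_zero h
  have : i * (r : ℤ) ≤ p * r := mul_le_mul_of_nonneg_right hi (by positivity)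
  omega

theorem finite_vertexEnt_ne_zero (c : A) (r a : ℕ) (p : ℤ) (T : Maya0) :
    (Function.support fun S => vertexEnt c r a p S T).Finite :=
  (finite_maya0_energy_le (T.1.energy + p * r + a)).subset fun _ h =>
    energy_le_of_vertexEnt_ne_zero h

/-- The coefficient of `z ^ p` of the vertex operator on one factor, without the constant term
of `𝓔_0`, acting on the linear combinations of basis vectors by the transposed matrix. -/
def vertexOp (c : A) (r a : ℕ) (p : ℤ) : Module.End A (Maya0 →₀ A) :=
  ofColumns (vertexEnt c r a p) (finite_vertexEnt_ne_zero c r a p)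

/-- The scalar by which the coefficients of two vertex operators on one factor commute. -/
def factorBracket (c : A) (r a b : ℕ) (p q : ℤ) : A :=
  if r ∣ a + b then vertexBracket c r a b (-((a + b) / r : ℕ)) p q else 0

theorem vertexOp_mul_apply (c : A) (r a b : ℕ) (p q : ℤ) (S T : Maya0) {N : ℤ}
    (hN : T.1.energy + p * r + a ≤ N) :
    (vertexOp c r b q * vertexOp c r a p) (Finsupp.single T 1) S =
      ∑ U ∈ levelSet N, vertexEnt c r a p U T * vertexEnt c r b q S U := by
  change vertexOp c r b q (vertexOp c r a p (Finsupp.single T 1)) S = _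
  rw [vertexOp, ofColumns_apply (s := levelSet N)]
  · refine sum_congr rfl fun U _ => ?_
    rw [vertexOp, ofColumns_single_apply]
  · intro U hU
    rw [vertexOp, ofColumns_single_apply] at hU
    exact mem_levelSet.mpr ((energy_le_of_vertexEnt_ne_zero hU).trans hN)

/-- Expressed for operators, `vertexEnt_commutator` no longer involves the energy of the states.
-/
theorem vertexOp_commutator {c : A} (hc : c ≠ 0) {r : ℕ} (hr : r ≠ 0) (a b : ℕ) (p q : ℤ) :
    vertexOp c r b q * vertexOp c r a p =
      vertexOp c r a p * vertexOp c r b q + factorBracket c r a b p q • 1 := by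
  apply end_ext_single
  intro S T
  set N := max (T.1.energy + p * r + a) (T.1.energy + q * r + b)
  have hp : T.1.energy + p * r + a ≤ N := le_max_left _ _
  have hq : T.1.energy + q * r + b ≤ N := le_max_right _ _
  have hr' : (r : ℤ) ≠ 0 := by exact_mod_cast hr
  rw [LinearMap.add_apply, Finsupp.add_apply, vertexOp_mul_apply c r a b p q S T hp,
    vertexOp_mul_apply c r b a q p S T hq, ← sub_eq_iff_eq_add']
  simp only [LinearMap.smul_apply, Module.End.one_apply, Finsupp.smul_apply, smul_eq_mul]
  by_cases h : ∃ m : ℤ, S.1.energy = T.1.energy + (m * r + a + b)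
  · obtain ⟨m, hm⟩ := h
    rw [vertexEnt_commutator hc hr a b p q m hm hp hq]
    by_cases h1 : m * r + a + b = 0 ∧ S = T
    · obtain ⟨h1, rfl⟩ := h1
      have h2 : ((a + b : ℕ) : ℤ) = r * -m := by push_cast; linear_combination h1
      have h3 : r ∣ a + b := by
        have : (r : ℤ) ∣ ((a + b : ℕ) : ℤ) := ⟨-m, h2⟩
        exact_mod_cast this
      have h4 : -(((a + b) / r : ℕ) : ℤ) = m := by
        rw [Int.natCast_div, h2, Int.mul_ediv_cancel_left _ hr', neg_neg]
      rw [if_pos ⟨h1, rfl⟩, factorBracket, if_pos h3, h4]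
      simp
    · rw [if_neg h1]
      by_cases h2 : S = T
      · subst h2
        exact absurd ⟨by omega, rfl⟩ h1
      · rw [Finsupp.single_eq_of_ne h2, mul_zero]
  · have h0 : ∀ a' b' : ℕ, a' + b' = a + b → ∀ p q : ℤ, ∀ U,
        vertexEnt c r a' p U T * vertexEnt c r b' q S U = 0 := by
      intro a' b' hab p q U
      by_contra h1
      obtain ⟨i, _, hi⟩ := exists_of_vertexEnt_ne_zero (left_ne_zero_of_mul h1)
      obtain ⟨j, _, hj⟩ := exists_of_vertexEnt_ne_zero (right_ne_zero_of_mul h1)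
      have hab' : (a' : ℤ) + b' = a + b := by exact_mod_cast hab
      exact h ⟨i + j, by rw [hj, hi]; linear_combination hab'⟩
    rw [sum_eq_zero fun U _ => h0 a b rfl p q U, sum_eq_zero fun U _ => h0 b a (add_comm b a) q p U,
      sub_zero]
    by_cases h2 : S = T
    · subst h2
      rw [factorBracket, if_neg, zero_mul]
      rintro ⟨m, hm⟩
      apply h
      refine ⟨-m, ?_⟩
      have : (a : ℤ) + b = r * m := by exact_mod_cast hm
      linear_combination -this
    · rw [Finsupp.single_eq_of_ne h2, mul_zero]

theorem factorBracket_add {c : A} (hc : c ≠ 0) {r : ℕ} (hr : r ≠ 0) (a b : ℕ) (p q : ℤ) :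
    factorBracket c r a b (p - 1) q + factorBracket c r a b p (q - 1) = 0 := by
  unfold factorBracket
  split_ifs with h
  · apply vertexBracket_add hc hr
    have : (((a + b) / r : ℕ) : ℤ) * r = a + b := by exact_mod_cast Nat.div_mul_cancel h
    linear_combination -this
  · exact add_zero 0

end FactorOp

/-! ### The operators on the tensor product -/

section StateOp

/-- The coefficient of `z ^ p` of the vertex operator on one factor. -/
def factorOp (c : USeries) (r a : ℕ) (p : ℤ) : Module.End USeries (Maya0 →₀ USeries) :=
  vertexOp c r a p + (if a = 0 then (poleTerm c r).coeff p else 0) • 1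

theorem factorOp_single_apply {c : USeries} (hc : c ≠ 0) {r a : ℕ} (hr : r ≠ 0) (ha : a < r)
    (p : ℤ) (S T : Maya0) :
    factorOp c r a p (Finsupp.single T 1) S = (factorEnt c r a S T).coeff p := by
  rw [coeff_factorEnt hc hr ha, factorOp, LinearMap.add_apply, Finsupp.add_apply, vertexOp,
    ofColumns_single_apply]
  congr 1
  by_cases h : a = 0 <;> by_cases h' : S = T
  · simp [h, h']
  · simp [h, h', Finsupp.single_eq_of_ne h']
  · simp [h]
  · simp [h]

/-- The constant term of `𝓔_0` adds a scalar to `vertexOp` and does not affect the commutators. -/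
theorem factorOp_commutator {c : USeries} (hc : c ≠ 0) {r : ℕ} (hr : r ≠ 0) (a b : ℕ) (p q : ℤ) :
    factorOp c r b q * factorOp c r a p =
      factorOp c r a p * factorOp c r b q + factorBracket c r a b p q • 1 := by
  rw [factorOp, factorOp]
  simp only [add_mul, mul_add, smul_mul_assoc, mul_smul_comm, one_mul, mul_one, smul_add,
    vertexOp_commutator hc hr a b p q]
  rw [smul_comm]
  abel

variable {r : ℕ} {K : Type*} [AddCommGroup K] [Finite K] {κ : K}

theorem ordK_mul_uVar_ne_zero : ordK K * uVar ≠ 0 := by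
  have h : (Nat.card K : USeries) ≠ 0 := by exact_mod_cast Nat.card_pos.ne'
  exact mul_ne_zero h (HahnSeries.single_ne_zero (one_ne_zero (α := ℂ)))

/-- The coefficient of the action on the factor `γ` in `𝓐_{(a,k)}`. -/
def charWeight (ρ : AddChar K ℂ → ℂ) (x : Ext r K κ) (γ : AddChar K ℂ) : ℂ :=
  γ (-x.k) * ρ γ ^ x.a.val

open Classical in
/-- The coefficient of `z ^ p` of `𝓐_x`, acting by the transposed matrix. -/
def stateOp (ρ : AddChar K ℂ → ℂ) (x : Ext r K κ) (p : ℤ) :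
    Module.End USeries (State K →₀ USeries) :=
  ∑ γ : AddChar K ℂ, algebraMap ℂ USeries (charWeight ρ x γ) •
    extAt γ (factorOp (ordK K * uVar) r x.a.val p)

theorem scalar_mul_coeff (s : ℂ) (f : ZSeries) (p : ℤ) :
    (scalar s * f).coeff p = algebraMap ℂ USeries s * f.coeff p := by
  rw [scalar, const, HahnSeries.C_mul_eq_smul, HahnSeries.coeff_smul, smul_eq_mul]

theorem opChar_eq (ρ : AddChar K ℂ → ℂ) (γ : AddChar K ℂ) (a : ℕ) (Λ Λ' : State K) :
    opChar r K ρ γ a Λ Λ' =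
      scalar (ρ γ ^ a) * onFactor K γ (factorEnt (ordK K * uVar) r a) Λ Λ' := by
  have e : ordR r K * uVar = ordK K * uVar * r := by rw [ordR, ordK]; ring
  rw [opChar, e]
  congr 1
  unfold onFactor factorEnt
  split_ifs with h <;> simp

/-- `stateOp` is the transpose of the coefficient of `z ^ p` in `𝓐_x`: it takes the basis vector
on the left of the matrix element to the one on the right, in the order in which the path of
intermediate vectors is traversed. -/
theorem stateOp_single_apply [NeZero r] (ρ : AddChar K ℂ → ℂ) (x : Ext r K κ) (p : ℤ)
    (Λ Λ' : State K) :
    stateOp ρ x p (Finsupp.single Λ' 1) Λ = (opA r ρ x Λ Λ').coeff p := by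
  rw [stateOp, opA, LinearMap.sum_apply, Finsupp.finsetSum_apply, HahnSeries.coeff_sum]
  refine sum_congr rfl fun γ _ => ?_
  rw [opChar_eq, scalar_mul_coeff, scalar_mul_coeff, LinearMap.smul_apply, Finsupp.smul_apply,
    extAt_single_apply, smul_eq_mul, charWeight, map_mul, mul_assoc, onFactor]
  split_ifs
  · rw [factorOp_single_apply ordK_mul_uVar_ne_zero (NeZero.ne r) (ZMod.val_lt _)]
  · simp

/-- The scalar by which the coefficients of `𝓐_x` and `𝓐_y` commute. -/
def stateBracket (ρ : AddChar K ℂ → ℂ) (x y : Ext r K κ) (p q : ℤ) : USeries :=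
  algebraMap ℂ USeries (∑ γ : AddChar K ℂ, charWeight ρ x γ * charWeight ρ y γ) *
    factorBracket (ordK K * uVar) r x.a.val y.a.val p q

/-- Bilinear expansion of a commutator in which the components with different indices commute and
those with equal indices have the same scalar commutator. -/
theorem sum_smul_commutator {ι A M : Type*} [CommRing A] [AddCommGroup M] [Module A M]
    (s : Finset ι) (α β : ι → A) (f g : ι → Module.End A M) (d : A)
    (hd : ∀ i ∈ s, g i * f i = f i * g i + d • 1)
    (h0 : ∀ i ∈ s, ∀ j ∈ s, i ≠ j → g j * f i = f i * g j) :
    (∑ j ∈ s, β j • g j) * (∑ i ∈ s, α i • f i) =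
      (∑ i ∈ s, α i • f i) * (∑ j ∈ s, β j • g j) + ((∑ i ∈ s, α i * β i) * d) • 1 := by
  rw [sum_mul_sum, sum_mul_sum, sum_comm, sum_mul, sum_smul, ← sum_add_distrib]
  refine sum_congr rfl fun i hi => ?_
  rw [← sub_eq_iff_eq_add', ← sum_sub_distrib, sum_eq_single_of_mem i hi]
  · rw [smul_mul_smul_comm, smul_mul_smul_comm, mul_comm (β i), ← smul_sub, hd i hi,
      add_sub_cancel_left, smul_smul]
  · intro j hj hij
    rw [smul_mul_smul_comm, smul_mul_smul_comm, mul_comm (β j), h0 i hi j hj hij.symm, sub_self]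

/-- Only equal tensor factors contribute to the commutator, each with the same scalar times the
weights of the character. -/
theorem stateOp_commutator [NeZero r] (ρ : AddChar K ℂ → ℂ) (x y : Ext r K κ) (p q : ℤ) :
    stateOp ρ y q * stateOp ρ x p =
      stateOp ρ x p * stateOp ρ y q + stateBracket ρ x y p q • 1 := by
  classical
  rw [stateOp, stateOp, sum_smul_commutator univ _ _ _ _
    (factorBracket (ordK K * uVar) r x.a.val y.a.val p q), stateBracket]
  · simp only [map_sum, map_mul]
  · intro γ _
    rw [← extAt_mul, ← extAt_mul,
      factorOp_commutator ordK_mul_uVar_ne_zero (NeZero.ne r) x.a.val y.a.val p q,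
      (extAt γ).map_add, (extAt γ).map_smul, extAt_one]
  · intro γ _ γ' _ h
    exact extAt_comm h.symm _ _

theorem stateBracket_add [NeZero r] (ρ : AddChar K ℂ → ℂ) (x y : Ext r K κ) (p q : ℤ) :
    stateBracket ρ x y (p - 1) q + stateBracket ρ x y p (q - 1) = 0 := by
  rw [stateBracket, stateBracket, ← mul_add,
    factorBracket_add ordK_mul_uVar_ne_zero (NeZero.ne r), mul_zero]

/-- Operators whose indices are not opposite commute, by orthogonality of characters. -/
theorem stateBracket_eq_zero [NeZero r] {ρ : AddChar K ℂ → ℂ}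
    (hρ : ∀ γ, ρ γ ^ r = γ (-κ) * (r : ℂ)) {x y : Ext r K κ} (hxy : x + y ≠ 0) (p q : ℤ) :
    stateBracket ρ x y p q = 0 := by
  have hr := NeZero.ne r
  unfold stateBracket factorBracket
  split_ifs with hdvd
  swap; · exact mul_zero _
  have ha : x.a + y.a = 0 := by
    rw [← ZMod.natCast_zmod_val x.a, ← ZMod.natCast_zmod_val y.a, ← Nat.cast_add]
    exact (ZMod.natCast_eq_zero_iff _ _).mpr hdvd
  have hk : x.k + y.k + cocycle κ x.a y.a ≠ 0 := fun hk => hxy (Ext.ext ha hk)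
  -- in case of a carry, `ρ ^ r = γ(-κ) r` supplies the value of the cocycle
  have key : ∃ s : ℂ, ∀ γ : AddChar K ℂ, charWeight ρ x γ * charWeight ρ y γ =
      s * γ (-(x.k + y.k + cocycle κ x.a y.a)) := by
    by_cases h : r ≤ x.a.val + y.a.val
    · have h1 : x.a.val + y.a.val = r := by
        have hx := x.a.val_lt
        have hy := y.a.val_lt
        obtain ⟨m, hm⟩ := hdvd
        have h2 : m < 2 := by
          by_contra h3
          have : r * 2 ≤ r * m := Nat.mul_le_mul_left r (by omega)
          omega
        have h3 : m ≠ 0 := by rintro rfl; omega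
        have h4 : m = 1 := by omega
        rw [hm, h4, mul_one]
      refine ⟨r, fun γ => ?_⟩
      rw [cocycle, if_pos h, charWeight, charWeight, mul_mul_mul_comm, ← pow_add, h1, hρ, neg_add,
        neg_add, AddChar.map_add_eq_mul, AddChar.map_add_eq_mul]
      ring
    · have h1 : x.a.val + y.a.val = 0 := Nat.eq_zero_of_dvd_of_lt hdvd (not_le.mp h)
      refine ⟨1, fun γ => ?_⟩
      rw [cocycle, if_neg h, charWeight, charWeight, mul_mul_mul_comm, ← pow_add, h1, pow_zero,
        mul_one, add_zero, neg_add, AddChar.map_add_eq_mul, one_mul]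
  obtain ⟨s, hs⟩ := key
  have : ∑ γ : AddChar K ℂ, charWeight ρ x γ * charWeight ρ y γ = 0 := by
    simp_rw [hs, ← mul_sum]
    rw [AddChar.sum_apply_eq_zero_iff_ne_zero.mpr (neg_ne_zero.mpr hk), mul_zero]
  rw [this, map_zero, zero_mul]

end StateOp

/-! ### Products of operators as sums over paths -/

section Paths

variable {A : Type*} [Field A] {ι : Type*}

/-- The product `M_{n-1} ⋯ M_0`. -/
def opProd : {n : ℕ} → (Fin n → Module.End A (ι →₀ A)) → Module.End A (ι →₀ A)
  | 0, _ => 1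
  | _ + 1, M => opProd (fun j => M j.succ) * M 0

/-- The product of the matrix elements along a sequence. -/
def pathProd {n : ℕ} (M : Fin n → Module.End A (ι →₀ A)) (Λ : Fin (n + 1) → ι) : A :=
  ∏ j, M j (Finsupp.single (Λ j.castSucc) 1) (Λ j.succ)

theorem pathProd_cons {n : ℕ} (M : Fin (n + 1) → Module.End A (ι →₀ A)) (S : ι)
    (Λ : Fin (n + 1) → ι) : pathProd M (Fin.cons S Λ) =
      M 0 (Finsupp.single S 1) (Λ 0) * pathProd (fun j => M j.succ) Λ := by
  rw [pathProd, Fin.prod_univ_succ]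
  rfl

section PathSet

variable [DecidableEq ι]

/-- A finite set of sequences that start at `S` and contains all those along which the product of
the matrix elements of `M_0, …, M_{n-1}` is nonzero. -/
def pathSet : {n : ℕ} → (Fin n → Module.End A (ι →₀ A)) → ι → Finset (Fin (n + 1) → ι)
  | 0, _, S => {fun _ => S}
  | _ + 1, M, S => (M 0 (Finsupp.single S 1)).support.biUnion fun U =>
      (pathSet (fun j => M j.succ) U).image (Fin.cons S)

theorem apply_zero_of_mem_pathSet {n : ℕ} {M : Fin n → Module.End A (ι →₀ A)} {S : ι}
    {Λ : Fin (n + 1) → ι} (h : Λ ∈ pathSet M S) : Λ 0 = S := by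
  cases n with
  | zero => rw [mem_singleton.mp h]
  | succ n =>
    simp only [pathSet, mem_biUnion, mem_image] at h
    obtain ⟨U, _, Λ', _, rfl⟩ := h
    rfl

theorem mem_pathSet {n : ℕ} {M : Fin n → Module.End A (ι →₀ A)} {Λ : Fin (n + 1) → ι}
    (h : pathProd M Λ ≠ 0) : Λ ∈ pathSet M (Λ 0) := by
  induction n with
  | zero =>
    refine mem_singleton.mpr ?_
    funext i
    rw [Fin.fin_one_eq_zero i]
  | succ n ih =>
    obtain ⟨S, Λ, rfl⟩ : ∃ S Λ', Λ = Fin.cons S Λ' := ⟨Λ 0, Fin.tail Λ, (Fin.cons_self_tail Λ).symm⟩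
    rw [pathProd_cons] at h
    simp only [pathSet, mem_biUnion, mem_image]
    exact ⟨Λ 0, Finsupp.mem_support_iff.mpr (left_ne_zero_of_mul h), Λ,
      ih (right_ne_zero_of_mul h), rfl⟩

/-- Matrix multiplication, expanded over all sequences of intermediate basis vectors. -/
theorem opProd_single_apply {n : ℕ} (M : Fin n → Module.End A (ι →₀ A)) (S T : ι) :
    opProd M (Finsupp.single S 1) T =
      ∑ Λ ∈ pathSet M S, if Λ (Fin.last n) = T then pathProd M Λ else 0 := by
  induction n generalizing S with
  | zero => rw [pathSet, sum_singleton]; simp [opProd, pathProd, Finsupp.single_apply]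
  | succ n ih =>
    set v := M 0 (Finsupp.single S 1) with hv
    have e : opProd M (Finsupp.single S 1) T =
        ∑ U ∈ v.support, v U * opProd (fun j => M j.succ) (Finsupp.single U 1) T := by
      change opProd (fun j => M j.succ) v T = _
      conv_lhs => rw [← Finsupp.sum_single v, Finsupp.sum, map_sum, Finsupp.finsetSum_apply]
      refine sum_congr rfl fun U _ => ?_
      rw [← mul_one (v U), ← smul_eq_mul, ← Finsupp.smul_single, map_smul, smul_eq_mul, mul_one]
      rfl
    rw [e, pathSet, sum_biUnion]
    · refine sum_congr rfl fun U _ => ?_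
      rw [ih, mul_sum, sum_image (Fin.cons_right_injective (α := fun _ => ι) S).injOn]
      refine sum_congr rfl fun Λ hΛ => ?_
      rw [pathProd_cons, apply_zero_of_mem_pathSet hΛ, mul_ite, mul_zero, ← Fin.succ_last]
      rfl
    · intro U _ U' _ hU
      refine disjoint_left.mpr fun Λ h h' => hU ?_
      obtain ⟨Λ₁, h1, rfl⟩ := mem_image.mp h
      obtain ⟨Λ₂, h2, h3⟩ := mem_image.mp h'
      rw [← apply_zero_of_mem_pathSet h1, ← apply_zero_of_mem_pathSet h2,
        Fin.cons_right_injective (α := fun _ => ι) S h3]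

end PathSet

/-- Two adjacent factors can be isolated in a product. -/
theorem exists_opProd_eq {n : ℕ} (M : Fin (n + 1) → Module.End A (ι →₀ A)) (i : Fin n) :
    ∃ P Q : Module.End A (ι →₀ A), ∀ M' : Fin (n + 1) → Module.End A (ι →₀ A),
      (∀ j, j ≠ i.castSucc → j ≠ i.succ → M' j = M j) →
        opProd M' = P * (M' i.succ * M' i.castSucc) * Q := by
  induction n with
  | zero => exact i.elim0
  | succ n ih =>
    induction i using Fin.cases with
    | zero =>
      refine ⟨opProd fun j : Fin n => M j.succ.succ, 1, fun M' h => ?_⟩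
      have e : (fun j : Fin n => M' j.succ.succ) = fun j => M j.succ.succ := by
        funext j
        exact h _ (Fin.succ_ne_zero _) (by simp [Fin.ext_iff])
      rw [opProd, opProd, e, mul_one, mul_assoc]
      rfl
    | succ i =>
      obtain ⟨P, Q, h⟩ := ih (fun j => M j.succ) i
      refine ⟨P, Q * M 0, fun M' h' => ?_⟩
      rw [opProd, h (fun j => M' j.succ), h' 0, mul_assoc _ Q]
      · rfl
      · exact (Fin.castSucc_ne_zero_iff.mpr (Fin.succ_ne_zero i)).symm
      · exact (Fin.succ_ne_zero _).symm
      · intro j hj hj'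
        apply h'
        · rw [← Fin.succ_castSucc]
          exact fun e => hj (Fin.succ_injective _ e)
        · exact fun e => hj' (Fin.succ_injective _ e)

end Paths

/-! ### The coefficients of the vacuum expectation -/

section Correlator

variable {r : ℕ} [NeZero r] {K : Type*} [AddCommGroup K] [Finite K] {κ : K}

/-- The coefficient of `z_1^{p_1} ⋯ z_n^{p_n}` in `⟨𝓐_{x_1}(z_1,u) ⋯ 𝓐_{x_n}(z_n,u)⟩`. -/
def correl (ρ : AddChar K ℂ → ℂ) {n : ℕ} (x : Fin n → Ext r K κ) (p : Fin n → ℤ) : USeries :=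
  opProd (fun j => stateOp ρ (x j) (p j)) (Finsupp.single (vacState K) 1) (vacState K)

theorem pathTerm_eq (ρ : AddChar K ℂ → ℂ) {n : ℕ} (x : Fin n → Ext r K κ) (p : Fin n → ℤ)
    (Λ : VacuumPath K n) :
    pathTerm r ρ x p Λ = pathProd (fun j => stateOp ρ (x j) (p j)) Λ.1 := by
  simp only [pathTerm, pathProd, stateOp_single_apply]

/-- The matrices `stateOp` are column-finite, so only finitely many sequences of intermediate vectors
starting at the vacuum contribute. -/
theorem finite_support_pathTerm (ρ : AddChar K ℂ → ℂ) {n : ℕ} (x : Fin n → Ext r K κ)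
    (p : Fin n → ℤ) : (Function.support (pathTerm r ρ x p)).Finite := by
  classical
  apply Set.Finite.of_finite_image (f := Subtype.val) _ Subtype.val_injective.injOn
  apply (pathSet (fun j => stateOp ρ (x j) (p j)) (vacState K)).finite_toSet.subset
  rintro _ ⟨Λ, hΛ, rfl⟩
  have h : pathProd (fun j => stateOp ρ (x j) (p j)) Λ.1 ≠ 0 := (pathTerm_eq ρ x p Λ).symm.trans_ne hΛ
  have := mem_pathSet h
  rwa [Λ.2.1] at this

theorem correl_eq_finsum (ρ : AddChar K ℂ → ℂ) {n : ℕ} (x : Fin n → Ext r K κ) (p : Fin n → ℤ) :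
    correl ρ x p = ∑ᶠ Λ : VacuumPath K n, pathTerm r ρ x p Λ := by
  classical
  have hs := finite_support_pathTerm ρ x p
  rw [correl, opProd_single_apply, finsum_eq_sum _ hs]
  refine (sum_filter _ _).symm.trans ?_
  symm
  refine sum_bij_ne_zero (fun Λ _ _ => Λ.1) ?_ ?_ ?_ ?_
  · intro Λ _ h
    rw [pathTerm_eq] at h
    have h1 := mem_pathSet h
    rw [Λ.2.1] at h1
    exact mem_filter.mpr ⟨h1, Λ.2.2⟩
  · intro Λ _ _ Λ' _ _ h
    exact Subtype.ext h
  · intro Λ hΛ h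
    rw [mem_filter] at hΛ
    have h2 : pathTerm r ρ x p ⟨Λ, apply_zero_of_mem_pathSet hΛ.1, hΛ.2⟩ ≠ 0 := by
      exact (pathTerm_eq ρ x p _).trans_ne h
    exact ⟨_, hs.mem_toFinset.mpr h2, h2, rfl⟩
  · intro Λ _ _
    exact pathTerm_eq ρ x p Λ

theorem exists_pathTerm_ne_zero {ρ : AddChar K ℂ → ℂ} {n : ℕ} {x : Fin n → Ext r K κ}
    {p : Fin n → ℤ} (h : correl ρ x p ≠ 0) : ∃ Λ : VacuumPath K n, pathTerm r ρ x p Λ ≠ 0 := by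
  by_contra! h'
  rw [correl_eq_finsum] at h
  exact h (by simp [h'])

end Correlator

/-! ### Well-ordered supports -/

section WellOrdered

/-- A set of exponents is well-ordered if each entry is bounded below in terms of the previous
ones: subtracting the bounds gives a strictly monotone map to `Lex (Fin n → ℕ)`. -/
theorem isPWO_of_lower_bound {n : ℕ} (s : Set (Lex (Fin n → ℤ))) (b : Fin n → (Fin n → ℤ) → ℤ)
    (hb : ∀ i p q, (∀ j < i, p j = q j) → b i p = b i q)
    (hs : ∀ p ∈ s, ∀ i, b i (ofLex p) ≤ ofLex p i) : s.IsPWO := by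
  rw [Set.isPWO_iff_isWF]
  -- subtracting the bounds is strictly monotone into the well-ordered set of natural exponents
  let f : Lex (Fin n → ℤ) → Lex (Fin n → ℕ) := fun p =>
    toLex fun i => (ofLex p i - b i (ofLex p)).toNat
  have hf : ∀ p ∈ s, ∀ q ∈ s, p < q → f p < f q := by
    rintro p hp q hq ⟨i, hi, hlt⟩
    have hbi : b i (ofLex p) = b i (ofLex q) := hb i _ _ hi
    refine ⟨i, fun j hj => ?_, ?_⟩
    · have hbj : b j (ofLex p) = b j (ofLex q) := hb j _ _ fun l hl => hi l (hl.trans hj)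
      have := hi j hj
      change (ofLex p j - b j (ofLex p)).toNat = (ofLex q j - b j (ofLex q)).toNat
      rw [hbj]
      exact congrArg (fun t => (t - b j (ofLex q)).toNat) this
    · change (ofLex p i - b i (ofLex p)).toNat < (ofLex q i - b i (ofLex q)).toNat
      have h1 := hs p hp i
      have h2 : ofLex p i < ofLex q i := hlt
      omega
  exact Subrelation.wf (fun {a b} h => hf a a.2 b b.2 h)
    (InvImage.wf (fun a : s => f a) wellFounded_lt)

end WellOrdered

/-! ### Degree bounds in `z` and `u` -/

section Degrees

theorem coeffHom_mul_ne_zero {a b : USeries} {m : ℤ} (h : USeries.coeffHom m (a * b) ≠ 0) :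
    ∃ m₁ m₂, m₁ + m₂ = m ∧ USeries.coeffHom m₁ a ≠ 0 ∧ USeries.coeffHom m₂ b ≠ 0 := by
  have h1 : USeries.coeffHom m (a * b) = _ := HahnSeries.coeff_mul (Γ := ℤ) (R := ℂ)
  rw [h1] at h
  obtain ⟨⟨m₁, m₂⟩, h2, h3⟩ := exists_ne_zero_of_sum_ne_zero h
  exact ⟨m₁, m₂, (Finset.mem_antidiagonal.mp h2).2.2, left_ne_zero_of_mul h3,
    right_ne_zero_of_mul h3⟩

/-- The monomial `c * u ^ k`. -/
def uMono (k : ℤ) (c : ℂ) : USeries := (HahnSeries.single k c : LaurentSeries ℂ)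

theorem uMono_mul (k l : ℤ) (a b : ℂ) : uMono k a * uMono l b = uMono (k + l) (a * b) :=
  HahnSeries.single_mul_single

theorem algebraMap_eq_uMono (c : ℂ) : algebraMap ℂ USeries c = uMono 0 c := by
  have h : algebraMap ℂ (LaurentSeries ℂ) c = HahnSeries.single 0 c := by
    rw [HahnSeries.algebraMap_apply', PowerSeries.algebraMap_apply]
    exact HahnSeries.ofPowerSeries_C c
  exact h

theorem uVar_pow (d : ℕ) : uVar ^ d = uMono d 1 := by
  induction d with
  | zero => rw [pow_zero, ← map_one (algebraMap ℂ USeries), algebraMap_eq_uMono]; rfl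
  | succ d ih => rw [pow_succ, ih, show uVar = uMono 1 1 from rfl, uMono_mul]; simp

theorem uVar_ne_zero : uVar ≠ 0 := HahnSeries.single_ne_zero (one_ne_zero (α := ℂ))

theorem uVar_inv : uVar⁻¹ = uMono (-1) 1 := by
  symm
  apply eq_inv_of_mul_eq_one_left
  rw [show uVar = uMono 1 1 from rfl, uMono_mul, ← map_one (algebraMap ℂ USeries),
    algebraMap_eq_uMono]
  simp

theorem uMono_zero (k : ℤ) : uMono k 0 = 0 := HahnSeries.single_eq_zero

theorem coeffHom_uMono_ne_zero {k m : ℤ} {c : ℂ} (h : USeries.coeffHom m (uMono k c) ≠ 0) :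
    m = k := by
  by_contra hk
  exact h (HahnSeries.coeff_single_of_ne hk)

/-- The series in which every monomial `z ^ p * u ^ m` satisfies `α * p + β * m ≤ s`. The weights
`(0, -1)` bound the pole order in `u`, the weights `(-1, 0)` that in `z`, the weights `(-1, 1)` the
degree in `u` by that in `z`, and the weights `(1, -2)` the degree in `z` by that in `u`. -/
def slab (α β s : ℤ) : AddSubgroup ZSeries where
  carrier := {f | ∀ p m, USeries.coeffHom m (f.coeff p) ≠ 0 → α * p + β * m ≤ s}
  zero_mem' := by intro p m h; simp at h
  add_mem' := by
    intro f g hf hg p m h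
    rw [HahnSeries.coeff_add, map_add] at h
    by_cases h1 : USeries.coeffHom m (f.coeff p) = 0
    · rw [h1, zero_add] at h
      exact hg p m h
    · exact hf p m h1
  neg_mem' := by
    intro f hf p m h
    rw [HahnSeries.coeff_neg, map_neg, neg_ne_zero] at h
    exact hf p m h

theorem slab_mono {α β s t : ℤ} (h : s ≤ t) {f : ZSeries} (hf : f ∈ slab α β s) :
    f ∈ slab α β t := fun p m hp => (hf p m hp).trans h

theorem mul_mem_slab {α β s t : ℤ} {f g : ZSeries} (hf : f ∈ slab α β s) (hg : g ∈ slab α β t) :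
    f * g ∈ slab α β (s + t) := by
  intro p m h
  rw [HahnSeries.coeff_mul, map_sum] at h
  obtain ⟨⟨p₁, p₂⟩, h2, h3⟩ := exists_ne_zero_of_sum_ne_zero h
  obtain ⟨m₁, m₂, rfl, h4, h5⟩ := coeffHom_mul_ne_zero h3
  have h6 : p₁ + p₂ = p := (Finset.mem_antidiagonal.mp h2).2.2
  have := hf p₁ m₁ h4
  have := hg p₂ m₂ h5
  subst h6
  linarith

theorem single_mem_slab {α β s k : ℤ} {a : USeries}
    (h : ∀ m, USeries.coeffHom m a ≠ 0 → α * k + β * m ≤ s) :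
    HahnSeries.single k a ∈ slab α β s := by
  intro p m hp
  by_cases hpk : p = k
  · subst hpk
    rw [HahnSeries.coeff_single_same] at hp
    exact h m hp
  · rw [HahnSeries.coeff_single_of_ne hpk, map_zero] at hp
    exact absurd rfl hp

theorem scalar_mem_slab (α β : ℤ) (c : ℂ) : scalar c ∈ slab α β 0 := by
  apply single_mem_slab
  intro m hm
  rw [algebraMap_eq_uMono] at hm
  rw [coeffHom_uMono_ne_zero hm]
  simp

/-- Complex numbers, seen as constant series. -/
def scalarHom : ℂ →+* ZSeries := (HahnSeries.C (Γ := ℤ)).comp (algebraMap ℂ USeries)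

theorem natCast_mem_slab (α β : ℤ) (n : ℕ) : (n : ZSeries) ∈ slab α β 0 := by
  rw [← map_natCast scalarHom]
  exact scalar_mem_slab α β n

theorem natCast_inv_mem_slab (α β : ℤ) (n : ℕ) : (n : ZSeries)⁻¹ ∈ slab α β 0 := by
  rw [← map_natCast scalarHom, ← map_inv₀]
  exact scalar_mem_slab α β _

theorem one_mem_slab (α β : ℤ) : (1 : ZSeries) ∈ slab α β 0 := by
  have := natCast_mem_slab α β 1
  rwa [Nat.cast_one] at this

theorem zVar_zpow_mem_slab (α β i : ℤ) : zVar ^ i ∈ slab α β (α * i) := by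
  rw [zVar_zpow]
  apply single_mem_slab
  intro m hm
  rw [← map_one (algebraMap ℂ USeries), algebraMap_eq_uMono] at hm
  rw [coeffHom_uMono_ne_zero hm]
  simp

theorem zVar_mem_slab (α β : ℤ) : zVar ∈ slab α β α := by
  simpa using zVar_zpow_mem_slab α β 1

theorem prod_mem_slab {α β s : ℤ} {f : ℕ → ZSeries} (n : ℕ) (h : ∀ j < n, f j ∈ slab α β s) :
    ∏ j ∈ range n, f j ∈ slab α β (n * s) := by
  induction n with
  | zero => simpa using one_mem_slab α β
  | succ n ih =>
    rw [prod_range_succ]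
    refine slab_mono (le_of_eq ?_) (mul_mem_slab (ih fun j hj => h j (by omega)) (h n (by omega)))
    push_cast; ring

theorem toZ_mem_slab {α β s : ℤ} {f : PowerSeries USeries}
    (h : ∀ (d : ℕ) (m : ℤ), USeries.coeffHom m (PowerSeries.coeff d f) ≠ 0 → α * d + β * m ≤ s) :
    toZ f ∈ slab α β s := by
  intro p m hp
  rw [coeff_toZ, coefZ] at hp
  split_ifs at hp with h0
  · have := h _ _ hp
    rwa [Int.toNat_of_nonneg h0] at this
  · simp at hp

/-- The substitution `X ↦ u z`. -/
def homogHom : PowerSeries ℂ →+* PowerSeries USeries :=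
  (PowerSeries.rescale uVar).comp (PowerSeries.map (algebraMap ℂ USeries))

theorem coeffHom_coeff_homogHom {g : PowerSeries ℂ} {d : ℕ} {m : ℤ}
    (h : USeries.coeffHom m (PowerSeries.coeff d (homogHom g)) ≠ 0) :
    m = d ∧ PowerSeries.coeff d g ≠ 0 := by
  rw [homogHom, RingHom.comp_apply, PowerSeries.coeff_rescale, PowerSeries.coeff_map, uVar_pow,
    algebraMap_eq_uMono, uMono_mul, add_zero, one_mul] at h
  refine ⟨coeffHom_uMono_ne_zero h, fun h0 => ?_⟩
  rw [h0, uMono_zero, map_zero] at h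
  exact h rfl

theorem homogHom_mem_slab {α β : ℤ} (h : α + β ≤ 0) (g : PowerSeries ℂ) :
    toZ (homogHom g) ∈ slab α β 0 := by
  apply toZ_mem_slab
  intro d m hd
  obtain ⟨rfl, _⟩ := coeffHom_coeff_homogHom hd
  nlinarith [Int.natCast_nonneg d]

theorem homogHom_mem_slab' {α β : ℤ} (h : α + β ≤ 0) {g : PowerSeries ℂ}
    (hg : PowerSeries.constantCoeff g = 0) : toZ (homogHom g) ∈ slab α β (α + β) := by
  apply toZ_mem_slab
  intro d m hd
  obtain ⟨rfl, h1⟩ := coeffHom_coeff_homogHom hd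
  have h2 : d ≠ 0 := by
    rintro rfl
    exact h1 (by rwa [PowerSeries.coeff_zero_eq_constantCoeff_apply])
  have h3 : (1 : ℤ) ≤ d := by omega
  nlinarith

theorem map_mem_slab {α β : ℤ} (h : α ≤ 0) (g : PowerSeries ℂ) :
    toZ (PowerSeries.map (algebraMap ℂ USeries) g) ∈ slab α β 0 := by
  apply toZ_mem_slab
  intro d m hd
  rw [PowerSeries.coeff_map, algebraMap_eq_uMono] at hd
  rw [coeffHom_uMono_ne_zero hd]
  nlinarith [Int.natCast_nonneg d]

theorem homogHom_rescale_exp (x : ℂ) :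
    homogHom (PowerSeries.rescale x (PowerSeries.exp ℂ)) =
      PowerSeries.rescale (algebraMap ℂ USeries x * uVar) (PowerSeries.exp USeries) := by
  ext d
  rw [homogHom, RingHom.comp_apply, PowerSeries.coeff_rescale, PowerSeries.coeff_map,
    PowerSeries.coeff_rescale, PowerSeries.coeff_rescale, PowerSeries.coeff_exp,
    PowerSeries.coeff_exp, map_mul, map_pow, mul_pow]
  simp
  ring

theorem homogHom_C (x : ℂ) :
    homogHom (PowerSeries.C x) = PowerSeries.C (algebraMap ℂ USeries x) := by
  ext d
  rw [homogHom, RingHom.comp_apply, PowerSeries.coeff_rescale, PowerSeries.map_C,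
    PowerSeries.coeff_C]
  split_ifs with h <;> simp [h]

theorem homogHom_X : homogHom PowerSeries.X = PowerSeries.C uVar * PowerSeries.X := by
  ext d
  rw [homogHom, RingHom.comp_apply, PowerSeries.coeff_rescale, PowerSeries.map_X,
    PowerSeries.coeff_C_mul, PowerSeries.coeff_X]
  split_ifs with h <;> simp [h]

/-- The series `𝒮(x u z)` is homogeneous, i.e. a series in the product `u z`. -/
theorem homogHom_calSPow {x : ℂ} (hx : x ≠ 0) :
    homogHom (calSPow x) = calSPow (algebraMap ℂ USeries x * uVar) := by
  have hc : algebraMap ℂ USeries x * uVar ≠ 0 := mul_ne_zero (by simpa using hx) uVar_ne_zero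
  have h1 := congrArg homogHom (C_mul_X_mul_calSPow hx)
  have h2 := C_mul_X_mul_calSPow hc
  have h3 : homogHom (sigmaPow x) = sigmaPow (algebraMap ℂ USeries x * uVar) := by
    rw [sigmaPow, sigmaPow, map_sub, homogHom_rescale_exp, homogHom_rescale_exp]
    simp only [map_neg, map_div₀, map_ofNat]
    congr 3 <;> ring
  rw [map_mul, map_mul, homogHom_C, homogHom_X, h3, ← h2, ← mul_assoc, ← map_mul] at h1
  exact mul_left_cancel₀ (mul_ne_zero ((map_ne_zero_iff _ PowerSeries.C_injective).mpr hc)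
    PowerSeries.X_ne_zero) h1

/-- In the term `binom x k * (f - 1) ^ k` of `f ^ x`, the binomial coefficient raises the weighted
degree by at most `k M`, and the power of `f - 1` lowers it by `k M`. -/
theorem toZ_pw_mem_slab {α β M : ℤ} {f x : PowerSeries USeries}
    (hf : toZ (f - 1) ∈ slab α β (-M)) (hx : ∀ n : ℕ, toZ x - n ∈ slab α β M) :
    toZ (pw f x) ∈ slab α β 0 := by
  apply toZ_mem_slab
  intro d m hd
  rw [pw, PowerSeries.coeff_mk] at hd
  have h1 : toZ (∑ k ∈ range (d + 1), binomQ x k * (f - 1) ^ k) ∈ slab α β 0 := by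
    rw [map_sum]
    refine AddSubgroup.sum_mem _ fun k _ => ?_
    rw [map_mul, ← binom_eq, binom, div_eq_mul_inv, map_pow, ← card_range k, ← prod_const,
      card_range]
    refine slab_mono (le_of_eq ?_) (mul_mem_slab (mul_mem_slab (prod_mem_slab k fun j _ => hx j)
      (natCast_inv_mem_slab α β _)) (prod_mem_slab k fun _ _ => hf))
    ring
  apply h1 d m
  rw [coeff_toZ, coefZ, if_pos (by positivity)]
  simpa using hd

theorem toZ_calSPow_sub_one_mem_slab {α β : ℤ} (h : α + β ≤ 0) {x : ℂ} (hx : x ≠ 0) :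
    toZ (calSPow (algebraMap ℂ USeries x * uVar) - 1) ∈ slab α β (α + β) := by
  rw [← homogHom_calSPow hx, ← map_one homogHom, ← map_sub]
  apply homogHom_mem_slab' h
  rw [map_sub, constantCoeff_calSPow hx, map_one, sub_self]

theorem inv_sigmaZ_mem_slab {α β : ℤ} (h : α + β ≤ 0) {x : ℂ} (hx : x ≠ 0) :
    (sigmaZ (algebraMap ℂ USeries x * uVar))⁻¹ ∈ slab α β (-(α + β)) := by
  have hc : algebraMap ℂ USeries x * uVar ≠ 0 := mul_ne_zero (by simpa using hx) uVar_ne_zero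
  have h1 : PowerSeries.constantCoeff (calSPow x) ≠ 0 := by
    rw [constantCoeff_calSPow hx]; exact one_ne_zero
  have e : (toZ (calSPow (algebraMap ℂ USeries x * uVar)))⁻¹ = toZ (homogHom (calSPow x)⁻¹) := by
    symm
    apply eq_inv_of_mul_eq_one_left
    rw [← homogHom_calSPow hx, ← map_mul, ← map_mul, PowerSeries.inv_mul_cancel _ h1, map_one,
      map_one]
  have hu : const uVar⁻¹ ∈ slab α β (-β) := by
    apply single_mem_slab
    intro m hm
    rw [uVar_inv] at hm
    rw [coeffHom_uMono_ne_zero hm]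
    simp
  have hz : zVar⁻¹ ∈ slab α β (-α) := by
    have := zVar_zpow_mem_slab α β (-1)
    rwa [zpow_neg_one, mul_neg_one] at this
  rw [sigmaZ_eq, ← C_mul_X_mul_calSPow hc, map_mul, map_mul, toZ_X, toZ_C, mul_inv, mul_inv, e,
    const, ← map_inv₀, mul_inv, map_mul, ← map_inv₀]
  refine slab_mono (le_of_eq ?_) (mul_mem_slab (mul_mem_slab
    (mul_mem_slab (scalar_mem_slab α β x⁻¹) hu) hz) (homogHom_mem_slab h _))
  ring

theorem toZ_regE_mem_slab {α β : ℤ} (h : α + β ≤ 0) (x : ℂ) (k : ℤ) (S T : Maya0) :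
    toZ (regE (algebraMap ℂ USeries x * uVar) k S T) ∈ slab α β 0 := by
  rw [regE, modeEnt_eq_sum k _ S T subset_rfl, map_sum]
  refine AddSubgroup.sum_mem _ fun j _ => ?_
  rw [map_mul, PowerSeries.algebraMap_apply, toZ_C, expMode, mul_right_comm, ← map_mul,
    ← homogHom_rescale_exp, ← zero_add (0 : ℤ)]
  exact mul_mem_slab (scalar_mem_slab α β _) (homogHom_mem_slab h _)

theorem calE_mem_slab {α β : ℤ} (h : α + β ≤ 0) {x : ℂ} (hx : x ≠ 0) (k : ℤ) (S T : Maya0) :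
    calE (algebraMap ℂ USeries x * uVar) k S T ∈ slab α β (-(α + β)) := by
  rw [calE_eq]
  refine AddSubgroup.add_mem _ (slab_mono (by omega) (toZ_regE_mem_slab h x k S T)) ?_
  split_ifs
  · exact inv_sigmaZ_mem_slab h hx
  · exact AddSubgroup.zero_mem _

theorem toZ_xExp_sub_mem_slab (α β : ℤ) {r : ℕ} (hr : r ≠ 0) (a : ℕ) (n : ℤ) :
    toZ (xExp USeries r a) - n ∈ slab α β (max 0 α) := by
  rw [← add_div_eq_toZ hr, div_eq_mul_inv]
  refine AddSubgroup.sub_mem _ ?_ ?_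
  · rw [← add_zero (max 0 α)]
    refine mul_mem_slab (AddSubgroup.add_mem _ ?_ ?_) (natCast_inv_mem_slab α β r)
    · exact slab_mono (le_max_right _ _) (zVar_mem_slab α β)
    · exact slab_mono (le_max_left _ _) (natCast_mem_slab α β a)
  · refine slab_mono (le_max_left _ _) ?_
    rw [← map_intCast scalarHom]
    exact scalar_mem_slab α β n

/-- The prefactor times the inverse Pochhammer symbol. -/
def pochFactor (r a : ℕ) (i : ℤ) : ZSeries :=
  toZ (preFactor USeries a * invPoch (xExp USeries r a) i)

/-- The powers of `𝒮(|R| u z)` do not increase the weighted degree: `𝒮 - 1` is a series in `u z`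
without constant term, and the condition on `α` and `β` is that of `toZ_pw_mem_slab`. -/
theorem toZ_vertexCoeff_mem_slab {α β t : ℤ} (h : max 0 α + (α + β) ≤ 0) {x : ℂ} (hx : x ≠ 0)
    {r : ℕ} (hr : r ≠ 0) (a : ℕ) (i : ℤ) (ht : pochFactor r a i ∈ slab α β t) :
    toZ (vertexCoeff (algebraMap ℂ USeries x * uVar) r a i) ∈ slab α β t := by
  have h0 : α + β ≤ 0 := by have := le_max_left 0 α; omega
  have hr' : (r : ℂ) ≠ 0 := by exact_mod_cast hr
  rw [vertexCoeff, coreCoeff, ← mul_assoc, map_mul, ← add_zero t]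
  refine mul_mem_slab ht ?_
  have e : algebraMap ℂ USeries x * uVar * r = algebraMap ℂ USeries (x * r) * uVar := by
    rw [map_mul, map_natCast]; ring
  rw [e]
  refine toZ_pw_mem_slab (M := max 0 α)
    (slab_mono (by omega) (toZ_calSPow_sub_one_mem_slab h0 (mul_ne_zero hx hr'))) fun n => ?_
  have e2 : toZ (xExp USeries r a + (i : PowerSeries USeries)) - (n : ZSeries) =
      toZ (xExp USeries r a) - ((n - i : ℤ) : ZSeries) := by
    rw [map_add, map_intCast]; push_cast; ring
  rw [e2]
  exact toZ_xExp_sub_mem_slab α β hr a _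

/-- The weighted degree of a matrix element is determined by `z ^ i`, the Pochhammer symbol and
the pole of `𝓔_0` along `u z = 0`. -/
theorem factorEnt_mem_slab {α β s : ℤ} (h : max 0 α + (α + β) ≤ 0) {x : ℂ} (hx : x ≠ 0)
    {r : ℕ} (hr : r ≠ 0) (a : ℕ) {S T : Maya0}
    (hs : ∀ i : ℤ, S.1.energy = T.1.energy + (i * r + a) →
      ∃ t, pochFactor r a i ∈ slab α β t ∧ α * i + t - (α + β) ≤ s) :
    factorEnt (algebraMap ℂ USeries x * uVar) r a S T ∈ slab α β s := by
  have h0 : α + β ≤ 0 := by have := le_max_left 0 α; omega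
  have hc : algebraMap ℂ USeries x * uVar ≠ 0 := mul_ne_zero (by simpa using hx) uVar_ne_zero
  by_cases he : ∃ i : ℤ, S.1.energy = T.1.energy + (i * r + a)
  · obtain ⟨i, hi⟩ := he
    obtain ⟨t, ht, hle⟩ := hs i hi
    rw [factorEnt_eq hc hr a hi]
    refine slab_mono ?_ (mul_mem_slab (zVar_zpow_mem_slab α β i)
      (mul_mem_slab (toZ_vertexCoeff_mem_slab h hx hr a i ht) (calE_mem_slab h0 hx _ S T)))
    omega
  · rw [factorEnt_eq_zero fun i hi => he ⟨i, hi⟩]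
    exact AddSubgroup.zero_mem _

theorem map_powerSeries_inv {f : PowerSeries ℂ} (hf : PowerSeries.constantCoeff f ≠ 0) :
    PowerSeries.map (algebraMap ℂ USeries) f⁻¹ = (PowerSeries.map (algebraMap ℂ USeries) f)⁻¹ := by
  have hf' : PowerSeries.constantCoeff (PowerSeries.map (algebraMap ℂ USeries) f) ≠ 0 := by
    rw [← PowerSeries.coeff_zero_eq_constantCoeff_apply, PowerSeries.coeff_map]
    simpa using hf
  rw [PowerSeries.eq_inv_iff_mul_eq_one hf', ← map_mul, PowerSeries.inv_mul_cancel _ hf, map_one]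

/-- Without poles in `z`, the prefactor and the inverse Pochhammer symbol do not increase the
weighted degree if the weight of `z` is nonpositive. -/
theorem pochFactor_mem_slab {α : ℤ} (hα : α ≤ 0) (β : ℤ) (r a : ℕ) (i : ℤ) :
    pochFactor r a i ∈ slab α β 0 := by
  have hx : PowerSeries.map (algebraMap ℂ USeries) (xExp ℂ r a) = xExp USeries r a := by
    simp [xExp]
  have h1 : PowerSeries.map (algebraMap ℂ USeries) (invPoch (xExp ℂ r a) i) =
      invPoch (xExp USeries r a) i := by
    match i with
    | Int.ofNat n =>
      simp only [invPoch]
      rw [map_powerSeries_inv, map_prod]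
      · simp [hx]
      · rw [map_prod]
        exact prod_ne_zero_iff.mpr fun j _ => constantCoeff_xExp_add_ne_zero r a j
    | Int.negSucc n => simp [invPoch, hx]
  have h2 : PowerSeries.map (algebraMap ℂ USeries) (preFactor ℂ a) = preFactor USeries a := by
    unfold preFactor
    split_ifs with h
    · exact map_one _
    · rw [map_mul, map_powerSeries_inv]
      · simp
      · simpa using h
  rw [pochFactor, ← h1, ← h2, ← map_mul]
  exact map_mem_slab hα _

/-- For nonpositive modes, the Pochhammer symbol in the denominator is the inverse of a polynomial
in `z`, which cancels the pole of the prefactor. -/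
theorem pochFactor_mem_slab_of_nonpos (β : ℤ) {r a : ℕ} (hr : r ≠ 0) {i : ℤ}
    (hi : i * r + a ≤ 0) : pochFactor r a i ∈ slab 1 β (-i) := by
  have hx : ∀ n : ℤ, toZ (xExp USeries r a) - n ∈ slab 1 β 1 := fun n => by
    simpa using toZ_xExp_sub_mem_slab 1 β hr a n
  have hr' : (0 : ℤ) < r := by exact_mod_cast Nat.pos_of_ne_zero hr
  match i, hi with
  | Int.ofNat n, hi =>
    have hn : n = 0 := by
      by_contra h
      have h1 : (1 : ℤ) ≤ n := by omega
      have h2 : (n : ℤ) * r + a ≤ 0 := hi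
      nlinarith
    subst hn
    have ha : a = 0 := by
      have : ((0 : ℕ) : ℤ) * r + a ≤ 0 := hi
      push_cast at this
      omega
    subst ha
    simp only [pochFactor, preFactor, invPoch]
    simpa using one_mem_slab 1 β
  | Int.negSucc n, hi =>
    simp only [pochFactor, invPoch]
    by_cases ha : a = 0
    · subst ha
      rw [preFactor, if_pos rfl, one_mul, map_prod]
      refine slab_mono (le_of_eq ?_) (prod_mem_slab (s := 1) (n + 1) fun j _ => ?_)
      · simp [Int.negSucc_eq]
      · have := hx j
        rw [map_sub, map_natCast]
        exact_mod_cast this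
    · have e : preFactor USeries a * xExp USeries r a =
          PowerSeries.C ((r : USeries)⁻¹) * PowerSeries.X := by
        have h0 : PowerSeries.constantCoeff (PowerSeries.X + PowerSeries.C (a : USeries)) ≠ 0 := by
          simpa using ha
        rw [preFactor, if_neg ha, xExp]
        linear_combination (PowerSeries.C ((r : USeries)⁻¹) * PowerSeries.X) *
          PowerSeries.inv_mul_cancel _ h0
      rw [prod_range_succ', Nat.cast_zero, sub_zero, mul_comm _ (xExp USeries r a), ← mul_assoc, e,
        map_mul, map_prod, map_mul, toZ_X, toZ_C]
      have hc : const ((r : USeries)⁻¹) = (r : ZSeries)⁻¹ := by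
        rw [const, map_inv₀, map_natCast]
      rw [hc]
      refine slab_mono (le_of_eq ?_) (mul_mem_slab (mul_mem_slab (natCast_inv_mem_slab 1 β r)
        (zVar_mem_slab 1 β)) (prod_mem_slab (s := 1) n fun j _ => ?_))
      · simp [Int.negSucc_eq]
        ring
      · have := hx (j + 1 : ℕ)
        rw [map_sub, map_natCast]
        exact_mod_cast this

end Degrees

/-! ### Bounds on the matrix elements and the vacuum expectation as an iterated Laurent series -/

section Bounds

theorem exists_coeffHom_ne_zero {a : USeries} (h : a ≠ 0) : ∃ m, USeries.coeffHom m a ≠ 0 := by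
  by_contra! h'
  exact h (HahnSeries.ext (funext h'))

variable {r : ℕ} [NeZero r] {K : Type*} [AddCommGroup K] [Finite K] {κ : K}

omit [AddCommGroup K] [Finite K] in
theorem ordK_mul_uVar_eq : ordK K * uVar = algebraMap ℂ USeries (Nat.card K : ℂ) * uVar := by
  rw [ordK, map_natCast]

theorem natCard_ne_zero : (Nat.card K : ℂ) ≠ 0 := by exact_mod_cast Nat.card_pos.ne'

omit [NeZero r] in
theorem opA_mem_slab (ρ : AddChar K ℂ → ℂ) (x : Ext r K κ) {α β s : ℤ} {Λ Λ' : State K}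
    (h : ∀ γ, factorEnt (ordK K * uVar) r x.a.val (Λ γ) (Λ' γ) ∈ slab α β s) :
    opA r ρ x Λ Λ' ∈ slab α β s := by
  rw [opA]
  refine AddSubgroup.sum_mem _ fun γ _ => ?_
  rw [opChar_eq, onFactor, ← zero_add s, ← zero_add (0 + s)]
  refine mul_mem_slab (scalar_mem_slab α β _) (mul_mem_slab (scalar_mem_slab α β _) ?_)
  split_ifs
  · exact h γ
  · exact AddSubgroup.zero_mem _

/-- The matrix elements have at most a simple pole in `u`. -/
theorem opA_mem_slab_u (ρ : AddChar K ℂ → ℂ) (x : Ext r K κ) (Λ Λ' : State K) :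
    opA r ρ x Λ Λ' ∈ slab 0 (-1) 1 := by
  apply opA_mem_slab
  intro γ
  rw [ordK_mul_uVar_eq]
  exact factorEnt_mem_slab (by norm_num) natCard_ne_zero (NeZero.ne r) _
    fun i _ => ⟨0, pochFactor_mem_slab le_rfl _ _ _ _, by omega⟩

/-- The degree in `u` of a matrix element is bounded above by the degree in `z`. -/
theorem exists_opA_mem_slab (ρ : AddChar K ℂ → ℂ) (x : Ext r K κ) (Λ Λ' : State K) :
    ∃ s, opA r ρ x Λ Λ' ∈ slab (-1) 1 s := by
  have hr : (r : ℤ) ≠ 0 := by exact_mod_cast NeZero.ne r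
  have h : ∀ γ, ∃ s, factorEnt (ordK K * uVar) r x.a.val (Λ γ) (Λ' γ) ∈ slab (-1) 1 s := by
    intro γ
    by_cases he : ∃ i : ℤ, (Λ γ).1.energy = (Λ' γ).1.energy + (i * r + x.a.val)
    · obtain ⟨i, hi⟩ := he
      refine ⟨-i, ?_⟩
      rw [ordK_mul_uVar_eq]
      refine factorEnt_mem_slab (by norm_num) natCard_ne_zero (NeZero.ne r) _
        fun j hj => ⟨0, pochFactor_mem_slab (by norm_num) _ _ _ _, ?_⟩
      have : j = i := mul_right_cancel₀ hr (by omega)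
      omega
    · exact ⟨0, by
        rw [factorEnt_eq_zero fun i hi => he ⟨i, hi⟩]
        exact AddSubgroup.zero_mem _⟩
  choose s hs using h
  refine ⟨∑ γ, |s γ|, opA_mem_slab ρ x fun γ => slab_mono ?_ (hs γ)⟩
  exact (le_abs_self _).trans (single_le_sum (f := fun γ => |s γ|) (fun _ _ => abs_nonneg _)
    (mem_univ γ))

/-- In the matrix elements of `𝓐_x v_∅`, the degree in `z` is at most twice the degree in `u`,
plus `1`: out of the vacuum only modes with `i r + a ≤ 0` contribute, for which `z ^ i` compensates
the Pochhammer polynomial. The factor `2` accounts for the exponent of `𝒮(|R| u z)`, which is itself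
of degree one in `z`. -/
theorem opA_vac_mem_slab (ρ : AddChar K ℂ → ℂ) (x : Ext r K κ) (Λ : State K) :
    opA r ρ x (vacState K) Λ ∈ slab 1 (-2) 1 := by
  apply opA_mem_slab
  intro γ
  rw [ordK_mul_uVar_eq]
  refine factorEnt_mem_slab (by norm_num) natCard_ne_zero (NeZero.ne r) _
    fun i hi => ⟨-i, pochFactor_mem_slab_of_nonpos _ (NeZero.ne r) ?_, by omega⟩
  have h1 := (Λ γ).1.energy_nonneg
  have h2 : ((vacState K) γ).1.energy = 0 := Maya.energy_vacuum
  omega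

theorem neg_one_le_of_coeff_poleTerm_ne_zero {p : ℤ}
    (h : (poleTerm (ordK K * uVar) r).coeff p ≠ 0) : -1 ≤ p := by
  obtain ⟨m, hm⟩ := exists_coeffHom_ne_zero h
  have hr := NeZero.ne r
  have : poleTerm (ordK K * uVar) r ∈ slab (-1) 0 1 := by
    rw [ordK_mul_uVar_eq, poleTerm, ← zero_add (1 : ℤ)]
    exact mul_mem_slab (toZ_vertexCoeff_mem_slab (by norm_num) natCard_ne_zero hr 0 0
      (pochFactor_mem_slab (by norm_num) _ _ _ _))
      (inv_sigmaZ_mem_slab (by norm_num) natCard_ne_zero)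
  have := this p m hm
  omega

/-- A nonzero coefficient comes either from a mode that lowers the energy accordingly, or from the
constant term of `𝓔_0`. -/
theorem of_coeff_factorEnt_ne_zero {a : ℕ} (ha : a < r) {p : ℤ} {S T : Maya0}
    (h : (factorEnt (ordK K * uVar) r a S T).coeff p ≠ 0) :
    (∃ i ≤ p, S.1.energy = T.1.energy + (i * r + a)) ∨ (a = 0 ∧ S = T ∧ -1 ≤ p) := by
  rw [coeff_factorEnt ordK_mul_uVar_ne_zero (NeZero.ne r) ha] at h
  by_cases h1 : vertexEnt (ordK K * uVar) r a p S T = 0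
  · right
    rw [h1, zero_add] at h
    split_ifs at h with h2
    · exact ⟨h2.1, h2.2, neg_one_le_of_coeff_poleTerm_ne_zero h⟩
    · exact absurd rfl h
  · exact Or.inl (exists_of_vertexEnt_ne_zero h1)

omit [NeZero r] in
theorem exists_of_coeff_opA_ne_zero {ρ : AddChar K ℂ → ℂ} {x : Ext r K κ} {Λ Λ' : State K} {p : ℤ}
    (h : (opA r ρ x Λ Λ').coeff p ≠ 0) : ∃ γ, (∀ γ', γ' ≠ γ → Λ γ' = Λ' γ') ∧
      (factorEnt (ordK K * uVar) r x.a.val (Λ γ) (Λ' γ)).coeff p ≠ 0 := by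
  rw [opA, HahnSeries.coeff_sum] at h
  obtain ⟨γ, _, hγ⟩ := exists_ne_zero_of_sum_ne_zero h
  rw [opChar_eq, scalar_mul_coeff, scalar_mul_coeff, onFactor] at hγ
  split_ifs at hγ with h1
  · exact ⟨γ, h1, right_ne_zero_of_mul (right_ne_zero_of_mul hγ)⟩
  · simp at hγ

/-- The energy of a basis vector of the tensor product. -/
def stateEnergy (Λ : State K) : ℤ := ∑ γ : AddChar K ℂ, (Λ γ).1.energy

theorem energy_le_stateEnergy (Λ : State K) (γ : AddChar K ℂ) :
    (Λ γ).1.energy ≤ stateEnergy Λ :=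
  single_le_sum (f := fun γ => (Λ γ).1.energy) (fun γ _ => (Λ γ).1.energy_nonneg) (mem_univ γ)

theorem stateEnergy_vacState : stateEnergy (vacState K) = 0 :=
  sum_eq_zero fun _ _ => Maya.energy_vacuum

/-- The power of `z` bounds the gain of energy when passing from the left to the right of an
operator, and the energy on the left bounds the power of `z` below. -/
theorem stateEnergy_bounds {ρ : AddChar K ℂ → ℂ} {x : Ext r K κ} {Λ Λ' : State K} {p : ℤ}
    (h : (opA r ρ x Λ Λ').coeff p ≠ 0) :
    stateEnergy Λ ≤ stateEnergy Λ' + (r * |p| + r) ∧ -(stateEnergy Λ' + r) ≤ p := by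
  obtain ⟨γ, h1, h2⟩ := exists_of_coeff_opA_ne_zero h
  have ha : (x.a.val : ℤ) < r := by exact_mod_cast ZMod.val_lt x.a
  have hr : (1 : ℤ) ≤ r := by exact_mod_cast NeZero.one_le
  have hp := le_abs_self p
  have hrp : 0 ≤ r * |p| := by positivity
  have hE := energy_le_stateEnergy Λ' γ
  have h0 := (Λ γ).1.energy_nonneg
  have h0' := (Λ' γ).1.energy_nonneg
  have e : stateEnergy Λ - stateEnergy Λ' = (Λ γ).1.energy - (Λ' γ).1.energy := by
    rw [stateEnergy, stateEnergy, ← sum_sub_distrib, sum_eq_single_of_mem γ (mem_univ γ)]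
    intro γ' _ hγ
    rw [h1 γ' hγ, sub_self]
  rcases of_coeff_factorEnt_ne_zero (ZMod.val_lt _) h2 with ⟨i, hi, hS⟩ | ⟨_, hS, hp1⟩
  · have h3 : i * r ≤ r * |p| := by nlinarith
    have h4 : i * r ≤ r * p := by nlinarith
    refine ⟨by omega, ?_⟩
    by_cases hp0 : 0 ≤ p
    · omega
    · have : (r : ℤ) * p ≤ p := by nlinarith
      omega
  · rw [hS, sub_self] at e
    exact ⟨by omega, by omega⟩

/-- Starting from the left vacuum, the energy of an intermediate vector is bounded by the
exponents of the variables to its left. -/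
theorem stateEnergy_path_le {ρ : AddChar K ℂ → ℂ} {n : ℕ} {x : Fin n → Ext r K κ} {p : Fin n → ℤ}
    {Λ : VacuumPath K n} (h : pathTerm r ρ x p Λ ≠ 0) (i : Fin (n + 1)) :
    stateEnergy (Λ.1 i) ≤ ∑ j with Fin.castSucc j < i, ((r : ℤ) * |p j| + r) := by
  rw [pathTerm, prod_ne_zero_iff] at h
  induction i using Fin.induction with
  | zero =>
    rw [Λ.2.1, stateEnergy_vacState]
    simp
  | succ i ih =>
    have e : univ.filter (fun j : Fin n => Fin.castSucc j < i.succ) =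
        insert i (univ.filter fun j : Fin n => Fin.castSucc j < i.castSucc) := by
      ext j
      simp [le_iff_eq_or_lt]
    rw [e, sum_insert (by simp)]
    have := (stateEnergy_bounds (h i (mem_univ i))).1
    omega

/-- The exponent of each variable is bounded below in terms of the preceding exponents. -/
theorem isPWO_support_correl (ρ : AddChar K ℂ → ℂ) {n : ℕ} (x : Fin n → Ext r K κ) :
    (Function.support fun p : Lex (Fin n → ℤ) => correl ρ x (ofLex p)).IsPWO := by
  apply isPWO_of_lower_bound _
    fun i p => -((∑ j with Fin.castSucc j < i.castSucc, ((r : ℤ) * |p j| + r)) + r)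
  · intro i p q h
    have : ∀ j ∈ univ.filter fun j : Fin n => Fin.castSucc j < i.castSucc, p j = q j :=
      fun j hj => h j (Fin.castSucc_lt_castSucc_iff.mp (mem_filter.mp hj).2)
    exact congrArg (fun t => -(t + (r : ℤ))) (sum_congr rfl fun j hj => by rw [this j hj])
  · intro p hp i
    obtain ⟨Λ, hΛ⟩ := exists_pathTerm_ne_zero hp
    have h1 := stateEnergy_path_le hΛ i.castSucc
    rw [pathTerm, prod_ne_zero_iff] at hΛ
    have h2 := (stateEnergy_bounds (hΛ i (mem_univ i))).2
    omega

/-- The vacuum expectation as an iterated Laurent series. -/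
def correlSeries (ρ : AddChar K ℂ → ℂ) {n : ℕ} (x : Fin n → Ext r K κ) :
    IterLaurent n USeries where
  coeff p := correl ρ x (ofLex p)
  isPWO_support' := isPWO_support_correl ρ x

theorem isVacuumExpectation_correlSeries (ρ : AddChar K ℂ → ℂ) {n : ℕ} (x : Fin n → Ext r K κ) :
    IsVacuumExpectation ρ x (correlSeries ρ x) :=
  fun p => ⟨finite_support_pathTerm ρ x p, correl_eq_finsum ρ x p⟩

/-- The Laurent polynomials in `u`. -/
def laurentPoly : Subring USeries where
  carrier := {a | {m : ℤ | USeries.coeffHom m a ≠ 0}.Finite}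
  mul_mem' := by
    intro a b ha hb
    refine (Set.Finite.image2 (· + ·) ha hb).subset ?_
    intro m hm
    obtain ⟨m₁, m₂, h, h1, h2⟩ := coeffHom_mul_ne_zero hm
    exact ⟨m₁, h1, m₂, h2, h⟩
  one_mem' := by
    refine (Set.finite_singleton 0).subset ?_
    intro m hm
    rw [← map_one (algebraMap ℂ USeries), algebraMap_eq_uMono] at hm
    exact coeffHom_uMono_ne_zero hm
  add_mem' := by
    intro a b ha hb
    refine (ha.union hb).subset ?_
    intro m hm
    by_contra h
    have h' : ¬ (USeries.coeffHom m a ≠ 0 ∨ USeries.coeffHom m b ≠ 0) := h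
    push Not at h'
    apply hm
    rw [map_add, h'.1, h'.2, add_zero]
  zero_mem' := by
    refine Set.finite_empty.subset ?_
    intro m hm
    exact hm (map_zero _)
  neg_mem' := by
    intro a ha
    refine ha.subset ?_
    intro m hm h
    apply hm
    rw [map_neg, h, neg_zero]

theorem coeff_opA_mem_laurentPoly (ρ : AddChar K ℂ → ℂ) (x : Ext r K κ) (Λ Λ' : State K) (p : ℤ) :
    (opA r ρ x Λ Λ').coeff p ∈ laurentPoly := by
  obtain ⟨s, hs⟩ := exists_opA_mem_slab ρ x Λ Λ'
  refine (Set.finite_Icc (-1) (p + s)).subset ?_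
  intro m hm
  have h1 := opA_mem_slab_u ρ x Λ Λ' p m hm
  have h2 := hs p m hm
  exact ⟨by omega, by omega⟩

theorem correl_mem_laurentPoly (ρ : AddChar K ℂ → ℂ) {n : ℕ} (x : Fin n → Ext r K κ)
    (p : Fin n → ℤ) : correl ρ x p ∈ laurentPoly := by
  rw [correl_eq_finsum, finsum_eq_sum _ (finite_support_pathTerm ρ x p)]
  exact Subring.sum_mem _ fun Λ _ => Subring.prod_mem _ fun j _ =>
    coeff_opA_mem_laurentPoly ρ _ _ _ _

/-- The leftmost operator produces no negative powers of its variable, except for the simple pole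
of `𝓐_0`: for `x = (0, k)`, the contributions of the constant terms of `𝓔_0` add up to a multiple
of `∑_γ γ(-k)`. -/
theorem exponent_bound_of_coeff_opA_vac_ne_zero {ρ : AddChar K ℂ → ℂ} {x : Ext r K κ}
    {Λ : State K} {p : ℤ} (h : (opA r ρ x Λ (vacState K)).coeff p ≠ 0) :
    0 ≤ p ∨ (x = 0 ∧ p = -1) := by
  classical
  by_contra hp
  push Not at hp
  obtain ⟨hp0, hp1⟩ := hp
  have ha := ZMod.val_lt x.a
  have hr : (1 : ℤ) ≤ r := by exact_mod_cast NeZero.one_le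
  -- a negative power of `z` requires a gain of energy, which the left vacuum does not allow
  have hreg : ∀ S : Maya0, vertexEnt (ordK K * uVar) r x.a.val p S vac0 = 0 := by
    intro S
    by_contra h1
    obtain ⟨i, hi, e⟩ := exists_of_vertexEnt_ne_zero h1
    have h2 := S.1.energy_nonneg
    have h3 : vac0.1.energy = 0 := Maya.energy_vacuum
    have h4 : i ≤ -1 := by omega
    have h5 : i * (r : ℤ) ≤ -r := by nlinarith
    omega
  -- what remains is the constant term of `𝓔_0`, which is the same for all characters
  have key : (opA r ρ x Λ (vacState K)).coeff p = ∑ γ : AddChar K ℂ,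
      algebraMap ℂ USeries (γ (-x.k)) * if x.a.val = 0 ∧ Λ = vacState K then
        (poleTerm (ordK K * uVar) r).coeff p else 0 := by
    rw [opA, HahnSeries.coeff_sum]
    refine sum_congr rfl fun γ _ => ?_
    rw [opChar_eq, scalar_mul_coeff, scalar_mul_coeff, onFactor]
    congr 1
    by_cases h1 : ∀ γ', γ' ≠ γ → Λ γ' = vacState K γ'
    · have h2 : Λ γ = vac0 ↔ Λ = vacState K := by
        refine ⟨fun h2 => funext fun γ' => ?_, fun h2 => by rw [h2]; rfl⟩
        by_cases h3 : γ' = γ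
        · rw [h3, h2]; rfl
        · exact h1 γ' h3
      rw [if_pos h1, coeff_factorEnt ordK_mul_uVar_ne_zero (NeZero.ne r) ha]
      have h4 : vacState K γ = vac0 := rfl
      rw [h4, hreg, zero_add]
      by_cases h5 : x.a.val = 0 ∧ Λ = vacState K
      · rw [if_pos h5, if_pos ⟨h5.1, h2.mpr h5.2⟩, h5.1, pow_zero, map_one, one_mul]
      · rw [if_neg h5, if_neg fun h6 => h5 ⟨h6.1, h2.mp h6.2⟩, mul_zero]
    · rw [if_neg h1, if_neg]
      · simp
      · rintro ⟨_, h2⟩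
        exact h1 fun γ' _ => by rw [h2]
  rw [key, ← sum_mul, ← map_sum] at h
  have h1 := right_ne_zero_of_mul h
  have h2 := left_ne_zero_of_mul h
  split_ifs at h1 with h3
  · have h4 := neg_one_le_of_coeff_poleTerm_ne_zero h1
    rw [map_ne_zero, Ne, AddChar.sum_apply_eq_zero_iff_ne_zero, not_not, neg_eq_zero] at h2
    refine hp1 (Ext.ext ?_ h2) (by omega)
    exact (ZMod.val_eq_zero _).mp h3.1
  · exact h1 rfl

/-- The bound for the leftmost operator, which is applied to the left vacuum. -/
theorem first_exponent_bound {ρ : AddChar K ℂ → ℂ} {n : ℕ} {x : Fin (n + 1) → Ext r K κ}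
    {p : Fin (n + 1) → ℤ} (h : correl ρ x p ≠ 0) : 0 ≤ p 0 ∨ (x 0 = 0 ∧ p 0 = -1) := by
  obtain ⟨Λ, hΛ⟩ := exists_pathTerm_ne_zero h
  rw [pathTerm, prod_ne_zero_iff] at hΛ
  have h1 := hΛ 0 (mem_univ 0)
  rw [Fin.castSucc_zero, Λ.2.1] at h1
  exact exponent_bound_of_coeff_opA_vac_ne_zero h1

/-- Pole orders in `u` add up. -/
theorem neg_card_le_of_coeffHom_prod_ne_zero {ι : Type*} (s : Finset ι) {f : ι → USeries}
    (hf : ∀ i m, USeries.coeffHom m (f i) ≠ 0 → -1 ≤ m) {m : ℤ}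
    (h : USeries.coeffHom m (∏ i ∈ s, f i) ≠ 0) : -(s.card : ℤ) ≤ m := by
  classical
  induction s using Finset.induction_on generalizing m with
  | empty =>
    rw [prod_empty, ← map_one (algebraMap ℂ USeries), algebraMap_eq_uMono] at h
    rw [coeffHom_uMono_ne_zero h]
    simp
  | insert i s hi ih =>
    rw [prod_insert hi] at h
    obtain ⟨m₁, m₂, rfl, h1, h2⟩ := coeffHom_mul_ne_zero h
    have := hf i m₁ h1
    have := ih h2
    rw [card_insert_of_notMem hi]
    push_cast
    omega

/-- The degree in the variable of the rightmost operator is bounded in terms of that in `u`. -/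
theorem last_exponent_bound {ρ : AddChar K ℂ → ℂ} {n : ℕ} {x : Fin (n + 1) → Ext r K κ}
    {p : Fin (n + 1) → ℤ} {m : ℤ} (h : USeries.coeffHom m (correl ρ x p) ≠ 0) :
    p (Fin.last n) ≤ 2 * (m + n) + 1 := by
  rw [correl_eq_finsum, finsum_eq_sum _ (finite_support_pathTerm ρ x p), map_sum] at h
  obtain ⟨Λ, _, hΛ⟩ := exists_ne_zero_of_sum_ne_zero h
  rw [pathTerm, Fin.prod_univ_castSucc] at hΛ
  obtain ⟨m₁, m₂, rfl, h1, h2⟩ := coeffHom_mul_ne_zero hΛ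
  have h3 := neg_card_le_of_coeffHom_prod_ne_zero univ (fun j m hm => by
    have := opA_mem_slab_u ρ _ _ _ _ m hm
    omega) h1
  rw [card_univ, Fintype.card_fin] at h3
  rw [Fin.succ_last, Λ.2.2] at h2
  have := opA_vac_mem_slab ρ _ _ _ m₂ h2
  omega

end Bounds

/-! ### Polynomials acting on families of coefficients -/

section Action

variable {n : ℕ} {A : Type*} [CommRing A] [Algebra ℂ A]

/-- The exponent vector of a monomial, with integer entries. -/
def expVec (d : Fin n →₀ ℕ) : Fin n → ℤ := fun i => d i

/-- The action of polynomials on families of coefficients `(Fin n → ℤ) → A`, in which the variable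
`X i` shifts the `i`-th exponent. -/
def act : MvPolynomial (Fin n) ℂ →ₐ[ℂ] Module.End ℂ ((Fin n → ℤ) → A) :=
  AddMonoidAlgebra.lift ℂ _ _
    { toFun := fun d => LinearMap.funLeft ℂ A fun p => p - expVec d.toAdd
      map_one' := by
        ext G p
        rw [LinearMap.funLeft_apply, Module.End.one_apply]
        congr 1
        funext i
        simp [expVec]
      map_mul' := by
        intro d d'
        apply LinearMap.ext
        intro G
        funext p
        simp only [Module.End.mul_apply, LinearMap.funLeft_apply, toAdd_mul]
        congr 1
        funext i
        simp only [expVec, Finsupp.add_apply, Pi.sub_apply]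
        push_cast
        ring }

theorem act_monomial (d : Fin n →₀ ℕ) (c : ℂ) (G : (Fin n → ℤ) → A) (p : Fin n → ℤ) :
    act (MvPolynomial.monomial d c) G p = c • G (p - expVec d) := by
  have : (act (MvPolynomial.monomial d c) : Module.End ℂ ((Fin n → ℤ) → A)) = _ :=
    AddMonoidAlgebra.lift_single _ d c
  rw [this]
  rfl

theorem expVec_single (i : Fin n) : expVec (Finsupp.single i 1) = Pi.single i 1 := by
  classical
  funext j
  simp only [expVec, Finsupp.single_apply, Pi.single_apply, eq_comm]
  split_ifs <;> rfl

theorem act_X (i : Fin n) (G : (Fin n → ℤ) → A) (p : Fin n → ℤ) :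
    act (MvPolynomial.X i) G p = G (p - Pi.single i 1) := by
  rw [MvPolynomial.X, act_monomial, one_smul, expVec_single]

theorem act_C (c : ℂ) (G : (Fin n → ℤ) → A) : act (MvPolynomial.C c) G = c • G := by
  funext p
  rw [MvPolynomial.C_apply, act_monomial]
  have : p - expVec 0 = p := by
    funext i; simp [expVec]
  rw [this]; rfl

theorem act_mul (P Q : MvPolynomial (Fin n) ℂ) (G : (Fin n → ℤ) → A) :
    act (P * Q) G = act P (act Q G) := by
  rw [map_mul]; rfl

theorem act_add (P Q : MvPolynomial (Fin n) ℂ) (G : (Fin n → ℤ) → A) :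
    act (P + Q) G = act P G + act Q G := by
  rw [map_add]; rfl

theorem act_apply_eq_sum (P : MvPolynomial (Fin n) ℂ) (G : (Fin n → ℤ) → A) (p : Fin n → ℤ) :
    act P G p = ∑ d ∈ P.support, P.coeff d • G (p - expVec d) := by
  conv_lhs => rw [P.as_sum]
  rw [map_sum, LinearMap.sum_apply, Finset.sum_apply]
  simp only [act_monomial]

/-- The action describes the multiplication of iterated Laurent series by polynomials. -/
theorem coeff_ofPoly_mul (P : MvPolynomial (Fin n) ℂ) (F : IterLaurent n A) (p : Fin n → ℤ) :
    (ofPoly A P * F).coeff (toLex p) = act P (fun q => F.coeff (toLex q)) p := by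
  induction P using MvPolynomial.induction_on generalizing F p with
  | C c =>
    rw [act_C, ← MvPolynomial.algebraMap_eq, AlgHom.commutes, ← Algebra.smul_def,
      HahnSeries.coeff_smul]
    rfl
  | add P Q hP hQ =>
    rw [map_add, add_mul, HahnSeries.coeff_add, hP, hQ, act_add]
    rfl
  | mul_X P i hP =>
    rw [map_mul, mul_assoc, hP, act_mul]
    refine congrFun (congrArg (act P) (funext fun q => ?_)) p
    rw [act_X, ofPoly, MvPolynomial.aeval_X]
    have := HahnSeries.coeff_single_mul_add (r := (1 : A)) (x := F)
      (a := toLex (q - Pi.single i 1)) (b := toLex (Pi.single i (1 : ℤ)))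
    rw [one_mul, ← toLex_add, sub_add_cancel] at this
    exact this

theorem act_comp {B : Type*} [CommRing B] [Algebra ℂ B] (f : A →ₗ[ℂ] B)
    (P : MvPolynomial (Fin n) ℂ) (G : (Fin n → ℤ) → A) (p : Fin n → ℤ) :
    act P (fun q => f (G q)) p = f (act P G p) := by
  simp only [act_apply_eq_sum, map_sum, map_smul]

/-- Renaming the variables of a polynomial and permuting the exponents of the family it acts on.
-/
theorem act_rename (σ : Equiv.Perm (Fin n)) (P : MvPolynomial (Fin n) ℂ) (G : (Fin n → ℤ) → A)
    (p : Fin n → ℤ) :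
    act (MvPolynomial.rename σ P) (fun q => G (q ∘ σ)) p = act P G (p ∘ σ) := by
  induction P using MvPolynomial.induction_on generalizing G p with
  | C c => rw [MvPolynomial.rename_C, act_C, act_C]; rfl
  | add P Q hP hQ =>
    rw [map_add, act_add, act_add, Pi.add_apply, Pi.add_apply, hP, hQ]
  | mul_X P i hP =>
    rw [map_mul, MvPolynomial.rename_X, act_mul, act_mul, ← hP]
    refine congrFun (congrArg (act _) (funext fun q => ?_)) p
    rw [act_X, act_X]
    congr 1
    funext j
    by_cases h : j = i
    · subst h; simp
    · simp [h]

theorem exists_of_act_ne_zero {P : MvPolynomial (Fin n) ℂ} {G : (Fin n → ℤ) → A} {p : Fin n → ℤ}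
    (h : act P G p ≠ 0) : ∃ d ∈ P.support, G (p - expVec d) ≠ 0 := by
  rw [act_apply_eq_sum] at h
  obtain ⟨d, hd, h1⟩ := exists_ne_zero_of_sum_ne_zero h
  exact ⟨d, hd, fun h2 => h1 (by rw [h2, smul_zero])⟩

theorem coeff_ofPoly_monomial (d : Fin n →₀ ℕ) (c : ℂ) (p : Fin n → ℤ) :
    (ofPoly ℂ (MvPolynomial.monomial d c)).coeff (toLex p) = if p = expVec d then c else 0 := by
  rw [← mul_one (ofPoly ℂ _), coeff_ofPoly_mul, act_monomial, HahnSeries.coeff_one]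
  by_cases h : p = expVec d
  · rw [if_pos h, h, sub_self, toLex_zero, if_pos rfl, smul_eq_mul, mul_one]
  · rw [if_neg h, if_neg, smul_zero]
    intro h1
    apply h
    rw [← toLex_zero, toLex_inj, sub_eq_zero] at h1
    exact h1

theorem expVec_injective : Function.Injective (expVec : (Fin n →₀ ℕ) → Fin n → ℤ) := by
  intro d d' h
  ext i
  have := congrFun h i
  simpa [expVec] using this

theorem ofPoly_injective : Function.Injective (ofPoly (n := n) ℂ) := by
  intro P Q h
  ext d
  have key : ∀ P : MvPolynomial (Fin n) ℂ, (ofPoly ℂ P).coeff (toLex (expVec d)) = P.coeff d := by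
    intro P
    induction P using MvPolynomial.induction_on' with
    | monomial d' c =>
      rw [coeff_ofPoly_monomial, MvPolynomial.coeff_monomial]
      simp only [expVec_injective.eq_iff, eq_comm]
    | add P Q hP hQ => rw [map_add, HahnSeries.coeff_add, hP, hQ, MvPolynomial.coeff_add]
  rw [← key, ← key, h]

/-- A series with finitely many monomials, all with nonnegative exponents, is a polynomial. -/
theorem exists_eq_ofPoly (f : IterLaurent n ℂ) (N : ℤ)
    (h : ∀ p : Fin n → ℤ, f.coeff (toLex p) ≠ 0 → ∀ i, 0 ≤ p i ∧ p i ≤ N) :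
    ∃ P, f = ofPoly ℂ P := by
  classical
  refine ⟨∑ q ∈ Fintype.piFinset (fun _ : Fin n => Icc 0 N),
    MvPolynomial.monomial (Finsupp.equivFunOnFinite.symm fun i => (q i).toNat)
      (f.coeff (toLex q)), ?_⟩
  apply HahnSeries.ext
  funext p
  obtain ⟨p, rfl⟩ := toLex.surjective p
  rw [map_sum, HahnSeries.coeff_sum]
  have e : ∀ q ∈ Fintype.piFinset (fun _ : Fin n => Icc 0 N),
      (ofPoly ℂ (MvPolynomial.monomial (Finsupp.equivFunOnFinite.symm fun i => (q i).toNat)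
        (f.coeff (toLex q)))).coeff (toLex p) = if p = q then f.coeff (toLex q) else 0 := by
    intro q hq
    have : expVec (Finsupp.equivFunOnFinite.symm fun i => (q i).toNat) = q := by
      funext i
      have := (mem_Icc.mp (Fintype.mem_piFinset.mp hq i)).1
      simp [expVec, this]
    rw [coeff_ofPoly_monomial, this]
  rw [sum_congr rfl e, sum_ite_eq]
  split_ifs with hp
  · rfl
  · by_contra h1
    exact hp (Fintype.mem_piFinset.mpr fun i => mem_Icc.mpr (h p h1 i))

/-- The coefficient of `u ^ m` as a linear map. -/
def coeffLin (m : ℤ) : USeries →ₗ[ℂ] ℂ where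
  toFun := USeries.coeffHom m
  map_add' := map_add _
  map_smul' c a := by
    rw [Algebra.smul_def, algebraMap_eq_uMono]
    exact HahnSeries.coeff_single_zero_mul (Γ := ℤ) (R := ℂ)

theorem uCoeff_ofPoly_mul (m : ℤ) (P : MvPolynomial (Fin n) ℂ) (F : IterLaurent n USeries) :
    uCoeff m (ofPoly USeries P * F) = ofPoly ℂ P * uCoeff m F := by
  apply HahnSeries.ext
  funext p
  obtain ⟨p, rfl⟩ := toLex.surjective p
  rw [coeff_ofPoly_mul, uCoeff, HahnSeries.map_coeff, coeff_ofPoly_mul]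
  exact (act_comp (coeffLin m) P _ p).symm

end Action

/-! ### Symmetry -/

section Symmetry

variable {r : ℕ} [NeZero r] {K : Type*} [AddCommGroup K] {κ : K}

/-- The factor `∏ (z_i + z_j)` is a product over unordered pairs, so it is compatible with
permutations although the pairs are indexed by `i < j`. -/
theorem rename_pairFactor {n : ℕ} (x : Fin n → Ext r K κ) (σ : Equiv.Perm (Fin n)) :
    MvPolynomial.rename σ (pairFactor (x ∘ σ)) = pairFactor x := by
  classical
  -- the increasing representative of an unordered pair
  let sort : Fin n × Fin n → Fin n × Fin n := fun q => if q.1 < q.2 then q else (q.2, q.1)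
  have hmem : ∀ (y : Fin n → Ext r K κ) (τ : Equiv.Perm (Fin n)) (q : Fin n × Fin n),
      q.1 < q.2 ∧ y (τ q.1) + y (τ q.2) = 0 →
      (sort (τ q.1, τ q.2)).1 < (sort (τ q.1, τ q.2)).2 ∧
        y (sort (τ q.1, τ q.2)).1 + y (sort (τ q.1, τ q.2)).2 = 0 := by
    rintro y τ q ⟨h1, h2⟩
    have hne : τ q.1 ≠ τ q.2 := fun h => h1.ne (τ.injective h)
    by_cases h : τ q.1 < τ q.2
    · simp only [sort, if_pos h]
      exact ⟨h, h2⟩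
    · simp only [sort, if_neg h]
      exact ⟨lt_of_le_of_ne (not_lt.mp h) hne.symm, by rw [add_comm]; exact h2⟩
  have hinv : ∀ (τ : Equiv.Perm (Fin n)) (q : Fin n × Fin n), q.1 < q.2 →
      sort (τ.symm (sort (τ q.1, τ q.2)).1, τ.symm (sort (τ q.1, τ q.2)).2) = q := by
    intro τ q hq
    by_cases h : τ q.1 < τ q.2
    · simp [sort, h, hq]
    · simp [sort, h, hq.not_gt]
  unfold pairFactor
  rw [map_prod]
  refine prod_nbij' (fun q => sort (σ q.1, σ q.2)) (fun q => sort (σ.symm q.1, σ.symm q.2))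
    ?_ ?_ ?_ ?_ ?_
  · intro q hq
    simp only [mem_filter, mem_univ, true_and] at hq ⊢
    exact hmem x σ q hq
  · intro q hq
    simp only [mem_filter, mem_univ, true_and] at hq ⊢
    exact hmem (x ∘ σ) σ.symm q (by simpa using hq)
  · intro q hq
    simp only [mem_filter, mem_univ, true_and] at hq
    exact hinv σ q hq.1
  · intro q hq
    simp only [mem_filter, mem_univ, true_and] at hq
    exact hinv σ.symm q hq.1
  · intro q _
    simp only [map_add, MvPolynomial.rename_X, sort]
    split_ifs
    · rfl
    · exact add_comm _ _

variable [Finite K]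

/-- The coefficients of the vacuum expectation multiplied by `∏ (z_i + z_j)`. -/
def clearedCorrel (ρ : AddChar K ℂ → ℂ) {n : ℕ} (x : Fin n → Ext r K κ) : (Fin n → ℤ) → USeries :=
  act (pairFactor x) (correl ρ x)

theorem coeff_cleared (ρ : AddChar K ℂ → ℂ) {n : ℕ} (x : Fin n → Ext r K κ) (p : Fin n → ℤ) :
    (cleared x (correlSeries ρ x)).coeff (toLex p) = clearedCorrel ρ x p :=
  coeff_ofPoly_mul _ _ _

/-- Exchanging two adjacent operators changes the vacuum expectation by a multiple of the
commutator. -/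
theorem exists_correl_sub_eq (ρ : AddChar K ℂ → ℂ) {n : ℕ} (x : Fin (n + 1) → Ext r K κ)
    (i : Fin n) (p : Fin (n + 1) → ℤ) : ∃ w : USeries, ∀ p' : Fin (n + 1) → ℤ,
      (∀ j, j ≠ i.castSucc → j ≠ i.succ → p' j = p j) →
      correl ρ x p' - correl ρ (x ∘ Equiv.swap i.castSucc i.succ)
          (p' ∘ Equiv.swap i.castSucc i.succ) =
        stateBracket ρ (x i.castSucc) (x i.succ) (p' i.castSucc) (p' i.succ) * w := by
  obtain ⟨P, Q, h⟩ := exists_opProd_eq (fun j => stateOp ρ (x j) (p j)) i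
  refine ⟨(P * Q) (Finsupp.single (vacState K) 1) (vacState K), fun p' hp' => ?_⟩
  rw [correl, correl, h _ fun j h1 h2 => by rw [hp' j h1 h2], h]
  · simp only [Function.comp_apply, Equiv.swap_apply_left, Equiv.swap_apply_right]
    rw [stateOp_commutator, mul_add, add_mul, LinearMap.add_apply, Finsupp.add_apply,
      add_sub_cancel_left, mul_smul_comm, smul_mul_assoc, mul_one, LinearMap.smul_apply,
      Finsupp.smul_apply, smul_eq_mul]
  · intro j h1 h2
    simp only [Function.comp_apply, Equiv.swap_apply_of_ne_of_ne h1 h2]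
    rw [hp' j h1 h2]

/-- The effect of exchanging two adjacent operators is annihilated by `∏ (z_i + z_j)`: it vanishes
unless this product contains the factor `z_i + z_{i+1}`, which annihilates the commutator. -/
theorem act_pairFactor_correl_sub {ρ : AddChar K ℂ → ℂ} (hρ : ∀ γ, ρ γ ^ r = γ (-κ) * (r : ℂ))
    {n : ℕ} (x : Fin (n + 1) → Ext r K κ) (i : Fin n) :
    act (pairFactor x) (fun p => correl ρ x p - correl ρ (x ∘ Equiv.swap i.castSucc i.succ)
      (p ∘ Equiv.swap i.castSucc i.succ)) = 0 := by
  set D : (Fin (n + 1) → ℤ) → USeries := fun p => correl ρ x p -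
    correl ρ (x ∘ Equiv.swap i.castSucc i.succ) (p ∘ Equiv.swap i.castSucc i.succ) with hD
  have hlt : i.castSucc < i.succ := Fin.castSucc_lt_succ
  by_cases hx : x i.castSucc + x i.succ = 0
  · have h0 : act (MvPolynomial.X i.castSucc + MvPolynomial.X i.succ) D = 0 := by
      funext p
      obtain ⟨w, hw⟩ := exists_correl_sub_eq ρ x i p
      have h1 := hw (p - Pi.single i.castSucc 1) fun j hj _ => by simp [hj]
      have h2 := hw (p - Pi.single i.succ 1) fun j _ hj => by simp [hj]
      rw [act_add, Pi.add_apply, act_X, act_X]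
      refine (congrArg₂ (· + ·) h1 h2).trans ?_
      simp only [Pi.sub_apply, Pi.single_eq_same, Pi.single_eq_of_ne hlt.ne,
        Pi.single_eq_of_ne hlt.ne', sub_zero]
      rw [← add_mul, stateBracket_add, zero_mul]
      rfl
    obtain ⟨Q, hQ⟩ : MvPolynomial.X i.castSucc + MvPolynomial.X i.succ ∣ pairFactor x := by
      classical
      exact dvd_prod_of_mem (fun q : Fin (n + 1) × Fin (n + 1) =>
        (MvPolynomial.X q.1 + MvPolynomial.X q.2 : MvPolynomial (Fin (n + 1)) ℂ))
        (a := (i.castSucc, i.succ)) (by simpa using hx)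
    rw [hQ, mul_comm, act_mul, h0, map_zero]
  · have h0 : D = 0 := by
      funext p
      obtain ⟨w, hw⟩ := exists_correl_sub_eq ρ x i p
      refine (hw p fun _ _ _ => rfl).trans ?_
      rw [stateBracket_eq_zero hρ hx, zero_mul]
      rfl
    rw [h0, map_zero]

theorem clearedCorrel_swap {ρ : AddChar K ℂ → ℂ} (hρ : ∀ γ, ρ γ ^ r = γ (-κ) * (r : ℂ))
    {n : ℕ} (x : Fin (n + 1) → Ext r K κ) (i : Fin n) (p : Fin (n + 1) → ℤ) :
    clearedCorrel ρ (x ∘ Equiv.swap i.castSucc i.succ) (p ∘ Equiv.swap i.castSucc i.succ) =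
      clearedCorrel ρ x p := by
  have h := congrFun (act_pairFactor_correl_sub hρ x i) p
  have e : (fun p => correl ρ x p - correl ρ (x ∘ Equiv.swap i.castSucc i.succ)
      (p ∘ Equiv.swap i.castSucc i.succ)) = correl ρ x - fun p =>
      correl ρ (x ∘ Equiv.swap i.castSucc i.succ) (p ∘ Equiv.swap i.castSucc i.succ) := rfl
  rw [e, map_sub, Pi.sub_apply] at h
  rw [clearedCorrel, clearedCorrel, ← act_rename, rename_pairFactor]
  exact (sub_eq_zero.mp h).symm

/-- The adjacent transpositions generate the symmetric group. -/
theorem clearedCorrel_perm {ρ : AddChar K ℂ → ℂ} (hρ : ∀ γ, ρ γ ^ r = γ (-κ) * (r : ℂ))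
    {n : ℕ} (x : Fin n → Ext r K κ) (σ : Equiv.Perm (Fin n)) (p : Fin n → ℤ) :
    clearedCorrel ρ (x ∘ σ) (p ∘ σ) = clearedCorrel ρ x p := by
  cases n with
  | zero => rw [Subsingleton.elim (x ∘ σ) x, Subsingleton.elim (p ∘ σ) p]
  | succ n =>
    have hσ : σ ∈ Submonoid.closure
        (Set.range fun i : Fin n => Equiv.swap i.castSucc i.succ) := by
      rw [Equiv.Perm.mclosure_swap_castSucc_succ]
      exact Submonoid.mem_top σ
    induction hσ using Submonoid.closure_induction generalizing x p with
    | mem τ hτ =>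
      obtain ⟨i, rfl⟩ := hτ
      exact clearedCorrel_swap hρ x i p
    | one => rfl
    | mul σ τ _ _ h1 h2 =>
      rw [Equiv.Perm.coe_mul, ← Function.comp_assoc, ← Function.comp_assoc, h2, h1]

/-- By symmetry, each variable may be moved to the first position, where the left vacuum bounds
its exponent below. -/
theorem exponent_bound_of_clearedCorrel_ne_zero {ρ : AddChar K ℂ → ℂ}
    (hρ : ∀ γ, ρ γ ^ r = γ (-κ) * (r : ℂ)) {n : ℕ} {x : Fin n → Ext r K κ} {p : Fin n → ℤ}
    (h : clearedCorrel ρ x p ≠ 0) (i : Fin n) : 0 ≤ p i ∨ (x i = 0 ∧ p i = -1) := by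
  cases n with
  | zero => exact i.elim0
  | succ n =>
    rw [← clearedCorrel_perm hρ x (Equiv.swap 0 i) p] at h
    obtain ⟨d, _, hd⟩ := exists_of_act_ne_zero h
    have h1 := first_exponent_bound hd
    have h2 : (0 : ℤ) ≤ expVec d 0 := Int.natCast_nonneg _
    simp only [Pi.sub_apply, Function.comp_apply, Equiv.swap_apply_left] at h1
    rcases h1 with h1 | ⟨h1, h3⟩
    · exact Or.inl (by omega)
    · by_cases h4 : 0 ≤ p i
      · exact Or.inl h4
      · exact Or.inr ⟨h1, by omega⟩

/-- For a given power of `u`, the exponents are bounded above. -/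
theorem exists_exponent_le {ρ : AddChar K ℂ → ℂ} (hρ : ∀ γ, ρ γ ^ r = γ (-κ) * (r : ℂ))
    {n : ℕ} (x : Fin n → Ext r K κ) (m : ℤ) : ∃ N : ℤ, ∀ p : Fin n → ℤ,
      USeries.coeffHom m (clearedCorrel ρ x p) ≠ 0 → ∀ i, p i ≤ N := by
  cases n with
  | zero => exact ⟨0, fun _ _ i => i.elim0⟩
  | succ n =>
    -- the bound for `i` is the one of `last_exponent_bound`, with the `i`-th variable moved to the
    -- last position, plus the degree of the polynomial multiplying the expectation
    let B : Fin (n + 1) → ℤ := fun i =>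
      (pairFactor (x ∘ Equiv.swap (Fin.last n) i)).totalDegree + |2 * (m + n) + 1|
    have hB : ∀ i, 0 ≤ B i := fun i => by positivity
    refine ⟨∑ i, B i, fun p hp i => ?_⟩
    refine le_trans ?_ (single_le_sum (f := B) (fun j _ => hB j) (mem_univ i))
    rw [← clearedCorrel_perm hρ x (Equiv.swap (Fin.last n) i) p, clearedCorrel] at hp
    have hp' := (act_comp (coeffLin m) _ _ _).trans_ne hp
    obtain ⟨d, hd, h1⟩ := exists_of_act_ne_zero hp'
    have h2 := last_exponent_bound h1
    simp only [Pi.sub_apply, Function.comp_apply, Equiv.swap_apply_left] at h2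
    have h3 : d (Fin.last n) ≤ (pairFactor (x ∘ Equiv.swap (Fin.last n) i)).totalDegree :=
      (Finsupp.le_degree (Fin.last n) d).trans (MvPolynomial.le_totalDegree hd)
    have h4 : expVec d (Fin.last n) ≤
        (pairFactor (x ∘ Equiv.swap (Fin.last n) i)).totalDegree :=
      Int.ofNat_le.mpr h3
    have h5 := le_abs_self (2 * (m + n) + 1)
    simp only [B]
    omega

theorem clearedCorrel_mem_laurentPoly (ρ : AddChar K ℂ → ℂ) {n : ℕ} (x : Fin n → Ext r K κ)
    (p : Fin n → ℤ) : clearedCorrel ρ x p ∈ laurentPoly := by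
  rw [clearedCorrel, act_apply_eq_sum]
  refine Subring.sum_mem _ fun d _ => ?_
  rw [Algebra.smul_def]
  refine Subring.mul_mem _ ?_ (correl_mem_laurentPoly ρ x _)
  refine (Set.finite_singleton 0).subset ?_
  intro m hm
  rw [algebraMap_eq_uMono] at hm
  exact coeffHom_uMono_ne_zero hm

omit [Finite K] in
open Classical in
theorem zeroFactor_eq {n : ℕ} (x : Fin n → Ext r K κ) : zeroFactor x =
    MvPolynomial.monomial (∑ i with x i = 0, Finsupp.single i 1) 1 := by
  rw [zeroFactor, MvPolynomial.monomial_sum_one]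
  rfl

omit [Finite K] in
theorem ofPoly_factor_ne_zero {n : ℕ} (x : Fin n → Ext r K κ) :
    ofPoly ℂ (pairFactor x * zeroFactor x) ≠ 0 := by
  rw [Ne, map_eq_zero_iff _ ofPoly_injective]
  intro h
  have h1 := congrArg (MvPolynomial.eval fun _ => (1 : ℂ)) h
  rw [map_mul, pairFactor, zeroFactor, map_prod, map_prod, map_zero] at h1
  simp only [map_add, MvPolynomial.eval_X, prod_const_one, mul_one] at h1
  exact prod_ne_zero_iff.mpr (fun _ _ => by norm_num) h1

/-- After multiplication by `∏ z_i`, the exponents of a given power of `u` are bounded below by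
`0` and above by `exists_exponent_le`, so that only a polynomial remains. -/
theorem exists_uCoeff_eq {ρ : AddChar K ℂ → ℂ} (hρ : ∀ γ, ρ γ ^ r = γ (-κ) * (r : ℂ))
    {n : ℕ} (x : Fin n → Ext r K κ) (m : ℤ) : ∃ P : MvPolynomial (Fin n) ℂ,
      uCoeff m (correlSeries ρ x) = ofPoly ℂ P / ofPoly ℂ (pairFactor x * zeroFactor x) := by
  classical
  obtain ⟨N, hN⟩ := exists_exponent_le hρ x m
  obtain ⟨P, hP⟩ := exists_eq_ofPoly
    (ofPoly ℂ (pairFactor x * zeroFactor x) * uCoeff m (correlSeries ρ x)) (|N| + 1) (by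
      intro p hp i
      rw [← uCoeff_ofPoly_mul, mul_comm (pairFactor x), map_mul, mul_assoc, uCoeff,
        HahnSeries.map_coeff] at hp
      have e : (ofPoly USeries (zeroFactor x) * (ofPoly USeries (pairFactor x) *
          correlSeries ρ x)).coeff (toLex p) =
          clearedCorrel ρ x (p - expVec (∑ i with x i = 0, Finsupp.single i 1)) := by
        rw [coeff_ofPoly_mul, zeroFactor_eq, act_monomial, one_smul]
        exact coeff_cleared ρ x _
      rw [e] at hp
      have h1 := hN _ hp i
      have h2 := exponent_bound_of_clearedCorrel_ne_zero hρ (fun h => hp (by rw [h, map_zero])) i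
      have h3 : expVec (∑ i with x i = 0, Finsupp.single i 1) i = if x i = 0 then 1 else 0 := by
        simp [expVec, Finsupp.finsetSum_apply, Finsupp.single_apply]
      rw [Pi.sub_apply, h3] at h1 h2
      have h4 := le_abs_self N
      split_ifs at h1 h2 with h5
      · omega
      · rcases h2 with h2 | h2
        · omega
        · exact absurd h2.1 h5)
  exact ⟨P, by rw [eq_div_iff (ofPoly_factor_ne_zero x), mul_comm, hP]⟩

end Symmetry

end OrbiFock

end

theorem mainTheorem9 (r : ℕ) [NeZero r] (K : Type*) [AddCommGroup K] [Finite K] (κ : K)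
    (ρ : AddChar K ℂ → ℂ) (hρ : ∀ γ, ρ γ ^ r = γ (-κ) * (r : ℂ)) (n : ℕ) :
    ∃ F : (Fin n → OrbiFock.Ext r K κ) → OrbiFock.IterLaurent n OrbiFock.USeries,
      (∀ x, OrbiFock.IsVacuumExpectation ρ x (F x)) ∧
      -- the `u`-coefficients are rational functions with the stated poles
      (∀ x, ∀ m : ℤ, ∃ P : MvPolynomial (Fin n) ℂ,
        OrbiFock.uCoeff m (F x) = OrbiFock.ofPoly ℂ P /
          OrbiFock.ofPoly ℂ (OrbiFock.pairFactor x * OrbiFock.zeroFactor x)) ∧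
      -- independence of the ordering
      (∀ x, ∀ σ : Equiv.Perm (Fin n), ∀ p : Fin n → ℤ,
        (OrbiFock.cleared (x ∘ σ) (F (x ∘ σ))).coeff (toLex (p ∘ σ)) =
          (OrbiFock.cleared x (F x)).coeff (toLex p)) ∧
      -- membership in `∏_{x_i = 0} z_i⁻¹ · ℂ[u, u⁻¹][[z_1, …, z_n]]`
      (∀ x, ∀ p : Fin n → ℤ,
        {m : ℤ | OrbiFock.USeries.coeffHom m
          ((OrbiFock.cleared x (F x)).coeff (toLex p)) ≠ 0}.Finite ∧
        ((OrbiFock.cleared x (F x)).coeff (toLex p) ≠ 0 →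
          ∀ i, 0 ≤ p i ∨ (x i = 0 ∧ p i = -1))) := by
  refine ⟨OrbiFock.correlSeries ρ, OrbiFock.isVacuumExpectation_correlSeries ρ,
    OrbiFock.exists_uCoeff_eq hρ, fun x σ p => ?_, fun x p => ⟨?_, fun h => ?_⟩⟩
  · rw [OrbiFock.coeff_cleared, OrbiFock.coeff_cleared]
    exact OrbiFock.clearedCorrel_perm hρ x σ p
  · rw [OrbiFock.coeff_cleared]
    exact OrbiFock.clearedCorrel_mem_laurentPoly ρ x p
  · rw [OrbiFock.coeff_cleared] at h
    exact OrbiFock.exponent_bound_of_clearedCorrel_ne_zero hρ h
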